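/- **Setting.** Let $Q$ be a finite-dimensional smooth (Hausdorff) manifold, $L:TQ\times\mathbb R\to\mathbb R$ a smooth regular Lagrangian (the Hessian $\partial^2L/\partial\dot q^i\partial\dot q^j$ is nondegenerate everywhere), and $h>0$. Let $\mathbb FL(q,\dot q,z)=(q,\partial L/\partial\dot q,z)\in T^*Q\times\mathbb R$, $\eta_L=\mathrm dz-\frac{\partial L}{\partial\dot q^i}\mathrm dq^i$, $E_L=\dot q^i\frac{\partial L}{\partial\dot q^i}-L$, $\eta_Q=\mathrm dz-p_i\,\mathrm dq^i$. For a contact form $\eta$ with Reeb field $\mathcal R$, the contact Hamiltonian vector field $X_f$ of $f$ is defined by $\iota_{X_f}\mathrm d\eta+\eta(X_f)\eta=\mathrm df-(f+\mathcal R(f))\eta$. Let $\xi_L=X_{E_L}$ with respect to $\eta_L$, with flow $\phi^{\xi_L}_t$, and let $U_h\subseteq TQ\times\mathbb R$ be the set of points from which $\phi_t^{\xi_L}$ is defined for $t\in[0,h]$. The contact exponential map $\exp_h:U_h\to Q\times Q\times\mathbb R$ sends $(q_0,\dot q_0,z_0)$ to $(q_0,q_1,z_0)$, where $q_1$ is the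 base point of $\phi^{\xi_L}_h(q_0,\dot q_0,z_0)$. Let $V\subseteq U_h$ be any open set on which $\exp_h$ is a diffeomorphism onto an open set $D\subseteq Q\times Q\times\mathbb R$, let $R:D\to V$ be its inverse, and let $$L^e_h(q_0,q_1,z_0)=\int_0^h L\bigl(\phi_t^{\xi_L}(R(q_0,q_1,z_0))\bigr)\,\mathrm dt,\qquad (q_0,q_1,z_0)\in D,$$ be the corresponding exact discrete Lagrangian. For a discrete Lagrangian $L_d$ on $D$ put $$\mathbb F^+L_d(q_0,q_1,z_0)=(q_1,D_2L_d,z_0+L_d),\qquad \mathbb F^-L_d(q_0,q_1,z_0)=\Bigl(q_0,-\frac{D_1L_d}{1+D_zL_d},z_0\Bigr),$$ the right-hand sides being evaluated at $(q_0,q_1,z_0)$. **Theorem.** 1. $L^e_h$ is a regular discrete Lagrangian on $D$: it is smooth, $1+D_zL^e_h$ does not vanish on $D$, and $\mathbb F^-L^e_h:D\to T^*Q\times\mathbb R$ is a local diffeomorphism. 2. Let $O\subseteq TQ\times\mathbb R$ be open and let $H$ be a Hamiltonian function on the open set $\mathbb FL(O)\subseteq T^*Q\times\mathbb R$ with $H\circ\mathbb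 FL=E_L$ on $O$; let $\phi^{X_H}_t$ be the flow on $\mathbb FL(O)$ of its contact Hamiltonian vector field with respect to $\eta_Q$. Then for every $p\in D$ with $\phi_t^{\xi_L}(R(p))\in O$ for all $t\in[0,h]$, $\phi^{X_H}_t$ is defined at $\mathbb F^-L_h^e(p)$ for $t\in[0,h]$ and $$\mathbb F^+L^e_h(p)=\phi_h^{X_H}\bigl(\mathbb F^-L^e_h(p)\bigr).$$ In particular, if $L$ is hyperregular ($\mathbb FL$ is a global diffeomorphism) and $H=E_L\circ\mathbb FL^{-1}$, then $\mathbb F^+L^e_h=\phi^{X_H}_h\circ\mathbb F^-L^e_h$ on $D$. 3. Let $N\ge1$ and let $(q,z):[0,Nh]\to Q\times\mathbb R$ (with $q$ of class $C^2$) be a solution of the Herglotz equations $$\frac{\mathrm d}{\mathrm dt}\frac{\partial L}{\partial\dot q^i}-\frac{\partial L}{\partial q^i}=\frac{\partial L}{\partial\dot q^i}\frac{\partial L}{\partial z},\qquad \dot z=L(q,\dot q,z).$$ A discrete solution means a sequence $(q_0,z_0),\dots,(q_N,z_N)$ with $(q_k,q_{k+1},z_k)\in D$ and $z_{k+1}-z_k=L_h^e(q_k,q_{k+1},z_k)$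 for $0\le k<N$, which solves the discrete Herglotz equations $$D_1L^e_h(q_k,q_{k+1},z_k)+\bigl(1+D_zL^e_h(q_k,q_{k+1},z_k)\bigr)D_2L^e_h(q_{k-1},q_k,z_{k-1})=0,\qquad 1\le k\le N-1.$$ (a) If $(q,\dot q,z)(kh)\in V$ for $0\le k<N$, then $q_k=q(kh)$, $z_k=z(kh)$ $(0\le k\le N)$ is a discrete solution. It is locally unique: there are open neighbourhoods $U_k$ of the points $(q(kh),q((k+1)h),z(kh))$, $0\le k<N$, such that every discrete solution with initial conditions $(q_0,q_1,z_0)=(q(0),q(h),z(0))$ and $(q_k,q_{k+1},z_k)\in U_k$ for all $0\le k<N$ satisfies $q_k=q(kh)$ and $z_k=z(kh)$ for $0\le k\le N$. (b) If $\mathbb FL$ is injective (for instance, if $L$ is hyperregular) and $(q,\dot q,z)(0)\in V$, then every discrete solution with initial conditions $(q_0,q_1,z_0)=(q(0),q(h),z(0))$ satisfies $q_k=q(kh)$ and $z_k=z(kh)$ for $0\le k\le N$. -/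

import Mathlib

open Set Filter Topology
open scoped Manifold ContDiff

noncomputable section

/-! ### Contact geometry of a one-form on a manifold -/

section Contact

variable {V : Type*} [NormedAddCommGroup V] [NormedSpace ℝ V]
  {H : Type*} [TopologicalSpace H] (I : ModelWithCorners ℝ V H)
  {M : Type*} [TopologicalSpace M] [ChartedSpace H M]

/-- The differential of a real function, as a one-form. -/
def differential (f : M → ℝ) (x : M) : TangentSpace I x →L[ℝ] ℝ :=
  mfderiv I 𝓘(ℝ, ℝ) f x

/-- The expression of a one-form in the chart centred at `x₀`: its pullback to the model vector
space along the inverse of the chart. -/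
def oneFormInChart (η : (x : M) → TangentSpace I x →L[ℝ] ℝ) (x₀ : M) (y : V) : V →L[ℝ] ℝ :=
  (η ((extChartAt I x₀).symm y)).comp (mfderiv 𝓘(ℝ, V) I (extChartAt I x₀).symm y)

/-- The exterior derivative `dη (v, w)` at `x` of a one-form on a manifold without boundary, computed
in the chart centred at `x` as the antisymmetrised derivative of the form. -/
def extDerivOneForm (η : (x : M) → TangentSpace I x →L[ℝ] ℝ) (x : M)
    (v w : TangentSpace I x) : ℝ :=
  fderiv ℝ (oneFormInChart I η x) (extChartAt I x x)
      (mfderiv I 𝓘(ℝ, V) (extChartAt I x) x v) (mfderiv I 𝓘(ℝ, V) (extChartAt I x) x w)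
    - fderiv ℝ (oneFormInChart I η x) (extChartAt I x x)
      (mfderiv I 𝓘(ℝ, V) (extChartAt I x) x w) (mfderiv I 𝓘(ℝ, V) (extChartAt I x) x v)

/-- The map `♭ v = ι_v dη + η(v) η`, evaluated at `w`. -/
def flat (η : (x : M) → TangentSpace I x →L[ℝ] ℝ) (x : M) (v w : TangentSpace I x) : ℝ :=
  extDerivOneForm I η x v w + η x v * η x w

/-- The Reeb vector field: the (for a contact form, unique) solution of
`ι_R dη = 0`, `η(R) = 1`. -/
def reeb (η : (x : M) → TangentSpace I x →L[ℝ] ℝ) (x : M) : TangentSpace I x :=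
  Classical.epsilon fun v : TangentSpace I x =>
    (∀ w, extDerivOneForm I η x v w = 0) ∧ η x v = 1

/-- The contact Hamiltonian vector field `X_f`: the (for a contact form, unique) solution of
`♭ (X_f) = df - (f + R(f)) η`. -/
def contactHamVF (η : (x : M) → TangentSpace I x →L[ℝ] ℝ) (f : M → ℝ) (x : M) :
    TangentSpace I x :=
  Classical.epsilon fun v : TangentSpace I x =>
    ∀ w, flat I η x v w =
      differential I f x w - (f x + differential I f x (reeb I η x)) * η x w

/-- `γ` is an integral curve of the vector field `X` restricted to `W`, starting at `x` and
defined on an open interval that contains `[0, t]`. -/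
def IsFlowLine (X : (x : M) → TangentSpace I x) (W : Set M) (t : ℝ) (x : M) (γ : ℝ → M) : Prop :=
  γ 0 = x ∧ ∃ ε > 0, (∀ s ∈ Ioo (-ε) (t + ε), γ s ∈ W) ∧
    IsMIntegralCurveOn (I := I) γ X (Ioo (-ε) (t + ε))

/-- The points of `W` from which the flow of `X` on `W` is defined on `[0, t]` (for `0 ≤ t`). -/
def flowDomain (X : (x : M) → TangentSpace I x) (W : Set M) (t : ℝ) : Set M :=
  {x | ∃ γ, IsFlowLine I X W t x γ}

open Classical in
/-- The flow of `X` on `W` at the time `t ≥ 0`; the junk value `x` is taken off the flow domain. -/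
def flowMap (X : (x : M) → TangentSpace I x) (W : Set M) (t : ℝ) (x : M) : M :=
  if hx : ∃ γ, IsFlowLine I X W t x γ then hx.choose t else x

end Contact

/-! ### Contact Lagrangian systems -/

section Lagrangian

variable {E : Type*} [NormedAddCommGroup E] [NormedSpace ℝ E]
  {Q : Type*} [TopologicalSpace Q] [ChartedSpace E Q]

variable (E Q) in
/-- The extended phase space `TQ × ℝ`. -/
abbrev ExtTangent [IsManifold 𝓘(ℝ, E) ∞ Q] : Type _ := TangentBundle 𝓘(ℝ, E) Q × ℝ

variable (E Q) in
/-- The extended cotangent bundle `T*Q × ℝ`. -/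
abbrev ExtCotangent [IsManifold 𝓘(ℝ, E) ∞ Q] : Type _ :=
  Bundle.TotalSpace (E →L[ℝ] ℝ)
    (fun q : Q => TangentSpace 𝓘(ℝ, E) q →L[ℝ] Bundle.Trivial Q ℝ q) × ℝ

variable (E) in
/-- The model with corners of `TQ × ℝ`. -/
abbrev modelTR := (𝓘(ℝ, E).prod 𝓘(ℝ, E)).prod 𝓘(ℝ, ℝ)

variable (E) in
/-- The model with corners of `T*Q × ℝ`. -/
abbrev modelCR := (𝓘(ℝ, E).prod 𝓘(ℝ, E →L[ℝ] ℝ)).prod 𝓘(ℝ, ℝ)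

variable (E) in
/-- The model with corners of `Q × Q × ℝ`. -/
abbrev modelQQR := 𝓘(ℝ, E).prod (𝓘(ℝ, E).prod 𝓘(ℝ, ℝ))

variable [IsManifold 𝓘(ℝ, E) ∞ Q]

/-- The derivative of `L` along the fibre of `TQ`, i.e. the covector `∂L/∂q̇`. -/
def fibreDeriv (L : ExtTangent E Q → ℝ) (q : Q) (v : TangentSpace 𝓘(ℝ, E) q) (z : ℝ) :
    TangentSpace 𝓘(ℝ, E) q →L[ℝ] ℝ :=
  fderiv ℝ (fun w : E => L (⟨q, w⟩, z)) v

/-- The Lagrangian is regular: its Hessian with respect to the velocities is a nondegenerate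
bilinear form at every point. -/
def IsRegularLagrangian (L : ExtTangent E Q → ℝ) : Prop :=
  ∀ (q : Q) (v : E) (z : ℝ) (u : E),
    (∀ w : E, fderiv ℝ (fun v' : E => fderiv ℝ (fun w' : E => L (⟨q, w'⟩, z)) v') v u w = 0) →
      u = 0

/-- The Legendre transformation `FL : TQ × ℝ → T*Q × ℝ`. -/
def legendre (L : ExtTangent E Q → ℝ) (x : ExtTangent E Q) : ExtCotangent E Q :=
  (⟨x.1.1, fibreDeriv L x.1.1 x.1.2 x.2⟩, x.2)

/-- The contact form `η_L = dz - θ_L` on `TQ × ℝ`, with `θ_L = S^*(dL) = (∂L/∂q̇) dq`. -/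
def etaL (L : ExtTangent E Q → ℝ) (x : ExtTangent E Q) : TangentSpace (modelTR E) x →L[ℝ] ℝ :=
  differential (modelTR E) (fun y : ExtTangent E Q => y.2) x -
    (fibreDeriv L x.1.1 x.1.2 x.2).comp
      (mfderiv (modelTR E) 𝓘(ℝ, E) (fun y : ExtTangent E Q => y.1.1) x)

/-- The canonical contact form `η_Q = dz - θ_Q` on `T*Q × ℝ`, with the tautological form
`θ_Q = p dq`. -/
def etaQ (x : ExtCotangent E Q) : TangentSpace (modelCR E) x →L[ℝ] ℝ :=
  differential (modelCR E) (fun y : ExtCotangent E Q => y.2) x -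
    ContinuousLinearMap.comp (x.1.2 : TangentSpace 𝓘(ℝ, E) x.1.1 →L[ℝ] ℝ)
      (mfderiv (modelCR E) 𝓘(ℝ, E) (fun y : ExtCotangent E Q => y.1.1) x)

/-- The energy `E_L = Δ(L) - L`. -/
def energy (L : ExtTangent E Q → ℝ) (x : ExtTangent E Q) : ℝ :=
  fibreDeriv L x.1.1 x.1.2 x.2 x.1.2 - L x

/-- The Lagrangian vector field `ξ_L = X_{E_L}` on `(TQ × ℝ, η_L)`. -/
def lagrangianVF (L : ExtTangent E Q → ℝ) (x : ExtTangent E Q) : TangentSpace (modelTR E) x :=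
  contactHamVF (modelTR E) (etaL L) (energy L) x

/-- The flow `φ_t` of `ξ_L`, for `t ≥ 0`. -/
def lagrangianFlow (L : ExtTangent E Q → ℝ) (t : ℝ) : ExtTangent E Q → ExtTangent E Q :=
  flowMap (modelTR E) (lagrangianVF L) univ t

/-- The contact Hamiltonian vector field `X_H` on `(T*Q × ℝ, η_Q)`. -/
def hamiltonianVF (H : ExtCotangent E Q → ℝ) (x : ExtCotangent E Q) :
    TangentSpace (modelCR E) x :=
  contactHamVF (modelCR E) etaQ H x

/-- The lift `t ↦ (q(t), q̇(t), z(t))` to `TQ × ℝ` of a curve in `Q × ℝ` defined on `s`. -/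
def velocityLift (s : Set ℝ) (q : ℝ → Q) (z : ℝ → ℝ) (t : ℝ) : ExtTangent E Q :=
  (⟨q t, mfderivWithin 𝓘(ℝ, ℝ) 𝓘(ℝ, E) q s t (1 : ℝ)⟩, z t)

/-- The Lagrangian in the bundle coordinates `(x, v, z)` of `TQ × ℝ` that are induced by the chart
of `Q` centred at `q₀`. -/
def lagrangianInChart (L : ExtTangent E Q → ℝ) (q₀ : Q) (x v : E) (z : ℝ) : ℝ :=
  L (⟨(extChartAt 𝓘(ℝ, E) q₀).symm x,
    mfderiv 𝓘(ℝ, E) 𝓘(ℝ, E) (extChartAt 𝓘(ℝ, E) q₀).symm x v⟩, z)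

/-- The curve `(q, z)` solves on `s` the Herglotz equations: `ż = L(q, q̇, z)` and, in the chart
centred at `q(t₀)` for each time `t₀`,
`d/dt (∂L/∂q̇) = ∂L/∂q + (∂L/∂q̇) (∂L/∂z)` at `t₀`. -/
structure IsHerglotzSolution (L : ExtTangent E Q → ℝ) (s : Set ℝ) (q : ℝ → Q) (z : ℝ → ℝ) :
    Prop where
  contMDiffOn : ContMDiffOn 𝓘(ℝ, ℝ) 𝓘(ℝ, E) 2 q s
  action : ∀ t ∈ s, HasDerivWithinAt z (L (velocityLift (E := E) s q z t)) s t
  herglotz : ∀ t₀ ∈ s,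
    let x : ℝ → E := fun t => extChartAt 𝓘(ℝ, E) (q t₀) (q t)
    let v : ℝ → E := fun t => derivWithin x s t
    let L' : E → E → ℝ → ℝ := lagrangianInChart L (q t₀)
    HasDerivWithinAt (fun t => fderiv ℝ (fun w : E => L' (x t) w (z t)) (v t))
      (fderiv ℝ (fun y : E => L' y (v t₀) (z t₀)) (x t₀) +
        deriv (fun ζ : ℝ => L' (x t₀) (v t₀) ζ) (z t₀) •
          fderiv ℝ (fun w : E => L' (x t₀) w (z t₀)) (v t₀)) s t₀

/-! ### Discrete contact mechanics -/

/-- `D₁ L_d`. -/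
def discD1 (Ld : Q × Q × ℝ → ℝ) (q₀ q₁ : Q) (z₀ : ℝ) : TangentSpace 𝓘(ℝ, E) q₀ →L[ℝ] ℝ :=
  differential 𝓘(ℝ, E) (fun q => Ld (q, q₁, z₀)) q₀

/-- `D₂ L_d`. -/
def discD2 (Ld : Q × Q × ℝ → ℝ) (q₀ q₁ : Q) (z₀ : ℝ) : TangentSpace 𝓘(ℝ, E) q₁ →L[ℝ] ℝ :=
  differential 𝓘(ℝ, E) (fun q => Ld (q₀, q, z₀)) q₁

/-- `σ_d = 1 + D_z L_d`. -/
def discSigma (Ld : Q × Q × ℝ → ℝ) (q₀ q₁ : Q) (z₀ : ℝ) : ℝ :=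
  1 + deriv (fun z => Ld (q₀, q₁, z)) z₀

/-- The discrete Legendre transform `F⁺L_d`. -/
def discLegendrePlus (Ld : Q × Q × ℝ → ℝ) (p : Q × Q × ℝ) : ExtCotangent E Q :=
  (⟨p.2.1, discD2 Ld p.1 p.2.1 p.2.2⟩, p.2.2 + Ld p)

/-- The discrete Legendre transform `F⁻L_d`. -/
def discLegendreMinus (Ld : Q × Q × ℝ → ℝ) (p : Q × Q × ℝ) : ExtCotangent E Q :=
  (⟨p.1, -(discSigma Ld p.1 p.2.1 p.2.2)⁻¹ • discD1 Ld p.1 p.2.1 p.2.2⟩, p.2.2)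

variable (E) in
/-- `L_d` is a (smooth) regular discrete Lagrangian on the open set `D`: `1 + D_z L_d` does not
vanish and `F⁻L_d` is a local diffeomorphism. -/
structure IsRegularDiscreteLagrangian (Ld : Q × Q × ℝ → ℝ) (D : Set (Q × Q × ℝ)) : Prop where
  isOpen : IsOpen D
  smooth : ContMDiffOn (modelQQR E) 𝓘(ℝ, ℝ) ∞ Ld D
  sigma_ne_zero : ∀ p ∈ D, discSigma Ld p.1 p.2.1 p.2.2 ≠ 0
  legendre : IsLocalDiffeomorphOn (modelQQR E) (modelCR E) ∞
    (discLegendreMinus (E := E) Ld : Q × Q × ℝ → ExtCotangent E Q) D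

variable (E) in
/-- The sequence `(q₀, z₀), …, (q_N, z_N)` solves the discrete Herglotz equations of a discrete
Lagrangian `L_d` that is defined on `D`. -/
structure IsDiscreteHerglotzSolution (Ld : Q × Q × ℝ → ℝ) (D : Set (Q × Q × ℝ)) (N : ℕ)
    (q : ℕ → Q) (z : ℕ → ℝ) : Prop where
  mem : ∀ k < N, (q k, q (k + 1), z k) ∈ D
  action : ∀ k < N, z (k + 1) - z k = Ld (q k, q (k + 1), z k)
  herglotz : ∀ k, k + 1 < N →
    discD1 (E := E) Ld (q (k + 1)) (q (k + 2)) (z (k + 1)) +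
      discSigma Ld (q (k + 1)) (q (k + 2)) (z (k + 1)) •
        discD2 (E := E) Ld (q k) (q (k + 1)) (z k) = 0

/-! ### The exact discrete Lagrangian -/

/-- The contact exponential map `(q₀, q̇₀, z₀) ↦ (q₀, q₁, z₀)`, with `q₁` the base point of
`φ_h (q₀, q̇₀, z₀)`. -/
def contactExp (L : ExtTangent E Q → ℝ) (h : ℝ) (x : ExtTangent E Q) : Q × Q × ℝ :=
  (x.1.1, (lagrangianFlow L h x).1.1, x.2)

/-- `R : D → V` is an exact retraction `R_h^{e-}`: `V` is an open subset of the domain `U_h` of the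
contact exponential map, on which this map is a diffeomorphism onto the open set `D`, and `R` is
the inverse diffeomorphism. -/
structure IsExactRetraction (L : ExtTangent E Q → ℝ) (h : ℝ) (V : Set (ExtTangent E Q))
    (D : Set (Q × Q × ℝ)) (R : Q × Q × ℝ → ExtTangent E Q) : Prop where
  isOpen_source : IsOpen V
  isOpen_target : IsOpen D
  source_subset : V ⊆ flowDomain (modelTR E) (lagrangianVF L) univ h
  mapsTo_exp : MapsTo (contactExp L h) V D
  mapsTo_inv : MapsTo R D V
  invOn : InvOn R (contactExp L h) V D
  smooth_exp : ContMDiffOn (modelTR E) (modelQQR E) ∞ (contactExp L h) V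
  smooth_inv : ContMDiffOn (modelQQR E) (modelTR E) ∞ R D

/-- The exact discrete Lagrangian `L_h^e (p) = ∫₀^h L (φ_t (R p)) dt`. -/
def exactDiscreteLagrangian (L : ExtTangent E Q → ℝ) (h : ℝ) (R : Q × Q × ℝ → ExtTangent E Q)
    (p : Q × Q × ℝ) : ℝ :=
  ∫ t in (0 : ℝ)..h, L (lagrangianFlow L t (R p))

end Lagrangian

end

/-!
The energy of a regular Lagrangian generates the Herglotz flow, and this flow is conformal for the
contact form: in bundle coordinates `(x, v, z)` of `TQ × ℝ` one has `η_L = dz - P dx` with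
`P = ∂L/∂v`, the contact Hamiltonian vector field `ξ_L` of the energy is the vector field of the
Herglotz equations (`IsContactRep.contactHamVF_eq`), and its Lie derivative satisfies
`𝓛_ξ η_L = (∂L/∂z) η_L` (`lieDeriv_coordForm`). Hence the time-`h` flow `φ` is smooth wherever it is
defined and `φ^* η_L = σ η_L` with a function `σ` without zeros
(`IsLocallyConformal.isConformalFlowAt`). The smooth dependence of flows on the initial value and
the variational equation that this needs are derived from the inverse function theorem in a space of
continuous curves (`exists_local_flow`).

Since `ż = L` along the flow lines, the exact discrete Lagrangian `S` is the increment of `z`. As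
the retraction `R` inverts the exponential map, `φ^* η_L = σ η_L`, pulled back along `R`, reads
`dz + dS - p₁ dq₁ = σ (dz - p₀ dq₀)` on `D`, where `p₀` and `p₁` are the momenta at the two ends of
the flow line (`IsExactRetraction.exists_conformal_factor`). Comparing coefficients gives
`D₂S = p₁`, `D₁S = -σ p₀` and `1 + D_z S = σ ≠ 0`, that is `F⁻S = FL ∘ R` and `F⁺S = FL ∘ φ ∘ R`
(`IsExactRetraction.discLegendre_eq`), on which everything else rests. `F⁻S` is a local
diffeomorphism because `FL` is one and `R` is a diffeomorphism. `FL` carries `ξ_L` to the contact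
Hamiltonian vector field of any Hamiltonian that corresponds to `L`, as the two are represented by
the same Herglotz vector field (`IsMIntegralCurveOn.legendre`); so the Legendre transforms of `S`
are related by the Hamiltonian flow.

The discrete Herglotz equations say `F⁻S(p_{k+1}) = F⁺S(p_k)`
(`discLegendreMinus_eq_discLegendrePlus_iff`), i.e. `FL (R p_{k+1}) = FL (φ (R p_k))`. The lift of a
solution of the Herglotz equations is an integral curve of `ξ_L`
(`IsHerglotzSolution.isMIntegralCurveOn`), so its samples satisfy this. Conversely, wherever `FL` is
injective, it forces `R p_{k+1} = φ (R p_k)`, and the discrete solution follows the continuous one.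
-/

/-! ### Smooth dependence of ordinary differential equations on initial values -/

section Superposition

universe u

variable {K : Type*} [TopologicalSpace K] [CompactSpace K]

/-- The pointwise application of a continuous family of linear maps, as a continuous linear map in
the family. -/
noncomputable def pointwiseApply (K : Type*) [TopologicalSpace K] [CompactSpace K]
    (F G : Type*) [NormedAddCommGroup F] [NormedSpace ℝ F] [NormedAddCommGroup G]
    [NormedSpace ℝ G] : C(K, F →L[ℝ] G) →L[ℝ] C(K, F) →L[ℝ] C(K, G) :=
  LinearMap.mkContinuous₂
    (LinearMap.mk₂ ℝ (fun (T : C(K, F →L[ℝ] G)) (η : C(K, F)) =>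
        (⟨fun t => T t (η t), by fun_prop⟩ : C(K, G)))
      (fun _ _ _ => by ext; simp) (fun _ _ _ => by ext; simp) (fun _ _ _ => by ext; simp)
      (fun _ _ _ => by ext; simp)) 1 (by
    intro T η
    rw [one_mul]
    refine (ContinuousMap.norm_le _ (by positivity)).2 fun t => ?_
    exact ((T t).le_opNorm _).trans
      (mul_le_mul (T.norm_coe_le_norm t) (η.norm_coe_le_norm t) (norm_nonneg _) (by positivity)))

@[simp] lemma pointwiseApply_apply {F G : Type*} [NormedAddCommGroup F] [NormedSpace ℝ F]
    [NormedAddCommGroup G] [NormedSpace ℝ G] (T : C(K, F →L[ℝ] G)) (η : C(K, F)) (t : K) :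
    pointwiseApply K F G T η t = T t (η t) := rfl

variable {F : Type u} [NormedAddCommGroup F] [NormedSpace ℝ F]

/-- The superposition operator of a `C^1` map is differentiable on the space of continuous maps on
a compact space. -/
lemma hasFDerivAt_superposition {G : Type u} [NormedAddCommGroup G] [NormedSpace ℝ G]
    (X : C(F, G)) (DX : C(F, F →L[ℝ] G)) (hX : ∀ x, HasFDerivAt X (DX x) x) (γ : C(K, F)) :
    HasFDerivAt (fun γ : C(K, F) => X.comp γ) (pointwiseApply K F G (DX.comp γ)) γ := by
  rw [hasFDerivAt_iff_isLittleO_nhds_zero, Asymptotics.isLittleO_iff]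
  intro c hc
  have hK : IsCompact (range γ) := isCompact_range γ.continuous
  have hu := hK.uniformContinuousAt_of_continuousAt DX (fun a _ => DX.continuous.continuousAt)
    (Metric.dist_mem_uniformity hc)
  obtain ⟨δ, hδ, hδu⟩ := Metric.mem_uniformity_dist.1 hu
  filter_upwards [Metric.ball_mem_nhds (0 : C(K, F)) hδ] with η hη
  rw [mem_ball_zero_iff] at hη
  refine (ContinuousMap.norm_le _ (by positivity)).2 fun t => ?_
  have hηt : ‖η t‖ ≤ ‖η‖ := η.norm_coe_le_norm t
  have key := Convex.norm_image_sub_le_of_norm_fderiv_le' (𝕜 := ℝ) (f := X) (C := c)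
    (s := Metric.ball (γ t) δ) (x := γ t) (y := γ t + η t) (φ := DX (γ t))
    (fun x _ => (hX x).differentiableAt)
    (fun x hx => by
      have hx' := @hδu (γ t) x (by rwa [dist_comm]) (mem_range_self t)
      have h2 : dist (DX (γ t)) (DX x) < c := hx'
      rw [(hX x).fderiv]
      rw [dist_comm, dist_eq_norm] at h2
      exact h2.le)
    (convex_ball _ _) (Metric.mem_ball_self hδ)
    (by simpa using hηt.trans_lt hη)
  simp only [add_sub_cancel_left] at key
  refine le_trans key ?_
  gcongr

/-- The derivative of a superposition operator is built from the superposition operator of the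
derivative, so that smoothness follows by induction over all codomains `G` at once. -/
lemma contDiff_superposition_nat (n : ℕ) : ∀ {G : Type u} [NormedAddCommGroup G] [NormedSpace ℝ G]
    (X : C(F, G)), ContDiff ℝ ∞ X → ContDiff ℝ n (fun γ : C(K, F) => X.comp γ) := by
  induction n with
  | zero =>
    intro G _ _ X _
    exact contDiff_zero.2 (ContinuousMap.continuous_postcomp X)
  | succ n ih =>
    intro G _ _ X hX
    have hd : ∀ x, HasFDerivAt X (fderiv ℝ X x) x := fun x =>
      (hX.differentiable (by simp) x).hasFDerivAt
    have hDX : ContDiff ℝ ∞ (fderiv ℝ X) := hX.fderiv_right (by simp)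
    let DX : C(F, F →L[ℝ] G) := ⟨fderiv ℝ X, hDX.continuous⟩
    have hder : ∀ γ : C(K, F), HasFDerivAt (fun γ : C(K, F) => X.comp γ)
      (pointwiseApply K F G (DX.comp γ)) γ := hasFDerivAt_superposition X DX hd
    push_cast
    refine contDiff_succ_iff_fderiv.2 ⟨fun γ => (hder γ).differentiableAt, by simp, ?_⟩
    have : fderiv ℝ (fun γ : C(K, F) => X.comp γ) =
        fun γ => pointwiseApply K F G (DX.comp γ) := by
      ext1 γ; exact (hder γ).fderiv
    rw [this]
    exact (pointwiseApply K F G).contDiff.comp (ih DX hDX)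

/-- The superposition operator of a smooth map is smooth. -/
lemma contDiff_superposition {G : Type u} [NormedAddCommGroup G] [NormedSpace ℝ G]
    (X : C(F, G)) (hX : ContDiff ℝ ∞ X) : ContDiff ℝ ∞ (fun γ : C(K, F) => X.comp γ) :=
  contDiff_infty.2 fun n => contDiff_superposition_nat n X hX

end Superposition

section LocalFlow

variable {F : Type*} [NormedAddCommGroup F] [NormedSpace ℝ F] [CompleteSpace F]

lemma zero_mem_Icc_neg_one : (0 : ℝ) ∈ Icc (-1 : ℝ) 1 := by norm_num

lemma neg_one_le_one_real : (-1 : ℝ) ≤ 1 := by norm_num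

/-- The primitive vanishing at `0` of a continuous curve on `[-1, 1]`, as a continuous linear
operator on curves. -/
noncomputable def primitiveCLM (F : Type*) [NormedAddCommGroup F] [NormedSpace ℝ F]
    [CompleteSpace F] : C(Icc (-1 : ℝ) 1, F) →L[ℝ] C(Icc (-1 : ℝ) 1, F) :=
  LinearMap.mkContinuous
    { toFun := fun γ => ⟨fun t => ∫ s in (0 : ℝ)..t, IccExtend neg_one_le_one_real γ s,
        (intervalIntegral.continuous_primitive
          (fun _ _ => (γ.continuous.Icc_extend').intervalIntegrable _ _) 0).comp
          continuous_subtype_val⟩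
      map_add' := fun γ δ => by
        ext t
        exact intervalIntegral.integral_add
          ((γ.continuous.Icc_extend').intervalIntegrable _ _)
          ((δ.continuous.Icc_extend').intervalIntegrable _ _)
      map_smul' := fun c γ => by
        ext t
        exact intervalIntegral.integral_smul c _ } 1 (by
    intro γ
    rw [one_mul]
    refine (ContinuousMap.norm_le _ (norm_nonneg _)).2 fun t => ?_
    have h1 := intervalIntegral.norm_integral_le_of_norm_le_const (a := (0 : ℝ)) (b := t)
      (f := IccExtend neg_one_le_one_real γ) (C := ‖γ‖) (fun s _ => γ.norm_coe_le_norm _)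
    refine h1.trans ?_
    have : |(t : ℝ) - 0| ≤ 1 := by rw [sub_zero]; exact abs_le.2 t.2
    nlinarith [norm_nonneg γ])

lemma primitiveCLM_apply (γ : C(Icc (-1 : ℝ) 1, F)) (t : Icc (-1 : ℝ) 1) :
    primitiveCLM F γ t = ∫ s in (0 : ℝ)..t, IccExtend neg_one_le_one_real γ s := rfl

/-- A curve on `[-1, 1]` that satisfies an integral equation solves the differential equation. -/
lemma hasDerivAt_of_eq_primitive {γ g : C(Icc (-1 : ℝ) 1, F)} {y : F} {s : ℝ}
    (h : γ = ContinuousMap.const _ y + s • primitiveCLM F g) {t : ℝ} (ht : t ∈ Ioo (-1 : ℝ) 1) :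
    HasDerivAt (IccExtend neg_one_le_one_real γ)
      (s • IccExtend neg_one_le_one_real g t) t := by
  have h1 : HasDerivAt (fun t => ∫ s in (0 : ℝ)..t, IccExtend neg_one_le_one_real g s)
      (IccExtend neg_one_le_one_real g t) t :=
    (g.continuous.Icc_extend').integral_hasStrictDerivAt 0 t |>.hasDerivAt
  refine ((h1.const_smul s).const_add y).congr_of_eventuallyEq ?_
  filter_upwards [Ioo_mem_nhds ht.1 ht.2] with r hr
  rw [IccExtend_of_mem _ _ (Ioo_subset_Icc_self hr), h]
  simp [primitiveCLM_apply]

/-- The embedding of a normed space as the constant curves. -/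
noncomputable def constCurveCLM (F : Type*) [NormedAddCommGroup F] [NormedSpace ℝ F] :
    F →L[ℝ] C(Icc (-1 : ℝ) 1, F) :=
  LinearMap.mkContinuous
    { toFun := fun y => ContinuousMap.const _ y
      map_add' := fun _ _ => rfl
      map_smul' := fun _ _ => rfl } 1 (by
    intro y
    rw [one_mul]
    exact (ContinuousMap.norm_le _ (norm_nonneg _)).2 fun t => le_rfl)

@[simp] lemma constCurveCLM_apply {F : Type*} [NormedAddCommGroup F] [NormedSpace ℝ F] (y : F) :
    constCurveCLM F y = ContinuousMap.const _ y := rfl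

/-- The map `(s, y, γ) ↦ (s, y, γ - y - s ∫₀ X ∘ γ)`, which has the integral curves of `s X` that
start at `y` as the zeros of its last component. -/
noncomputable def integralDefect (X : C(F, F)) (p : ℝ × F × C(Icc (-1 : ℝ) 1, F)) :
    ℝ × F × C(Icc (-1 : ℝ) 1, F) :=
  (p.1, p.2.1, p.2.2 - constCurveCLM F p.2.1 - p.1 • primitiveCLM F (X.comp p.2.2))

lemma contDiff_integralDefect (X : C(F, F)) (hX : ContDiff ℝ ∞ X) :
    ContDiff ℝ ∞ (integralDefect X) := by
  have h := (contDiff_superposition (K := Icc (-1 : ℝ) 1) X hX).comp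
    (contDiff_snd.comp contDiff_snd : ContDiff ℝ ∞
      fun p : ℝ × F × C(Icc (-1 : ℝ) 1, F) => p.2.2)
  have h2 := (primitiveCLM F).contDiff.comp h
  refine contDiff_fst.prodMk ((contDiff_fst.comp contDiff_snd).prodMk ?_)
  refine ((contDiff_snd.comp contDiff_snd).sub
    ((constCurveCLM F).contDiff.comp (contDiff_fst.comp contDiff_snd))).sub
    (contDiff_fst.smul h2)

/-- The derivative of `integralDefect` at the time scale `s = 0`. -/
noncomputable def integralDefectDeriv (j : C(Icc (-1 : ℝ) 1, F)) :
    (ℝ × F × C(Icc (-1 : ℝ) 1, F)) ≃L[ℝ] (ℝ × F × C(Icc (-1 : ℝ) 1, F)) :=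
  ContinuousLinearEquiv.equivOfInverse
    ((ContinuousLinearMap.fst ℝ _ _).prod
      ((ContinuousLinearMap.fst ℝ _ _ ∘L ContinuousLinearMap.snd ℝ _ _).prod
        (ContinuousLinearMap.snd ℝ _ _ ∘L ContinuousLinearMap.snd ℝ _ _ -
          constCurveCLM F ∘L ContinuousLinearMap.fst ℝ _ _ ∘L ContinuousLinearMap.snd ℝ _ _ -
          (ContinuousLinearMap.fst ℝ _ _).smulRight j)))
    ((ContinuousLinearMap.fst ℝ _ _).prod
      ((ContinuousLinearMap.fst ℝ _ _ ∘L ContinuousLinearMap.snd ℝ _ _).prod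
        (ContinuousLinearMap.snd ℝ _ _ ∘L ContinuousLinearMap.snd ℝ _ _ +
          constCurveCLM F ∘L ContinuousLinearMap.fst ℝ _ _ ∘L ContinuousLinearMap.snd ℝ _ _ +
          (ContinuousLinearMap.fst ℝ _ _).smulRight j)))
    (fun x => by ext; all_goals simp; try abel) (fun x => by ext; all_goals simp; try abel)

/-- At `s = 0` the term `s ∫₀ X ∘ γ` contributes only its derivative in `s`, which makes the
derivative of `integralDefect` triangular and hence invertible. -/
lemma hasFDerivAt_integralDefect (X : C(F, F)) (hX : ContDiff ℝ ∞ X) (y : F) :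
    HasFDerivAt (integralDefect X)
      (integralDefectDeriv (primitiveCLM F (X.comp (constCurveCLM F y))) :
        (ℝ × F × C(Icc (-1 : ℝ) 1, F)) →L[ℝ] _) (0, y, constCurveCLM F y) := by
  have h := (contDiff_superposition (K := Icc (-1 : ℝ) 1) X hX).comp
    (contDiff_snd.comp contDiff_snd : ContDiff ℝ ∞
      fun p : ℝ × F × C(Icc (-1 : ℝ) 1, F) => p.2.2)
  have h2 := (((primitiveCLM F).contDiff.comp h).differentiable (by simp)
    (0, y, constCurveCLM F y)).hasFDerivAt
  have h3 := (hasFDerivAt_fst (𝕜 := ℝ) (p := ((0 : ℝ), y, constCurveCLM F y))).smul h2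
  have h4 := (hasFDerivAt_snd (𝕜 := ℝ) (p := ((0 : ℝ), y, constCurveCLM F y))).snd.sub
    ((constCurveCLM F).hasFDerivAt.comp ((0 : ℝ), y, constCurveCLM F y)
      (hasFDerivAt_snd (𝕜 := ℝ) (p := ((0 : ℝ), y, constCurveCLM F y))).fst)
  refine (hasFDerivAt_fst.prodMk ((hasFDerivAt_snd.fst).prodMk (h4.sub h3))).congr_fderiv ?_
  ext <;> simp [integralDefectDeriv]

/-- Smooth vector fields have local flows that depend smoothly on the initial value, with
derivatives that solve the variational equation. The inverse function theorem for `integralDefect`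
gives, for a small time scale `s`, curves on `[-1, 1]` that solve `γ' = s X(γ)` and depend smoothly
on the initial value; the flow is their reparametrisation by `t / s`. -/
lemma exists_local_flow_of_contDiff (X : F → F) (hX : ContDiff ℝ ∞ X) (y₀ : F) {U : Set F}
    (hU : U ∈ 𝓝 y₀) :
    ∃ ε > 0, ∃ r > 0, ∃ θ : ℝ → F → F,
      (∀ t ∈ Ioo (-ε) ε, ContDiffOn ℝ ∞ (θ t) (Metric.ball y₀ r)) ∧
      ∀ y ∈ Metric.ball y₀ r, θ 0 y = y ∧ ∀ t ∈ Ioo (-ε) ε, θ t y ∈ U ∧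
        HasDerivAt (fun t => θ t y) (X (θ t y)) t ∧
        ∀ u, HasDerivAt (fun t => fderiv ℝ (θ t) y u)
          (fderiv ℝ X (θ t y) (fderiv ℝ (θ t) y u)) t := by
  let Xc : C(F, F) := ⟨X, hX.continuous⟩
  let DXc : C(F, F →L[ℝ] F) := ⟨fderiv ℝ X, (hX.fderiv_right (m := ∞) (by simp)).continuous⟩
  have hΦ := contDiff_integralDefect Xc hX
  set c₀ := constCurveCLM F y₀ with hc₀
  set p₀ : ℝ × F × C(Icc (-1 : ℝ) 1, F) := (0, y₀, c₀) with hp₀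
  have hΦ' := hasFDerivAt_integralDefect Xc hX y₀
  set f := hΦ.contDiffAt.toOpenPartialHomeomorph (integralDefect Xc) hΦ' (by simp) with hf
  have hfc : ∀ p, f p = integralDefect Xc p := fun p => rfl
  have hp₀s : p₀ ∈ f.source := hΦ.contDiffAt.mem_toOpenPartialHomeomorph_source hΦ' (by simp)
  have hfp₀ : f p₀ = (0, y₀, 0) := by
    rw [hfc]; simp [integralDefect, hp₀, hc₀]
  have hp₀t : ((0, y₀, 0) : ℝ × F × C(Icc (-1 : ℝ) 1, F)) ∈ f.target := hfp₀ ▸ f.map_source hp₀s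
  have hsymm : f.symm (0, y₀, 0) = p₀ := by rw [← hfp₀, f.left_inv hp₀s]
  obtain ⟨ρ, hρ, hρU⟩ := Metric.mem_nhds_iff.1 hU
  -- the points at which the inverse function theorem applies and the curve stays in `U`
  have hgood : ∀ᶠ p in 𝓝 p₀, (fderiv ℝ (integralDefect Xc) p ∈
      range ((↑) : ((ℝ × F × C(Icc (-1 : ℝ) 1, F)) ≃L[ℝ] (ℝ × F × C(Icc (-1 : ℝ) 1, F))) → _)) ∧
      ‖p.2.2 - c₀‖ < ρ := by
    refine Filter.Eventually.and ?_ ?_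
    · have hcont : Continuous (fderiv ℝ (integralDefect Xc)) :=
        (hΦ.fderiv_right (m := ∞) (by simp)).continuous
      refine hcont.continuousAt.eventually_mem (ContinuousLinearEquiv.isOpen.mem_nhds ?_)
      exact ⟨_, hΦ'.fderiv.symm⟩
    · have : Continuous fun p : ℝ × F × C(Icc (-1 : ℝ) 1, F) => ‖p.2.2 - c₀‖ := by fun_prop
      exact this.continuousAt.eventually_lt continuousAt_const (by simpa [hp₀] using hρ)
  have hgood' : ∀ᶠ q in 𝓝 ((0, y₀, 0) : ℝ × F × C(Icc (-1 : ℝ) 1, F)), q ∈ f.target ∧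
      (fderiv ℝ (integralDefect Xc) (f.symm q) ∈
      range ((↑) : ((ℝ × F × C(Icc (-1 : ℝ) 1, F)) ≃L[ℝ] (ℝ × F × C(Icc (-1 : ℝ) 1, F))) → _)) ∧
      ‖(f.symm q).2.2 - c₀‖ < ρ := by
    refine Filter.Eventually.and (f.open_target.mem_nhds hp₀t) ?_
    have := f.continuousAt_symm hp₀t
    rw [ContinuousAt, hsymm] at this
    exact this.eventually hgood
  obtain ⟨r, hr, hball⟩ := Metric.eventually_nhds_iff_ball.1 hgood'
  set s := r / 2 with hs
  have hspos : 0 < s := by positivity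
  have hmem : ∀ y ∈ Metric.ball y₀ r, ((s, y, 0) : ℝ × F × C(Icc (-1 : ℝ) 1, F)) ∈
      Metric.ball ((0, y₀, 0) : ℝ × F × C(Icc (-1 : ℝ) 1, F)) r := by
    intro y hy
    rw [Metric.mem_ball, Prod.dist_eq, Prod.dist_eq]
    refine max_lt ?_ (max_lt hy (by simpa using hr))
    rw [Real.dist_eq, sub_zero, abs_of_pos hspos]; simp only [hs]; linarith
  set γ : F → C(Icc (-1 : ℝ) 1, F) := fun y => (f.symm (s, y, 0)).2.2 with hγ
  have hγsmooth : ContDiffOn ℝ ∞ γ (Metric.ball y₀ r) := by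
    intro y hy
    obtain ⟨ht, ⟨e, he⟩, -⟩ := hball _ (hmem y hy)
    have h1 : ContDiffAt ℝ ∞ f.symm (s, y, 0) :=
      f.contDiffAt_symm (f₀' := e) ht
        (by rw [he]; exact (hΦ.differentiable (by simp) _).hasFDerivAt) hΦ.contDiffAt
    have h2 : ContDiffAt ℝ ∞
        (fun y : F => ((s, y, 0) : ℝ × F × C(Icc (-1 : ℝ) 1, F))) y := by fun_prop
    exact ((h1.comp y h2).snd.snd).contDiffWithinAt
  have hγeq : ∀ y ∈ Metric.ball y₀ r,
      γ y = constCurveCLM F y + s • primitiveCLM F (Xc.comp (γ y)) := by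
    intro y hy
    have h1 := f.right_inv (hball _ (hmem y hy)).1
    rw [hfc, integralDefect, Prod.mk.injEq, Prod.mk.injEq] at h1
    obtain ⟨h1, h2, h3⟩ := h1
    rw [h1, h2, sub_sub, sub_eq_zero] at h3
    exact h3
  have hγd : ∀ y ∈ Metric.ball y₀ r, HasFDerivAt γ (fderiv ℝ γ y) y := fun y hy =>
    ((hγsmooth.contDiffAt (Metric.isOpen_ball.mem_nhds hy)).differentiableAt
      (by simp)).hasFDerivAt
  have hδ : ∀ y ∈ Metric.ball y₀ r, ∀ u, fderiv ℝ γ y u =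
      ContinuousMap.const _ u + s • primitiveCLM F (pointwiseApply _ F F (DXc.comp (γ y))
        (fderiv ℝ γ y u)) := by
    intro y hy u
    have h1 : HasFDerivAt (fun y => constCurveCLM F y + s • primitiveCLM F (Xc.comp (γ y)))
        (constCurveCLM F + s • (primitiveCLM F ∘L
          (pointwiseApply _ F F (DXc.comp (γ y))) ∘L fderiv ℝ γ y)) y := by
      have h0 : HasFDerivAt (fun y => primitiveCLM F (Xc.comp (γ y)))
          (primitiveCLM F ∘L (pointwiseApply _ F F (DXc.comp (γ y))) ∘L fderiv ℝ γ y) y :=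
        (primitiveCLM F).hasFDerivAt.comp y ((hasFDerivAt_superposition Xc DXc
          (fun x => (hX.differentiable (by simp) x).hasFDerivAt) (γ y)).comp y (hγd y hy))
      exact (constCurveCLM F).hasFDerivAt.add (h0.const_smul s)
    have h2 := h1.congr_of_eventuallyEq
      (eventually_of_mem (Metric.isOpen_ball.mem_nhds hy) hγeq)
    have h3 := (hγd y hy).unique h2
    conv_lhs => rw [h3]
    rfl
  have hsne : s ≠ 0 := hspos.ne'
  have hdiv : ∀ t ∈ Ioo (-s) s, t / s ∈ Ioo (-1 : ℝ) 1 := fun t ht =>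
    ⟨by rw [lt_div_iff₀ hspos]; linarith [ht.1], by rw [div_lt_iff₀ hspos]; linarith [ht.2]⟩
  have hscale : ∀ t, HasDerivAt (fun t : ℝ => t / s) (1 / s) t := fun t =>
    (hasDerivAt_id t).div_const s
  let pr : ℝ → Icc (-1 : ℝ) 1 := fun t => projIcc (-1) 1 neg_one_le_one_real (t / s)
  have hθd : ∀ t, ∀ y ∈ Metric.ball y₀ r, ∀ u, fderiv ℝ (fun y => γ y (pr t)) y u =
      fderiv ℝ γ y u (pr t) := by
    intro t y hy u
    have h1 : HasFDerivAt (fun y => γ y (pr t))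
        (ContinuousMap.evalCLM ℝ (pr t) ∘L fderiv ℝ γ y) y :=
      (ContinuousMap.evalCLM ℝ (pr t) : C(Icc (-1 : ℝ) 1, F) →L[ℝ] F).hasFDerivAt.comp y (hγd y hy)
    rw [h1.fderiv]; rfl
  refine ⟨s, hspos, r, hr, fun t y => γ y (pr t), fun t ht => ?_, fun y hy => ⟨?_, fun t ht => ?_⟩⟩
  · exact (ContinuousMap.evalCLM ℝ (pr t)).contDiff.comp_contDiffOn hγsmooth
  · have hpr : ((pr 0 : Icc (-1 : ℝ) 1) : ℝ) = 0 := by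
      simp [pr, projIcc_of_mem _ zero_mem_Icc_neg_one]
    change γ y (pr 0) = y
    rw [hγeq y hy]
    simp [primitiveCLM_apply, hpr]
  · refine ⟨hρU ?_, ?_, fun u => ?_⟩
    · have h1 := (hball _ (hmem y hy)).2.2
      have h2 := ((γ y - c₀).norm_coe_le_norm (pr t)).trans_lt h1
      rw [Metric.mem_ball, dist_eq_norm]
      exact h2
    · have h1 := hasDerivAt_of_eq_primitive (hγeq y hy) (hdiv t ht)
      have h2 := h1.scomp t (hscale t)
      rw [smul_smul, one_div, inv_mul_cancel₀ hsne, one_smul] at h2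
      exact h2
    · have h1 := hasDerivAt_of_eq_primitive (hδ y hy u) (hdiv t ht)
      have h2 := h1.scomp t (hscale t)
      rw [smul_smul, one_div, inv_mul_cancel₀ hsne, one_smul] at h2
      refine (h2.congr_of_eventuallyEq (Eventually.of_forall fun t => hθd t y hy u)).congr_deriv ?_
      rw [hθd t y hy u]
      rfl

/-- The local version of `exists_local_flow_of_contDiff`, for a vector field that is smooth on an
open set. -/
lemma exists_local_flow [FiniteDimensional ℝ F] {X : F → F} {U : Set F} (hU : IsOpen U)
    (hX : ContDiffOn ℝ ∞ X U) {y₀ : F} (hy₀ : y₀ ∈ U) :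
    ∃ ε > 0, ∃ r > 0, ∃ θ : ℝ → F → F,
      (∀ t ∈ Ioo (-ε) ε, ContDiffOn ℝ ∞ (θ t) (Metric.ball y₀ r)) ∧
      ∀ y ∈ Metric.ball y₀ r, θ 0 y = y ∧ ∀ t ∈ Ioo (-ε) ε, θ t y ∈ U ∧
        HasDerivAt (fun t => θ t y) (X (θ t y)) t ∧
        ∀ u, HasDerivAt (fun t => fderiv ℝ (θ t) y u)
          (fderiv ℝ X (θ t y) (fderiv ℝ (θ t) y u)) t := by
  obtain ⟨R, hR, hRU⟩ := Metric.isOpen_iff.1 hU y₀ hy₀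
  -- cut off `X` outside a ball, and keep the flow inside the ball on which nothing has changed
  let χ : ContDiffBump y₀ := ⟨R / 3, R / 2, by positivity, by linarith⟩
  have hsm : ContDiff ℝ ∞ (fun y => χ y • X y) := by
    rw [contDiff_iff_contDiffAt]
    intro y
    by_cases hy : y ∈ Metric.closedBall y₀ (R / 2)
    · have hyU : y ∈ U := hRU (Metric.closedBall_subset_ball (by linarith) hy)
      exact χ.contDiff.contDiffAt.smul (hX.contDiffAt (hU.mem_nhds hyU))
    · have : (fun y => χ y • X y) =ᶠ[𝓝 y] fun _ => 0 := by
        filter_upwards [Metric.isClosed_closedBall.isOpen_compl.mem_nhds hy] with x hx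
        rw [χ.zero_of_le_dist (le_of_lt (by simpa using hx)), zero_smul]
      exact contDiffAt_const.congr_of_eventuallyEq this
  obtain ⟨ε, hε, r, hr, θ, hθ, hflow⟩ := exists_local_flow_of_contDiff _ hsm y₀
    (Metric.ball_mem_nhds y₀ (by positivity : 0 < R / 3))
  refine ⟨ε, hε, r, hr, θ, hθ, fun y hy => ⟨(hflow y hy).1, fun t ht => ?_⟩⟩
  obtain ⟨h1, h2, h3⟩ := (hflow y hy).2 t ht
  have hev : (fun y => χ y • X y) =ᶠ[𝓝 (θ t y)] X := by
    filter_upwards [Metric.isOpen_ball.mem_nhds h1] with x hx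
    rw [χ.one_of_mem_closedBall (Metric.ball_subset_closedBall hx), one_smul]
  refine ⟨hRU (Metric.ball_subset_ball (by linarith) h1), ?_, fun u => ?_⟩
  · rwa [hev.eq_of_nhds] at h2
  · rw [← hev.fderiv_eq]; exact h3 u

end LocalFlow

/-! ### Integral curves of vector fields in local parametrisations -/

section Rep

variable {F : Type*} [NormedAddCommGroup F] [NormedSpace ℝ F]
  {V : Type*} [NormedAddCommGroup V] [NormedSpace ℝ V]
  {H : Type*} [TopologicalSpace H] {I : ModelWithCorners ℝ V H}
  {M : Type*} [TopologicalSpace M] [ChartedSpace H M]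

namespace PartialDiffeomorph

variable (Ψ : PartialDiffeomorph 𝓘(ℝ, F) I F M ∞)

lemma mdifferentiableAt_symm {x : M} (hx : x ∈ Ψ.target) : MDifferentiableAt I 𝓘(ℝ, F) Ψ.symm x :=
  Ψ.symm.mdifferentiableAt (by simp) hx

lemma mfderiv_symm_mfderiv {y : F} (hy : y ∈ Ψ.source) (u : F) :
    mfderiv I 𝓘(ℝ, F) Ψ.symm (Ψ y) (mfderiv 𝓘(ℝ, F) I Ψ y u) = u := by
  have h1 := (Ψ.mdifferentiableAt_symm (Ψ.map_source hy)).hasMFDerivAt.comp y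
    (Ψ.mdifferentiableAt (by simp) hy).hasMFDerivAt
  have h2 : HasMFDerivAt 𝓘(ℝ, F) 𝓘(ℝ, F) (Ψ.symm ∘ Ψ) y
      (ContinuousLinearMap.id ℝ (TangentSpace 𝓘(ℝ, F) y)) := by
    refine (hasMFDerivAt_id (I := 𝓘(ℝ, F)) y).congr_of_eventuallyEq ?_
    filter_upwards [Ψ.open_source.mem_nhds hy] with z hz
    exact Ψ.left_inv hz
  have h3 := hasMFDerivAt_unique h1 h2
  exact DFunLike.congr_fun h3 u

lemma mfderiv_mfderiv_symm {y : F} (hy : y ∈ Ψ.source) (u : TangentSpace I (Ψ y)) :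
    mfderiv 𝓘(ℝ, F) I Ψ y (mfderiv I 𝓘(ℝ, F) Ψ.symm (Ψ y) u) = u := by
  have hsy : Ψ.symm (Ψ y) = y := Ψ.left_inv hy
  have h0 : HasMFDerivAt 𝓘(ℝ, F) I Ψ (Ψ.symm (Ψ y)) (mfderiv 𝓘(ℝ, F) I Ψ y) := by
    rw [hsy]
    exact (Ψ.mdifferentiableAt (by simp) hy).hasMFDerivAt
  have h1 := h0.comp (Ψ y) (Ψ.mdifferentiableAt_symm (Ψ.map_source hy)).hasMFDerivAt
  have h2 : HasMFDerivAt I I (Ψ ∘ Ψ.symm) (Ψ y)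
      (ContinuousLinearMap.id ℝ (TangentSpace I (Ψ y))) := by
    refine (hasMFDerivAt_id (I := I) (Ψ y)).congr_of_eventuallyEq ?_
    filter_upwards [Ψ.open_target.mem_nhds (Ψ.map_source hy)] with z hz
    exact Ψ.right_inv hz
  have h3 := hasMFDerivAt_unique h1 h2
  exact DFunLike.congr_fun h3 u

end PartialDiffeomorph

/-- The vector field `X` is represented by the smooth vector field `X'` on a normed space in the
parametrisation `Ψ` of an open subset of the manifold. -/
structure IsLocalRep (X : (x : M) → TangentSpace I x) (Ψ : PartialDiffeomorph 𝓘(ℝ, F) I F M ∞)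
    (X' : F → F) : Prop where
  smooth : ContDiffOn ℝ ∞ X' Ψ.source
  map_eq : ∀ y ∈ Ψ.source, mfderiv 𝓘(ℝ, F) I Ψ y (X' y) = X (Ψ y)

namespace IsLocalRep

variable {X : (x : M) → TangentSpace I x} {Ψ : PartialDiffeomorph 𝓘(ℝ, F) I F M ∞} {X' : F → F}

/-- Integral curves are integral curves of the representative in the parametrisation. -/
lemma hasDerivWithinAt (hX : IsLocalRep X Ψ X') {γ : ℝ → M} {s : Set ℝ} {t : ℝ}
    (ht : γ t ∈ Ψ.target)
    (h : HasMFDerivWithinAt 𝓘(ℝ, ℝ) I γ s t ((1 : ℝ →L[ℝ] ℝ).smulRight (X (γ t)))) :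
    HasDerivWithinAt (fun t => Ψ.symm (γ t)) (X' (Ψ.symm (γ t))) s t := by
  have h1 := (Ψ.mdifferentiableAt_symm ht).hasMFDerivAt.comp_hasMFDerivWithinAt t h
  have h2 := hasMFDerivWithinAt_iff_hasFDerivWithinAt.1 h1
  refine HasFDerivWithinAt.congr_fderiv h2 ?_
  have hsrc : Ψ.symm (γ t) ∈ Ψ.source := Ψ.map_target ht
  have hr : Ψ (Ψ.symm (γ t)) = γ t := Ψ.right_inv ht
  have h3 := Ψ.mfderiv_symm_mfderiv hsrc (X' (Ψ.symm (γ t)))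
  rw [hX.map_eq _ hsrc, hr] at h3
  refine ContinuousLinearMap.ext_ring ?_
  refine Eq.trans ?_ (h3.trans ?_)
  · change mfderiv I 𝓘(ℝ, F) Ψ.symm (γ t) ((1 : ℝ) • X (γ t)) = _
    rw [one_smul]
  · change X' (Ψ.symm (γ t)) = (1 : ℝ) • X' (Ψ.symm (γ t))
    rw [one_smul]

/-- Integral curves of the representative are mapped to integral curves on the manifold. -/
lemma hasMFDerivWithinAt (hX : IsLocalRep X Ψ X') {c : ℝ → F} {s : Set ℝ} {t : ℝ}
    (ht : c t ∈ Ψ.source) (h : HasDerivWithinAt c (X' (c t)) s t) :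
    HasMFDerivWithinAt 𝓘(ℝ, ℝ) I (fun t => Ψ (c t)) s t
      ((1 : ℝ →L[ℝ] ℝ).smulRight (X (Ψ (c t)))) := by
  have h1 := (Ψ.mdifferentiableAt (by simp) ht).hasMFDerivAt.comp_hasMFDerivWithinAt t
    (hasMFDerivWithinAt_iff_hasFDerivWithinAt.2 h.hasFDerivWithinAt)
  refine HasMFDerivWithinAt.congr_mfderiv h1 ?_
  refine ContinuousLinearMap.ext fun (a : ℝ) => ?_
  change mfderiv 𝓘(ℝ, F) I Ψ (c t) (a • X' (c t)) = a • X (Ψ (c t))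
  rw [← hX.map_eq _ ht]
  exact map_smul (mfderiv 𝓘(ℝ, F) I Ψ (c t)) a (X' (c t))

/-- Local uniqueness of integral curves, from the Lipschitz continuity of the representative. -/
lemma eventuallyEq (hX : IsLocalRep X Ψ X') {γ₁ γ₂ : ℝ → M} {t₀ : ℝ}
    (ht : γ₁ t₀ ∈ Ψ.target) (h₁ : IsMIntegralCurveAt γ₁ X t₀) (h₂ : IsMIntegralCurveAt γ₂ X t₀)
    (h : γ₁ t₀ = γ₂ t₀) : γ₁ =ᶠ[𝓝 t₀] γ₂ := by
  have hsrc : Ψ.symm (γ₁ t₀) ∈ Ψ.source := Ψ.map_target ht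
  have hn := Ψ.open_source.mem_nhds hsrc
  obtain ⟨K, S, hS, hlip⟩ := ((hX.smooth.contDiffAt hn).of_le
    (by simp : (1 : WithTop ℕ∞) ≤ ∞)).exists_lipschitzOnWith
  have key : ∀ γ : ℝ → M, γ t₀ = γ₁ t₀ → IsMIntegralCurveAt γ X t₀ →
      (∀ᶠ t in 𝓝 t₀, γ t ∈ Ψ.target) ∧
      ∀ᶠ t in 𝓝 t₀, HasDerivAt (fun t => Ψ.symm (γ t)) (X' (Ψ.symm (γ t))) t ∧
        Ψ.symm (γ t) ∈ S := by
    intro γ hγ0 hγ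
    have hc := hγ.continuousAt
    have ht' : γ t₀ ∈ Ψ.target := hγ0 ▸ ht
    have h1 : ∀ᶠ t in 𝓝 t₀, γ t ∈ Ψ.target := hc (Ψ.open_target.mem_nhds ht')
    have h2 : ContinuousAt (fun t => Ψ.symm (γ t)) t₀ :=
      ((Ψ.mdifferentiableAt_symm ht').continuousAt).comp hc
    have h3 : ∀ᶠ t in 𝓝 t₀, Ψ.symm (γ t) ∈ S := h2 (by simpa only [hγ0] using hS)
    refine ⟨h1, ?_⟩
    filter_upwards [h1, h3, hγ] with t ht1 ht3 htd
    refine ⟨?_, ht3⟩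
    rw [← hasDerivWithinAt_univ]
    exact hX.hasDerivWithinAt ht1 (hasMFDerivWithinAt_univ.2 htd)
  obtain ⟨ht1, hd1⟩ := key γ₁ rfl h₁
  obtain ⟨ht2, hd2⟩ := key γ₂ h.symm h₂
  have hE := ODE_solution_unique_of_eventually (v := fun _ => X') (s := fun _ => S)
    (Eventually.of_forall fun _ => hlip) hd1 hd2 (by simp only [h])
  filter_upwards [ht1, ht2, hE] with t h1 h2 h3
  rw [← Ψ.right_inv h1, ← Ψ.right_inv h2]
  exact congrArg Ψ.toFun h3

end IsLocalRep

/-- Two integral curves of a vector field on a Hausdorff manifold that meet coincide, if one of them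
stays in a region where the vector field has smooth local representatives. -/
lemma IsMIntegralCurveOn.eqOn_Ioo [T2Space M] {X : (x : M) → TangentSpace I x} {γ γ' : ℝ → M}
    {a b t₀ : ℝ} (hX : ∀ t ∈ Ioo a b, ∃ (Ψ : PartialDiffeomorph 𝓘(ℝ, F) I F M ∞) (X' : F → F),
      IsLocalRep X Ψ X' ∧ γ t ∈ Ψ.target)
    (ht₀ : t₀ ∈ Ioo a b) (hγ : IsMIntegralCurveOn γ X (Ioo a b))
    (hγ' : IsMIntegralCurveOn γ' X (Ioo a b)) (h : γ t₀ = γ' t₀) : EqOn γ γ' (Ioo a b) := by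
  have hopen : IsOpen {t | t ∈ Ioo a b ∧ γ t = γ' t} := by
    rw [isOpen_iff_mem_nhds]
    rintro t ⟨ht, hE⟩
    have hmem := Ioo_mem_nhds ht.1 ht.2
    obtain ⟨Ψ, X', hrep, htt⟩ := hX t ht
    exact (eventually_of_mem hmem fun _ h => h).and
      (hrep.eventuallyEq htt (hγ.isMIntegralCurveAt hmem) (hγ'.isMIntegralCurveAt hmem) hE)
  have hopen' : IsOpen {t | t ∈ Ioo a b ∧ γ t ≠ γ' t} := by
    rw [isOpen_iff_mem_nhds]
    rintro t ⟨ht, hE⟩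
    have hmem := Ioo_mem_nhds ht.1 ht.2
    exact (eventually_of_mem hmem fun _ h => h).and
      (((hγ.isMIntegralCurveAt hmem).continuousAt.prodMk
        (hγ'.isMIntegralCurveAt hmem).continuousAt).eventually_mem
          (isClosed_diagonal.isOpen_compl.mem_nhds hE))
  by_contra hne
  simp only [EqOn, not_forall] at hne
  obtain ⟨t₁, ht₁, hne⟩ := hne
  obtain ⟨t, -, h1, h2⟩ := isPreconnected_Ioo (a := a) (b := b) _ _ hopen hopen'
    (fun t ht => by by_cases hE : γ t = γ' t; exacts [Or.inl ⟨ht, hE⟩, Or.inr ⟨ht, hE⟩])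
    ⟨t₀, ht₀, ht₀, h⟩ ⟨t₁, ht₁, ht₁, hne⟩
  exact h2.2 h1.2

/-- Gluing of integral curves: a curve that follows `γ₁` until the time `t₀` and `γ₂` afterwards. -/
lemma IsMIntegralCurveOn.glue {X : (x : M) → TangentSpace I x} {γ₁ γ₂ : ℝ → M}
    {s₁ s₂ : Set ℝ} {t₀ : ℝ} (h₁ : IsMIntegralCurveOn γ₁ X s₁) (h₂ : IsMIntegralCurveOn γ₂ X s₂)
    (h : γ₁ t₀ = γ₂ t₀) (hs₁ : t₀ ∈ s₁) (hs₂ : t₀ ∈ s₂) :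
    IsMIntegralCurveOn (fun t => if t ≤ t₀ then γ₁ t else γ₂ t) X
      (s₁ ∩ Iic t₀ ∪ s₂ ∩ Ici t₀) := by
  set γ : ℝ → M := fun t => if t ≤ t₀ then γ₁ t else γ₂ t with hγ
  have e1 : ∀ t ≤ t₀, γ t = γ₁ t := fun t ht => if_pos ht
  have e2 : ∀ t, t₀ ≤ t → γ t = γ₂ t := fun t ht => by
    rcases ht.eq_or_lt with rfl | ht
    · rw [e1 _ le_rfl, h]
    · exact if_neg (not_le.2 ht)
  have A : ∀ t ∈ s₁, t ≤ t₀ → HasMFDerivWithinAt 𝓘(ℝ, ℝ) I γ (s₁ ∩ Iic t₀) t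
      ((1 : ℝ →L[ℝ] ℝ).smulRight (X (γ t))) := by
    intro t ht hle
    rw [e1 t hle]
    exact (h₁ t ht).congr_mono (fun x hx => e1 x hx.2) (e1 t hle) inter_subset_left
  have B : ∀ t ∈ s₂, t₀ ≤ t → HasMFDerivWithinAt 𝓘(ℝ, ℝ) I γ (s₂ ∩ Ici t₀) t
      ((1 : ℝ →L[ℝ] ℝ).smulRight (X (γ t))) := by
    intro t ht hle
    rw [e2 t hle]
    exact (h₂ t ht).congr_mono (fun x hx => e2 x hx.2) (e2 t hle) inter_subset_left
  intro t ht
  rcases lt_trichotomy t t₀ with hlt | rfl | hlt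
  · have hs : t ∈ s₁ := by
      rcases ht with ht | ht
      exacts [ht.1, absurd ht.2 (not_le.2 hlt)]
    refine (hasMFDerivWithinAt_inter (Iio_mem_nhds hlt)).1 ?_
    refine (A t hs hlt.le).mono ?_
    rintro x ⟨hx | hx, hx'⟩
    exacts [hx, absurd (mem_Ici.1 hx.2) (not_le.2 (mem_Iio.1 hx'))]
  · exact (A t hs₁ le_rfl).union (B t hs₂ le_rfl)
  · have hs : t ∈ s₂ := by
      rcases ht with ht | ht
      exacts [absurd ht.2 (not_le.2 hlt), ht.1]
    refine (hasMFDerivWithinAt_inter (Ioi_mem_nhds hlt)).1 ?_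
    refine (B t hs hlt.le).mono ?_
    rintro x ⟨hx | hx, hx'⟩
    exacts [absurd (mem_Iic.1 hx.2) (not_le.2 (mem_Ioi.1 hx')), hx]

end Rep

section FlowLines

variable {F : Type*} [NormedAddCommGroup F] [NormedSpace ℝ F]
  {V : Type*} [NormedAddCommGroup V] [NormedSpace ℝ V]
  {H : Type*} [TopologicalSpace H] {I : ModelWithCorners ℝ V H}
  {M : Type*} [TopologicalSpace M] [ChartedSpace H M] {X : (x : M) → TangentSpace I x}
  {W : Set M}

/-- The vector field `X` has smooth local representatives around all points of `W`. -/
def IsLocallyRepOn (F : Type*) [NormedAddCommGroup F] [NormedSpace ℝ F]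
    (X : (x : M) → TangentSpace I x) (W : Set M) : Prop :=
  ∀ x ∈ W, ∃ (Ψ : PartialDiffeomorph 𝓘(ℝ, F) I F M ∞) (X' : F → F),
    IsLocalRep X Ψ X' ∧ x ∈ Ψ.target

lemma IsFlowLine.mono {s t : ℝ} {x : M} {γ : ℝ → M} (h : IsFlowLine I X W t x γ) (hst : s ≤ t) :
    IsFlowLine I X W s x γ := by
  obtain ⟨h0, ε, hε, hW, hγ⟩ := h
  have hsub : Ioo (-ε) (s + ε) ⊆ Ioo (-ε) (t + ε) := Ioo_subset_Ioo_right (by linarith)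
  exact ⟨h0, ε, hε, fun r hr => hW r (hsub hr), hγ.mono hsub⟩

lemma IsFlowLine.isMIntegralCurveOn_Icc {t : ℝ} {x : M} {γ : ℝ → M}
    (h : IsFlowLine I X W t x γ) : IsMIntegralCurveOn γ X (Icc 0 t) := by
  obtain ⟨h0, ε, hε, hW, hγ⟩ := h
  exact hγ.mono fun r hr => ⟨by linarith [hr.1], by linarith [hr.2]⟩

lemma IsFlowLine.mem {t : ℝ} {x : M} {γ : ℝ → M}
    (h : IsFlowLine I X W t x γ) {s : ℝ} (hs : s ∈ Icc 0 t) : γ s ∈ W := by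
  obtain ⟨h0, ε, hε, hW, hγ⟩ := h
  exact hW s ⟨by linarith [hs.1], by linarith [hs.2]⟩

lemma IsFlowLine.eqOn [T2Space M] (hX : IsLocallyRepOn F X W) {t : ℝ} (ht : 0 ≤ t) {x : M}
    {γ γ' : ℝ → M} (h : IsFlowLine I X W t x γ) (h' : IsFlowLine I X W t x γ') :
    EqOn γ γ' (Icc 0 t) := by
  obtain ⟨h0, ε, hε, hW, hγ⟩ := h
  obtain ⟨h0', ε', hε', -, hγ'⟩ := h'
  have hpos : 0 < min ε ε' := lt_min hε hε'
  have hsub : Ioo (-min ε ε') (t + min ε ε') ⊆ Ioo (-ε) (t + ε) :=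
    Ioo_subset_Ioo (neg_le_neg (min_le_left _ _)) (by linarith [min_le_left ε ε'])
  have hsub' : Ioo (-min ε ε') (t + min ε ε') ⊆ Ioo (-ε') (t + ε') :=
    Ioo_subset_Ioo (neg_le_neg (min_le_right _ _)) (by linarith [min_le_right ε ε'])
  have key := IsMIntegralCurveOn.eqOn_Ioo (F := F) (fun r hr => hX _ (hW r (hsub hr)))
    (t₀ := 0) ⟨by linarith, by linarith⟩ (hγ.mono hsub) (hγ'.mono hsub') (h0.trans h0'.symm)
  exact fun r hr => key ⟨by linarith [hr.1], by linarith [hr.2]⟩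

/-- The value of `flowMap` does not depend on the integral curve chosen in its definition. -/
lemma flowMap_eq [T2Space M] (hX : IsLocallyRepOn F X W) {t : ℝ} (ht : 0 ≤ t) {x : M}
    {γ : ℝ → M} (h : IsFlowLine I X W t x γ) : flowMap I X W t x = γ t := by
  have hex : ∃ γ, IsFlowLine I X W t x γ := ⟨γ, h⟩
  rw [flowMap, dif_pos hex]
  exact hex.choose_spec.eqOn hX ht h (right_mem_Icc.2 ht)

lemma exists_isMIntegralCurveOn_Ioo [FiniteDimensional ℝ F] {X' : F → F}
    {Ψ : PartialDiffeomorph 𝓘(ℝ, F) I F M ∞} (hX : IsLocalRep X Ψ X') {x : M}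
    (hx : x ∈ Ψ.target) :
    ∃ (α : ℝ → M), α 0 = x ∧ ∃ ε > 0, IsMIntegralCurveOn α X (Ioo (-ε) ε) := by
  have hsrc : Ψ.symm x ∈ Ψ.source := Ψ.map_target hx
  obtain ⟨ε, hε, r, hr, θ, -, hθ⟩ := exists_local_flow Ψ.open_source hX.smooth hsrc
  obtain ⟨h0, hθ⟩ := hθ _ (Metric.mem_ball_self hr)
  refine ⟨fun t => Ψ (θ t (Ψ.symm x)), ?_, ε, hε, fun t ht => ?_⟩
  · simp only [h0]; exact Ψ.right_inv hx
  · exact hX.hasMFDerivWithinAt (c := fun t => θ t (Ψ.symm x)) (hθ t ht).1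
      (hθ t ht).2.1.hasDerivWithinAt

/-- A curve that is in the open set `W` on `[0, T]` stays in `W` a little longer. -/
lemma exists_forall_Ioo_mem {γ : ℝ → M} (hW : IsOpen W) {T ε : ℝ} (hT : 0 ≤ T) (hε : 0 < ε)
    (hγ : ContinuousOn γ (Ioo (-ε) (T + ε))) (hmem : ∀ t ∈ Icc 0 T, γ t ∈ W) :
    ∃ δ > 0, δ ≤ ε ∧ ∀ t ∈ Ioo (-δ) (T + δ), γ t ∈ W := by
  have h : ∀ t ∈ Icc 0 T, ∀ᶠ s in 𝓝 t, γ s ∈ W := fun t ht =>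
    (hγ.continuousAt (Ioo_mem_nhds (by linarith [ht.1]) (by linarith [ht.2]))).eventually_mem
      (hW.mem_nhds (hmem t ht))
  obtain ⟨δ₁, hδ₁, h₁⟩ := Metric.eventually_nhds_iff.1 (h 0 ⟨le_rfl, hT⟩)
  obtain ⟨δ₂, hδ₂, h₂⟩ := Metric.eventually_nhds_iff.1 (h T ⟨hT, le_rfl⟩)
  refine ⟨min ε (min δ₁ δ₂), by positivity, min_le_left _ _, fun t ht => ?_⟩
  have hm1 : min ε (min δ₁ δ₂) ≤ δ₁ := (min_le_right _ _).trans (min_le_left _ _)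
  have hm2 : min ε (min δ₁ δ₂) ≤ δ₂ := (min_le_right _ _).trans (min_le_right _ _)
  rcases lt_or_ge t 0 with h0 | h0
  · refine h₁ ?_
    rw [Real.dist_eq, sub_zero, abs_of_neg h0]
    linarith [ht.1]
  · rcases le_or_gt t T with hT' | hT'
    · exact hmem t ⟨h0, hT'⟩
    · refine h₂ ?_
      rw [Real.dist_eq, abs_of_pos (sub_pos.2 hT')]
      linarith [ht.2]

/-- An integral curve on a compact interval extends to an open interval. -/
lemma IsMIntegralCurveOn.exists_isFlowLine [FiniteDimensional ℝ F] (hX : IsLocallyRepOn F X W)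
    (hW : IsOpen W) {T : ℝ} (hT : 0 ≤ T) {γ : ℝ → M} (hγ : IsMIntegralCurveOn γ X (Icc 0 T))
    (hmem : ∀ t ∈ Icc 0 T, γ t ∈ W) :
    ∃ γ', IsFlowLine I X W T (γ 0) γ' ∧ EqOn γ' γ (Icc 0 T) := by
  obtain ⟨Ψ₁, X₁, hr₁, hx₁⟩ := hX _ (hmem 0 ⟨le_rfl, hT⟩)
  obtain ⟨Ψ₂, X₂, hr₂, hx₂⟩ := hX _ (hmem T ⟨hT, le_rfl⟩)
  obtain ⟨α, hα0, ε₁, hε₁, hα⟩ := exists_isMIntegralCurveOn_Ioo hr₁ hx₁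
  obtain ⟨β, hβ0, ε₂, hε₂, hβ⟩ := exists_isMIntegralCurveOn_Ioo hr₂ hx₂
  have g1 := hα.glue hγ (t₀ := 0) hα0 ⟨by linarith, hε₁⟩ ⟨le_rfl, hT⟩
  set γ₁ : ℝ → M := fun t => if t ≤ 0 then α t else γ t with hγ₁
  have e1 : ∀ t, 0 ≤ t → γ₁ t = γ t := fun t ht => by
    rcases ht.eq_or_lt with rfl | ht
    · simp [hγ₁, hα0]
    · simp [hγ₁, not_le.2 ht]
  have hβ' := hβ.comp_add (-T)
  have g2 := g1.glue hβ' (t₀ := T) (by rw [e1 T hT]; simp [hβ0])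
    (Or.inr ⟨⟨hT, le_rfl⟩, hT⟩) (by simp [hε₂])
  set γ₂ : ℝ → M := fun t => if t ≤ T then γ₁ t else (β ∘ fun x => x + -T) t with hγ₂
  have e2 : EqOn γ₂ γ (Icc 0 T) := fun t ht => by simp only [hγ₂, if_pos ht.2, e1 t ht.1]
  have hpos : 0 < min ε₁ ε₂ := lt_min hε₁ hε₂
  have g3 : IsMIntegralCurveOn γ₂ X (Ioo (-min ε₁ ε₂) (T + min ε₁ ε₂)) := by
    refine g2.mono fun t ht => ?_
    have h1 : -ε₁ < t := (neg_le_neg (min_le_left _ _)).trans_lt ht.1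
    have h2 : t < T + ε₂ := ht.2.trans_le (by linarith [min_le_right ε₁ ε₂])
    rcases le_or_gt t T with hle | hlt
    · refine Or.inl ⟨?_, hle⟩
      rcases le_or_gt t 0 with h0 | h0
      · exact Or.inl ⟨⟨h1, by linarith⟩, h0⟩
      · exact Or.inr ⟨⟨h0.le, hle⟩, h0.le⟩
    · refine Or.inr ⟨?_, hlt.le⟩
      exact ⟨by linarith, by linarith⟩
  obtain ⟨δ, hδ, hδε, hδW⟩ := exists_forall_Ioo_mem hW hT hpos g3.continuousOn
    (fun t ht => by rw [e2 ht]; exact hmem t ht)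
  exact ⟨γ₂, ⟨e2 ⟨le_rfl, hT⟩, δ, hδ, hδW,
    g3.mono (Ioo_subset_Ioo (neg_le_neg hδε) (by linarith))⟩, e2⟩

/-- Concatenation of flow lines. -/
lemma IsFlowLine.concat [FiniteDimensional ℝ F] (hX : IsLocallyRepOn F X W)
    (hW : IsOpen W) {s t : ℝ} (hs : 0 ≤ s) (ht : 0 ≤ t) {x : M} {γ₁ γ₂ : ℝ → M}
    (h₁ : IsFlowLine I X W s x γ₁) (h₂ : IsFlowLine I X W t (γ₁ s) γ₂) :
    ∃ γ, IsFlowLine I X W (s + t) x γ ∧ γ (s + t) = γ₂ t := by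
  have hb := h₂.isMIntegralCurveOn_Icc.comp_add (-s)
  have g := h₁.isMIntegralCurveOn_Icc.glue hb (t₀ := s) (by simp [h₂.1]) ⟨hs, le_rfl⟩
    (by simp [ht])
  set γ : ℝ → M := fun r => if r ≤ s then γ₁ r else (γ₂ ∘ fun x => x + -s) r with hγ
  have e2 : ∀ r, s ≤ r → γ r = γ₂ (r - s) := fun r hr => by
    rcases hr.eq_or_lt with rfl | hr
    · simp [hγ, h₂.1]
    · simp [hγ, not_le.2 hr, sub_eq_add_neg]
  have e1 : ∀ r ≤ s, γ r = γ₁ r := fun r hr => if_pos hr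
  have g' : IsMIntegralCurveOn γ X (Icc 0 (s + t)) := by
    refine g.mono fun r hr => ?_
    rcases le_total r s with h | h
    · exact Or.inl ⟨⟨hr.1, h⟩, h⟩
    · exact Or.inr ⟨⟨by linarith, by linarith [hr.2]⟩, h⟩
  obtain ⟨γ', hf, he⟩ := g'.exists_isFlowLine hX hW (by positivity) (fun r hr => by
    rcases le_total r s with h | h
    · rw [e1 r h]; exact h₁.mem ⟨hr.1, h⟩
    · rw [e2 r h]; exact h₂.mem ⟨by linarith, by linarith [hr.2]⟩)
  rw [e1 0 hs, h₁.1] at hf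
  refine ⟨γ', hf, ?_⟩
  rw [he ⟨by positivity, le_rfl⟩, e2 _ (by linarith), add_sub_cancel_left]

/-- A flow line can be restarted at a later time. -/
lemma IsFlowLine.shift {s t : ℝ} (hs : 0 ≤ s) {x : M} {γ : ℝ → M}
    (h : IsFlowLine I X W (s + t) x γ) : IsFlowLine I X W t (γ s) (fun r => γ (r + s)) := by
  obtain ⟨h0, ε, hε, hW, hγ⟩ := h
  refine ⟨by simp, ε, hε, fun r hr => hW _ ⟨by linarith [hr.1], by linarith [hr.2]⟩, ?_⟩
  exact (hγ.comp_add s).mono fun r hr => ⟨by linarith [hr.1], by linarith [hr.2]⟩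

end FlowLines

/-! ### Flows that rescale a one-form -/

section Conformal

variable {F : Type*} [NormedAddCommGroup F] [NormedSpace ℝ F]
  {V : Type*} [NormedAddCommGroup V] [NormedSpace ℝ V]
  {H : Type*} [TopologicalSpace H] {I : ModelWithCorners ℝ V H}
  {M : Type*} [TopologicalSpace M] [ChartedSpace H M] {X : (x : M) → TangentSpace I x}
  {η : (x : M) → TangentSpace I x →L[ℝ] ℝ}

/-- The time-`t` flow of `X` is, near `x`, a smooth map that multiplies the one-form `η` at `x` by
a nonzero factor. -/
def IsConformalFlowAt (X : (x : M) → TangentSpace I x) (η : (x : M) → TangentSpace I x →L[ℝ] ℝ)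
    (t : ℝ) (x : M) : Prop :=
  ∃ Φ : M → M, ContMDiffAt I I ∞ Φ x ∧
    (∀ᶠ y in 𝓝 x, ∃ γ, IsFlowLine I X univ t y γ ∧ γ t = Φ y) ∧
    ∃ σ : ℝ, σ ≠ 0 ∧ ∀ u, η (Φ x) (mfderiv I I Φ x u) = σ * η x u

/-- Around every point, `X` has a smooth representative `X'` and `η` a representative `β` with
`𝓛_{X'} β = a β` for some continuous function `a`. -/
def IsLocallyConformal (F : Type*) [NormedAddCommGroup F] [NormedSpace ℝ F]
    (X : (x : M) → TangentSpace I x) (η : (x : M) → TangentSpace I x →L[ℝ] ℝ) : Prop :=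
  ∀ x, ∃ (Ψ : PartialDiffeomorph 𝓘(ℝ, F) I F M ∞) (X' : F → F) (β : F → F →L[ℝ] ℝ) (a : F → ℝ),
    x ∈ Ψ.target ∧ IsLocalRep X Ψ X' ∧ ContDiffOn ℝ ∞ β Ψ.source ∧ ContinuousOn a Ψ.source ∧
    ∀ y ∈ Ψ.source, (∀ u, η (Ψ y) (mfderiv 𝓘(ℝ, F) I Ψ y u) = β y u) ∧
      ∀ u, fderiv ℝ β y (X' y) u + β y (fderiv ℝ X' y u) = a y * β y u

lemma IsLocallyConformal.isLocallyRepOn (h : IsLocallyConformal F X η) :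
    IsLocallyRepOn F X univ := fun x _ =>
  let ⟨Ψ, X', _, _, hx, hr, _⟩ := h x
  ⟨Ψ, X', hr, hx⟩

/-- The solutions of the scalar linear equation `c' = a c` are multiplied by a factor that depends
on `a` only. -/
lemma exists_factor_of_linear_ode {a : ℝ → ℝ} {ε t : ℝ} (ha : ContinuousOn a (Ioo (-ε) ε))
    (ht : t ∈ Ico 0 ε) :
    ∃ σ : ℝ, σ ≠ 0 ∧ ∀ c : ℝ → ℝ, (∀ s ∈ Ioo (-ε) ε, HasDerivAt c (a s * c s) s) →
      c t = σ * c 0 := by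
  have hsub : ∀ s ∈ Icc 0 t, s ∈ Ioo (-ε) ε := fun s hs =>
    ⟨by linarith [hs.1, hs.2, ht.2], by linarith [hs.2, ht.2]⟩
  set A : ℝ → ℝ := fun s => ∫ r in (0 : ℝ)..s, a r with hA
  have hA' : ∀ s ∈ Icc 0 t, HasDerivAt A (a s) s := fun s hs =>
    intervalIntegral.integral_hasDerivAt_right
      ((ha.mono fun r hr => by
        rw [uIcc_of_le hs.1] at hr
        exact hsub r ⟨hr.1, hr.2.trans hs.2⟩).intervalIntegrable)
      (ha.stronglyMeasurableAtFilter isOpen_Ioo s (hsub s hs))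
      (ha.continuousAt (isOpen_Ioo.mem_nhds (hsub s hs)))
  refine ⟨Real.exp (A t), (Real.exp_pos _).ne', fun c hc => ?_⟩
  have hg : ∀ s ∈ Icc 0 t, HasDerivAt (fun s => c s * Real.exp (-A s)) 0 s := fun s hs => by
    have h := (hc s (hsub s hs)).mul ((hA' s hs).neg.exp)
    refine h.congr_deriv ?_
    simp only [Pi.neg_apply]
    ring
  have hconst := constant_of_has_deriv_right_zero
    (fun s hs => (hg s hs).continuousAt.continuousWithinAt)
    (fun s hs => (hg s ⟨hs.1, hs.2.le⟩).hasDerivWithinAt) t ⟨ht.1, le_rfl⟩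
  have hA0 : A 0 = 0 := by simp [hA]
  rw [hA0, neg_zero, Real.exp_zero, mul_one] at hconst
  rw [← hconst, mul_comm, mul_assoc, ← Real.exp_add, neg_add_cancel, Real.exp_zero, mul_one]

/-- For short times the flow is the local flow of a representative `X'`; as `𝓛_{X'} β = a β`, the
value of `β` on the image of a vector solves a scalar linear equation along each flow line. -/
lemma IsLocallyConformal.exists_isConformalFlowAt [FiniteDimensional ℝ F]
    (h : IsLocallyConformal F X η) (x₀ : M) :
    ∃ ε > 0, ∀ᶠ x in 𝓝 x₀, ∀ t ∈ Icc 0 ε, IsConformalFlowAt X η t x := by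
  obtain ⟨Ψ, X', β, a, hx₀, hr, hβ, ha, hyp⟩ := h x₀
  have hsrc : Ψ.symm x₀ ∈ Ψ.source := Ψ.map_target hx₀
  obtain ⟨ε, hε, r, hrpos, θ, hθs, hθ⟩ := exists_local_flow Ψ.open_source hr.smooth hsrc
  refine ⟨ε / 2, by positivity, ?_⟩
  have hnear : ∀ x ∈ Ψ.target, Ψ.symm x ∈ Metric.ball (Ψ.symm x₀) r →
      ∀ᶠ y in 𝓝 x, y ∈ Ψ.target ∧ Ψ.symm y ∈ Metric.ball (Ψ.symm x₀) r := fun x hx hb =>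
    Filter.Eventually.and (Ψ.open_target.mem_nhds hx)
      ((Ψ.mdifferentiableAt_symm hx).continuousAt.eventually_mem (Metric.isOpen_ball.mem_nhds hb))
  filter_upwards [hnear x₀ hx₀ (Metric.mem_ball_self hrpos)] with x hx t ht
  obtain ⟨hxt, hxb⟩ := hx
  have htε : t ∈ Ioo (-ε) ε := ⟨by linarith [ht.1], by linarith [ht.2]⟩
  set y := Ψ.symm x with hy
  have hys : y ∈ Ψ.source := Ψ.map_target hxt
  have hΨy : Ψ y = x := Ψ.right_inv hxt
  have hθy : θ t y ∈ Ψ.source := ((hθ y hxb).2 t htε).1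
  have hθd : ∀ s ∈ Ioo (-ε) ε, DifferentiableAt ℝ (θ s) y := fun s hs =>
    ((hθs s hs).contDiffAt (Metric.isOpen_ball.mem_nhds hxb)).differentiableAt (by simp)
  refine ⟨fun z => Ψ (θ t (Ψ.symm z)), ?_, ?_, ?_⟩
  · have h1 : ContMDiffAt 𝓘(ℝ, F) I ∞ Ψ (θ t y) :=
      Ψ.contMDiffOn.contMDiffAt (Ψ.open_source.mem_nhds hθy)
    have h2 : ContMDiffAt 𝓘(ℝ, F) 𝓘(ℝ, F) ∞ (θ t) y :=
      ((hθs t htε).contDiffAt (Metric.isOpen_ball.mem_nhds hxb)).contMDiffAt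
    have h3 : ContMDiffAt I 𝓘(ℝ, F) ∞ Ψ.symm x :=
      Ψ.symm.contMDiffOn.contMDiffAt (Ψ.open_target.mem_nhds hxt)
    exact h1.comp x (h2.comp x h3)
  · filter_upwards [hnear x hxt hxb] with z hz
    refine ⟨fun s => Ψ (θ s (Ψ.symm z)), ⟨?_, ε / 2, by positivity, fun _ _ => mem_univ _, ?_⟩, rfl⟩
    · simp only [(hθ _ hz.2).1]; exact Ψ.right_inv hz.1
    · intro s hs
      have hsε : s ∈ Ioo (-ε) ε := ⟨by linarith [hs.1], by linarith [hs.2, ht.2]⟩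
      obtain ⟨h1, h2, -⟩ := (hθ _ hz.2).2 s hsε
      exact hr.hasMFDerivWithinAt (c := fun s => θ s (Ψ.symm z)) h1 h2.hasDerivWithinAt
  · have hac : ContinuousOn (fun s => a (θ s y)) (Ioo (-ε) ε) := fun s hs => by
      obtain ⟨h1, h2, -⟩ := (hθ y hxb).2 s hs
      exact ((ha.continuousAt (Ψ.open_source.mem_nhds h1)).comp
        (f := fun s => θ s y) h2.continuousAt).continuousWithinAt
    obtain ⟨σ, hσ, hfac⟩ := exists_factor_of_linear_ode hac ⟨ht.1, by linarith [ht.2]⟩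
    refine ⟨σ, hσ, fun u => ?_⟩
    -- the linear equation is applied to `c s = β (θ s y) (D(θ s) w)`
    have hΦ : HasMFDerivAt I I (fun z => Ψ (θ t (Ψ.symm z))) x _ :=
      (Ψ.mdifferentiableAt (by simp) hθy).hasMFDerivAt.comp x
        ((hθd t htε).hasFDerivAt.hasMFDerivAt.comp x (Ψ.mdifferentiableAt_symm hxt).hasMFDerivAt)
    rw [hΦ.mfderiv]
    set w : F := mfderiv I 𝓘(ℝ, F) Ψ.symm x u with hw
    have hL : η (Ψ (θ t y)) (mfderiv 𝓘(ℝ, F) I Ψ (θ t y) (fderiv ℝ (θ t) y w)) =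
        β (θ t y) (fderiv ℝ (θ t) y w) := (hyp _ hθy).1 _
    have hR : η x u = β y w := by
      have hgen : ∀ x', Ψ y = x' → ∀ u : TangentSpace I x',
          η x' u = β y (mfderiv I 𝓘(ℝ, F) Ψ.symm x' u) := by
        rintro _ rfl u
        exact (congrArg (η (Ψ y)) (Ψ.mfderiv_mfderiv_symm hys u)).symm.trans ((hyp y hys).1 _)
      exact hgen x hΨy u
    have hc := hfac (fun s => β (θ s y) (fderiv ℝ (θ s) y w)) (fun s hs => by
      obtain ⟨h1, h2, h3⟩ := (hθ y hxb).2 s hs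
      have h4 := ((hβ.contDiffAt (Ψ.open_source.mem_nhds h1)).differentiableAt
        (by simp)).hasFDerivAt.comp_hasDerivAt s h2
      refine (h4.clm_apply (h3 w)).congr_deriv ?_
      exact (hyp _ h1).2 _)
    have h0 : fderiv ℝ (θ 0) y w = w := by
      have : θ 0 =ᶠ[𝓝 y] id := by
        filter_upwards [Metric.isOpen_ball.mem_nhds hxb] with z hz using (hθ z hz).1
      rw [this.fderiv_eq, fderiv_id]; rfl
    simp only [h0, (hθ y hxb).1] at hc
    rw [hR, ← hc, ← hL]
    rfl

lemma IsConformalFlowAt.comp [FiniteDimensional ℝ F] (hX : IsLocallyRepOn F X univ) {s t : ℝ}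
    (hs : 0 ≤ s) (ht : 0 ≤ t) {x : M} {γ : ℝ → M} [T2Space M] (hγ : IsFlowLine I X univ s x γ)
    (h₁ : IsConformalFlowAt X η s x) (h₂ : IsConformalFlowAt X η t (γ s)) :
    IsConformalFlowAt X η (s + t) x := by
  obtain ⟨Φ, hΦ, hΦf, σ, hσ, hΦη⟩ := h₁
  obtain ⟨Φ', hΦ', hΦf', σ', hσ', hΦη'⟩ := h₂
  obtain ⟨γ₁, hγ₁, he⟩ := hΦf.self_of_nhds
  have hγs : γ s = Φ x := by rw [← he]; exact hγ.eqOn hX hs hγ₁ ⟨hs, le_rfl⟩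
  rw [hγs] at hΦ' hΦf' hΦη'
  refine ⟨Φ' ∘ Φ, hΦ'.comp x hΦ, ?_, σ' * σ, mul_ne_zero hσ' hσ, fun u => ?_⟩
  · filter_upwards [hΦf, hΦ.continuousAt.eventually hΦf'] with y hy hy'
    obtain ⟨γ₁, hγ₁, he₁⟩ := hy
    obtain ⟨γ₂, hγ₂, he₂⟩ := hy'
    rw [← he₁] at hγ₂
    obtain ⟨γ₃, hγ₃, he₃⟩ := hγ₁.concat hX isOpen_univ hs ht hγ₂
    exact ⟨γ₃, hγ₃, he₃.trans he₂⟩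
  · rw [mfderiv_comp x (hΦ'.mdifferentiableAt (by simp)) (hΦ.mdifferentiableAt (by simp))]
    exact (hΦη' _).trans ((congrArg (σ' * ·) (hΦη u)).trans (mul_assoc _ _ _).symm)

/-- The flow of a locally conformal vector field is smooth and conformal wherever it is defined. -/
lemma IsLocallyConformal.isConformalFlowAt [FiniteDimensional ℝ F] [T2Space M]
    (h : IsLocallyConformal F X η) {T : ℝ} (hT : 0 < T) {x : M} {γ : ℝ → M}
    (hγ : IsFlowLine I X univ T x γ) : IsConformalFlowAt X η T x := by
  have hX := h.isLocallyRepOn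
  -- on the compact flow line, the flow is conformal up to a uniform positive time
  have hK : IsCompact (γ '' Icc 0 T) :=
    isCompact_Icc.image_of_continuousOn hγ.isMIntegralCurveOn_Icc.continuousOn
  obtain ⟨ε, hε, hunif⟩ : ∃ ε > 0, ∀ x ∈ γ '' Icc 0 T, ∀ t ∈ Icc 0 ε,
      IsConformalFlowAt X η t x := by
    refine hK.induction_on (p := fun S => ∃ ε > 0, ∀ x ∈ S, ∀ t ∈ Icc 0 ε,
      IsConformalFlowAt X η t x) ⟨1, one_pos, by simp⟩ ?_ ?_ ?_
    · rintro S S' hS ⟨ε, hε, h'⟩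
      exact ⟨ε, hε, fun x hx => h' x (hS hx)⟩
    · rintro S S' ⟨ε, hε, h₁⟩ ⟨ε', hε', h₂⟩
      refine ⟨min ε ε', lt_min hε hε', fun x hx t ht => ?_⟩
      rcases hx with hx | hx
      exacts [h₁ x hx t ⟨ht.1, ht.2.trans (min_le_left _ _)⟩,
        h₂ x hx t ⟨ht.1, ht.2.trans (min_le_right _ _)⟩]
    · intro x _
      obtain ⟨ε, hε, h'⟩ := h.exists_isConformalFlowAt x
      exact ⟨_, mem_nhdsWithin_of_mem_nhds h', ε, hε, fun y hy => hy⟩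
  obtain ⟨n, hn⟩ := exists_nat_gt (T / ε)
  have hn0 : (0 : ℝ) < n := (div_pos hT hε).trans hn
  set τ := T / n with hτ
  have hτ0 : 0 < τ := div_pos hT hn0
  have hτε : τ ≤ ε := by
    rw [hτ, div_le_iff₀ hn0, mul_comm]
    exact ((div_lt_iff₀ hε).1 hn).le
  have key : ∀ k : ℕ, (k : ℝ) + 1 ≤ n → IsConformalFlowAt X η ((k + 1) * τ) x := by
    intro k
    induction k with
    | zero =>
      intro _
      have := hunif x ⟨0, ⟨le_rfl, hT.le⟩, hγ.1⟩ τ ⟨hτ0.le, hτε⟩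
      simpa using this
    | succ k ih =>
      intro hk
      push_cast at hk ⊢
      have hle : ((k : ℝ) + 1) * τ ≤ T := by
        have : T = n * τ := by rw [hτ]; field_simp
        rw [this]
        exact mul_le_mul_of_nonneg_right (by linarith) hτ0.le
      have hpos : 0 ≤ ((k : ℝ) + 1) * τ := by positivity
      have := (ih (by linarith)).comp hX hpos hτ0.le (hγ.mono hle)
        (hunif _ ⟨_, ⟨hpos, hle⟩, rfl⟩ τ ⟨hτ0.le, hτε⟩)
      convert this using 1
      ring
  obtain ⟨m, rfl⟩ : ∃ m, n = m + 1 := Nat.exists_eq_succ_of_ne_zero (by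
    rintro rfl; simp at hn0)
  have := key m (by push_cast; rfl)
  convert this using 1
  rw [hτ]; push_cast; field_simp

end Conformal

/-! ### The Herglotz vector field in bundle coordinates -/

section Coordinates

variable {E : Type*} [NormedAddCommGroup E] [NormedSpace ℝ E]

/-- The inclusion `u ↦ (u, 0, 0)` of the positions in the coordinate space `(E × E) × ℝ`. -/
noncomputable def posIncl (E : Type*) [NormedAddCommGroup E] [NormedSpace ℝ E] :
    E →L[ℝ] (E × E) × ℝ :=
  ContinuousLinearMap.inl ℝ (E × E) ℝ ∘L ContinuousLinearMap.inl ℝ E E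

/-- The inclusion `u ↦ (0, u, 0)` of the velocities in the coordinate space `(E × E) × ℝ`. -/
noncomputable def velIncl (E : Type*) [NormedAddCommGroup E] [NormedSpace ℝ E] :
    E →L[ℝ] (E × E) × ℝ :=
  ContinuousLinearMap.inl ℝ (E × E) ℝ ∘L ContinuousLinearMap.inr ℝ E E

/-- The projection `(x, v, z) ↦ x`. -/
noncomputable def posProj (E : Type*) [NormedAddCommGroup E] [NormedSpace ℝ E] :
    (E × E) × ℝ →L[ℝ] E :=
  ContinuousLinearMap.fst ℝ E E ∘L ContinuousLinearMap.fst ℝ (E × E) ℝ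

@[simp] lemma posIncl_apply (u : E) : posIncl E u = ((u, 0), 0) := rfl
@[simp] lemma velIncl_apply (u : E) : velIncl E u = ((0, u), 0) := rfl
@[simp] lemma posProj_apply (y : (E × E) × ℝ) : posProj E y = y.1.1 := rfl

/-- The momentum `∂Λ/∂v` of a coordinate Lagrangian `Λ`. -/
noncomputable def coordMomentum (Λ : (E × E) × ℝ → ℝ) (y : (E × E) × ℝ) : E →L[ℝ] ℝ :=
  fderiv ℝ Λ y ∘L velIncl E

/-- The contact form `dz - (∂Λ/∂v) dx`. -/
noncomputable def coordForm (Λ : (E × E) × ℝ → ℝ) (y : (E × E) × ℝ) : (E × E) × ℝ →L[ℝ] ℝ :=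
  ContinuousLinearMap.snd ℝ (E × E) ℝ - coordMomentum Λ y ∘L posProj E

/-- The energy `(∂Λ/∂v) v - Λ`. -/
noncomputable def coordEnergy (Λ : (E × E) × ℝ → ℝ) (y : (E × E) × ℝ) : ℝ :=
  coordMomentum Λ y y.1.2 - Λ y

/-- The Hessian `∂²Λ/∂v²`. -/
noncomputable def coordHessian (Λ : (E × E) × ℝ → ℝ) (y : (E × E) × ℝ) : E →L[ℝ] E →L[ℝ] ℝ :=
  fderiv ℝ (coordMomentum Λ) y ∘L velIncl E

/-- The right-hand side `∂Λ/∂x + (∂Λ/∂z) (∂Λ/∂v)` of the Herglotz equations. -/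
noncomputable def coordForce (Λ : (E × E) × ℝ → ℝ) (y : (E × E) × ℝ) : E →L[ℝ] ℝ :=
  fderiv ℝ Λ y ∘L posIncl E + fderiv ℝ Λ y (0, 1) • coordMomentum Λ y

/-- The vector field `(v, a, Λ)` of the Herglotz equations, with the acceleration `a` determined by
`(∂²Λ/∂v²) a = ∂Λ/∂x + (∂Λ/∂z) (∂Λ/∂v) - (∂²Λ/∂x∂v) v - Λ (∂²Λ/∂z∂v)`. Where the Hessian is not
invertible, its `inverse` is the junk value `0`. -/
noncomputable def coordField (Λ : (E × E) × ℝ → ℝ) (y : (E × E) × ℝ) : (E × E) × ℝ :=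
  ((y.1.2, (coordHessian Λ y).inverse
    (coordForce Λ y - fderiv ℝ (coordMomentum Λ) y ((y.1.2, 0), Λ y))), Λ y)

/-- The Hessian of `Λ` with respect to the velocities is nondegenerate at `y`. -/
def CoordRegularAt (Λ : (E × E) × ℝ → ℝ) (y : (E × E) × ℝ) : Prop :=
  ∀ u, (∀ w, coordHessian Λ y u w = 0) → u = 0

variable {Λ : (E × E) × ℝ → ℝ} {y : (E × E) × ℝ}

lemma decomp_coord (b : (E × E) × ℝ) :
    b = posIncl E b.1.1 + velIncl E b.1.2 + b.2 • ((0 : E × E), (1 : ℝ)) := by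
  ext <;> simp

lemma fderiv_coord_apply (b : (E × E) × ℝ) : fderiv ℝ Λ y b =
    fderiv ℝ Λ y (posIncl E b.1.1) + coordMomentum Λ y b.1.2 + fderiv ℝ Λ y (0, 1) * b.2 := by
  conv_lhs => rw [decomp_coord b]
  rw [map_add, map_add, map_smul, smul_eq_mul, mul_comm b.2]
  rfl

lemma contDiffAt_coordMomentum (h : ContDiffAt ℝ ∞ Λ y) : ContDiffAt ℝ ∞ (coordMomentum Λ) y :=
  (h.fderiv_right (m := ∞) (by simp)).clm_comp contDiffAt_const

lemma contDiffAt_coordForm (h : ContDiffAt ℝ ∞ Λ y) : ContDiffAt ℝ ∞ (coordForm Λ) y :=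
  contDiffAt_const.sub ((contDiffAt_coordMomentum h).clm_comp contDiffAt_const)

lemma contDiffAt_coordEnergy (h : ContDiffAt ℝ ∞ Λ y) : ContDiffAt ℝ ∞ (coordEnergy Λ) y :=
  ((contDiffAt_coordMomentum h).clm_apply (by fun_prop)).sub h

lemma contDiffAt_coordHessian (h : ContDiffAt ℝ ∞ Λ y) : ContDiffAt ℝ ∞ (coordHessian Λ) y :=
  ((contDiffAt_coordMomentum h).fderiv_right (m := ∞) (by simp)).clm_comp contDiffAt_const

lemma contDiffAt_coordForce (h : ContDiffAt ℝ ∞ Λ y) : ContDiffAt ℝ ∞ (coordForce Λ) y := by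
  have h1 := h.fderiv_right (m := ∞) (by simp)
  exact (h1.clm_comp contDiffAt_const).add
    ((h1.clm_apply contDiffAt_const).smul (contDiffAt_coordMomentum h))

lemma coordHessian_symm (h : ContDiffAt ℝ ∞ Λ y) (u w : E) :
    coordHessian Λ y u w = coordHessian Λ y w u := by
  have hs : IsSymmSndFDerivAt ℝ Λ y :=
    h.isSymmSndFDerivAt (by simpa using ENat.LEInfty.out)
  have h1 : DifferentiableAt ℝ (fderiv ℝ Λ) y :=
    (h.fderiv_right (m := ∞) (by simp)).differentiableAt (by simp)
  have h2 : ∀ a w, fderiv ℝ (coordMomentum Λ) y a w =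
      fderiv ℝ (fderiv ℝ Λ) y a (velIncl E w) := by
    intro a w
    have := (h1.hasFDerivAt.clm_comp (hasFDerivAt_const (velIncl E) y)).fderiv
    change fderiv ℝ (fun y => fderiv ℝ Λ y ∘L velIncl E) y a w = _
    rw [this]
    simp
  change fderiv ℝ (coordMomentum Λ) y (velIncl E u) w = fderiv ℝ (coordMomentum Λ) y (velIncl E w) u
  rw [h2, h2]
  exact hs _ _

lemma CoordRegularAt.exists_equiv [FiniteDimensional ℝ E] (h : CoordRegularAt Λ y) :
    ∃ e : E ≃L[ℝ] (E →L[ℝ] ℝ), (e : E →L[ℝ] E →L[ℝ] ℝ) = coordHessian Λ y := by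
  have hinj : Function.Injective (coordHessian Λ y).toLinearMap := by
    rw [← LinearMap.ker_eq_bot, LinearMap.ker_eq_bot']
    intro u hu
    exact h u fun w => DFunLike.congr_fun hu w
  have hrank : Module.finrank ℝ E = Module.finrank ℝ (E →L[ℝ] ℝ) := by
    rw [← LinearEquiv.finrank_eq (LinearMap.toContinuousLinearMap (𝕜 := ℝ) (E := E) (F' := ℝ))]
    exact (Subspace.dual_finrank_eq (K := ℝ) (V := E)).symm
  refine ⟨(LinearEquiv.ofInjectiveOfFinrankEq _ hinj hrank).toContinuousLinearEquiv, ?_⟩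
  ext u w
  rfl

lemma contDiffAt_coordField [FiniteDimensional ℝ E] (h : ContDiffAt ℝ ∞ Λ y)
    (hreg : CoordRegularAt Λ y) : ContDiffAt ℝ ∞ (coordField Λ) y := by
  obtain ⟨e, he⟩ := hreg.exists_equiv
  have h1 : ContDiffAt ℝ ∞ (fun y => (coordHessian Λ y).inverse) y := by
    have := contDiffAt_map_inverse (𝕜 := ℝ) (n := ∞) e
    rw [he] at this
    exact this.comp y (contDiffAt_coordHessian h)
  have h2 : ContDiffAt ℝ ∞ (fun y : (E × E) × ℝ => fderiv ℝ (coordMomentum Λ) y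
      ((y.1.2, 0), Λ y)) y :=
    ((contDiffAt_coordMomentum h).fderiv_right (m := ∞) (by simp)).clm_apply
      (((by fun_prop : ContDiffAt ℝ ∞ (fun y : (E × E) × ℝ => y.1.2) y).prodMk
        contDiffAt_const).prodMk h)
  exact ((by fun_prop : ContDiffAt ℝ ∞ (fun y : (E × E) × ℝ => y.1.2) y).prodMk
    (h1.clm_apply ((contDiffAt_coordForce h).sub h2))).prodMk h

lemma fderiv_coordMomentum_split (b : (E × E) × ℝ) : fderiv ℝ (coordMomentum Λ) y b =
    fderiv ℝ (coordMomentum Λ) y ((b.1.1, 0), b.2) + coordHessian Λ y b.1.2 := by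
  change _ = _ + fderiv ℝ (coordMomentum Λ) y (velIncl E b.1.2)
  rw [← map_add]
  congr 1
  ext <;> simp

/-- The momentum changes along the Herglotz vector field as the Herglotz equations say. -/
lemma fderiv_coordMomentum_coordField [FiniteDimensional ℝ E] (hreg : CoordRegularAt Λ y) :
    fderiv ℝ (coordMomentum Λ) y (coordField Λ y) = coordForce Λ y := by
  obtain ⟨e, he⟩ := hreg.exists_equiv
  rw [fderiv_coordMomentum_split]
  simp only [coordField]
  rw [← he, ContinuousLinearMap.inverse_equiv]
  simp

/-- A vector over `(v, Λ)` along which the momentum changes as the Herglotz equations say is the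
Herglotz vector field. -/
lemma eq_coordField [FiniteDimensional ℝ E] (hreg : CoordRegularAt Λ y) {X : (E × E) × ℝ}
    (h1 : X.1.1 = y.1.2) (h2 : X.2 = Λ y)
    (h3 : fderiv ℝ (coordMomentum Λ) y X = coordForce Λ y) : X = coordField Λ y := by
  rw [← fderiv_coordMomentum_coordField hreg, fderiv_coordMomentum_split,
    fderiv_coordMomentum_split (coordField Λ y)] at h3
  have h4 : coordHessian Λ y (X.1.2 - (coordField Λ y).1.2) = 0 := by
    rw [map_sub, sub_eq_zero]
    simpa [coordField, h1, h2] using h3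
  have h5 := hreg _ fun w => by rw [h4]; rfl
  rw [sub_eq_zero] at h5
  ext1
  · ext1
    exacts [h1, h5]
  · exact h2

lemma fderiv_coordForm_apply (h : ContDiffAt ℝ ∞ Λ y) (a b : (E × E) × ℝ) :
    fderiv ℝ (coordForm Λ) y a b = -fderiv ℝ (coordMomentum Λ) y a b.1.1 := by
  have hP := ((contDiffAt_coordMomentum h).differentiableAt (by simp)).hasFDerivAt
  have : HasFDerivAt (coordForm Λ) _ y :=
    (hasFDerivAt_const (ContinuousLinearMap.snd ℝ (E × E) ℝ) y).sub
      (hP.clm_comp (hasFDerivAt_const (posProj E) y))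
  rw [this.fderiv]
  simp

lemma coordForm_apply (b : (E × E) × ℝ) :
    coordForm Λ y b = b.2 - coordMomentum Λ y b.1.1 := rfl

/-- The exterior derivative `dx ∧ dP` of `dz - P dx`, with `P = ∂Λ/∂v`. -/
noncomputable def coordTwoForm (Λ : (E × E) × ℝ → ℝ) (y a b : (E × E) × ℝ) : ℝ :=
  fderiv ℝ (coordForm Λ) y a b - fderiv ℝ (coordForm Λ) y b a

lemma coordTwoForm_eq (h : ContDiffAt ℝ ∞ Λ y) (a b : (E × E) × ℝ) : coordTwoForm Λ y a b =
    fderiv ℝ (coordMomentum Λ) y b a.1.1 - fderiv ℝ (coordMomentum Λ) y a b.1.1 := by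
  rw [coordTwoForm, fderiv_coordForm_apply h, fderiv_coordForm_apply h]
  ring

lemma fderiv_coordEnergy_apply (h : ContDiffAt ℝ ∞ Λ y) (b : (E × E) × ℝ) :
    fderiv ℝ (coordEnergy Λ) y b = fderiv ℝ (coordMomentum Λ) y b y.1.2 -
      fderiv ℝ Λ y (posIncl E b.1.1) - fderiv ℝ Λ y (0, 1) * b.2 := by
  have hP := ((contDiffAt_coordMomentum h).differentiableAt (by simp)).hasFDerivAt
  have hv : HasFDerivAt (fun y : (E × E) × ℝ => y.1.2)
      (ContinuousLinearMap.snd ℝ E E ∘L ContinuousLinearMap.fst ℝ (E × E) ℝ) y :=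
    (ContinuousLinearMap.snd ℝ E E ∘L ContinuousLinearMap.fst ℝ (E × E) ℝ).hasFDerivAt
  have : HasFDerivAt (coordEnergy Λ) _ y :=
    (hP.clm_apply hv).sub (h.differentiableAt (by simp)).hasFDerivAt
  rw [this.fderiv]
  simp only [sub_apply, add_apply, ContinuousLinearMap.comp_apply,
    ContinuousLinearMap.flip_apply, ContinuousLinearMap.coe_fst', ContinuousLinearMap.coe_snd']
  rw [fderiv_coord_apply b]
  ring

/-- A vector in the kernel of `dx ∧ dP` has no position component. -/
lemma fst_eq_zero_of_coordTwoForm (h : ContDiffAt ℝ ∞ Λ y) (hreg : CoordRegularAt Λ y)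
    {a : (E × E) × ℝ} (ha : ∀ w, coordTwoForm Λ y a (velIncl E w) = 0) : a.1.1 = 0 := by
  refine hreg _ fun w => ?_
  have h1 := ha w
  rw [coordTwoForm_eq h] at h1
  rw [coordHessian_symm h]
  change fderiv ℝ (coordMomentum Λ) y (velIncl E w) a.1.1 = 0
  simpa using h1

/-- The Reeb vector field `(0, r, 1)`, with `(∂²Λ/∂v²) r = - ∂²Λ/∂z∂v`. -/
lemma exists_coordReeb [FiniteDimensional ℝ E] (h : ContDiffAt ℝ ∞ Λ y)
    (hreg : CoordRegularAt Λ y) :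
    ∃ r : (E × E) × ℝ, (∀ b, coordTwoForm Λ y r b = 0) ∧ coordForm Λ y r = 1 := by
  obtain ⟨e, he⟩ := hreg.exists_equiv
  have hr : fderiv ℝ (coordMomentum Λ) y
      ((0, e.symm (-fderiv ℝ (coordMomentum Λ) y ((0, 0), 1))), 1) = 0 := by
    rw [fderiv_coordMomentum_split, ← he]
    simp
  refine ⟨((0, e.symm (-fderiv ℝ (coordMomentum Λ) y ((0, 0), 1))), 1), fun b => ?_, ?_⟩
  · rw [coordTwoForm_eq h, hr]
    simp
  · simp [coordForm_apply]

/-- The derivative of the energy along the Reeb vector field is `-∂Λ/∂z`. -/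
lemma fderiv_coordEnergy_reeb (h : ContDiffAt ℝ ∞ Λ y)
    (hreg : CoordRegularAt Λ y) {r : (E × E) × ℝ} (hr : ∀ b, coordTwoForm Λ y r b = 0)
    (hr1 : coordForm Λ y r = 1) :
    fderiv ℝ (coordEnergy Λ) y r = -fderiv ℝ Λ y (0, 1) := by
  have h0 := fst_eq_zero_of_coordTwoForm h hreg fun w => hr _
  have hz : r.2 = 1 := by simpa [coordForm_apply, h0] using hr1
  have hP : fderiv ℝ (coordMomentum Λ) y r y.1.2 = 0 := by
    have := hr (posIncl E y.1.2)
    rw [coordTwoForm_eq h, h0] at this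
    simpa using this
  rw [fderiv_coordEnergy_apply h, hP, h0, hz]
  have : posIncl E (0 : E) = 0 := map_zero _
  rw [this, map_zero]
  ring

/-- The Herglotz vector field satisfies the equation of the contact Hamiltonian vector field of the
energy. -/
lemma coordField_spec [FiniteDimensional ℝ E] (h : ContDiffAt ℝ ∞ Λ y)
    (hreg : CoordRegularAt Λ y) (b : (E × E) × ℝ) :
    coordTwoForm Λ y (coordField Λ y) b + coordForm Λ y (coordField Λ y) * coordForm Λ y b =
      fderiv ℝ (coordEnergy Λ) y b -
        (coordEnergy Λ y - fderiv ℝ Λ y (0, 1)) * coordForm Λ y b := by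
  rw [coordTwoForm_eq h, fderiv_coordMomentum_coordField hreg, fderiv_coordEnergy_apply h]
  simp only [coordForm_apply, coordField, coordEnergy, coordForce, add_apply,
    ContinuousLinearMap.comp_apply, smul_apply, smul_eq_mul]
  ring

/-- The map `♭` of `dz - P dx` is injective. -/
lemma coordFlat_injective (h : ContDiffAt ℝ ∞ Λ y)
    (hreg : CoordRegularAt Λ y) {a a' : (E × E) × ℝ}
    (ha : ∀ b, coordTwoForm Λ y a b + coordForm Λ y a * coordForm Λ y b =
      coordTwoForm Λ y a' b + coordForm Λ y a' * coordForm Λ y b) : a = a' := by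
  rw [← sub_eq_zero]
  set d := a - a' with hd
  have hd0 : ∀ b, coordTwoForm Λ y d b + coordForm Λ y d * coordForm Λ y b = 0 := by
    intro b
    have := ha b
    simp only [coordTwoForm_eq h] at this ⊢
    simp only [hd, map_sub, sub_apply, Prod.fst_sub]
    linarith
  have h1 : d.1.1 = 0 := fst_eq_zero_of_coordTwoForm h hreg fun w => by
    have := hd0 (velIncl E w)
    simpa [coordForm_apply] using this
  have h2 : d.2 = 0 := by
    have := hd0 (0, 1)
    simpa [coordTwoForm_eq h, coordForm_apply, h1] using this
  have h3 : d.1.2 = 0 := by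
    refine hreg _ fun w => ?_
    have := hd0 (posIncl E w)
    rw [coordTwoForm_eq h, coordForm_apply, h1, h2, fderiv_coordMomentum_split d, h1, h2] at this
    have h0 : (((0, 0), 0) : (E × E) × ℝ) = 0 := rfl
    rw [h0, map_zero] at this
    simpa using this
  ext1
  · ext1
    exacts [h1, h3]
  · exact h2

/-- The Lie derivative of `dz - P dx` along the Herglotz vector field is `(∂Λ/∂z) (dz - P dx)`. -/
lemma lieDeriv_coordForm [FiniteDimensional ℝ E] (h : ContDiffAt ℝ ∞ Λ y)
    (hreg : CoordRegularAt Λ y) (u : (E × E) × ℝ) :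
    fderiv ℝ (coordForm Λ) y (coordField Λ y) u +
      coordForm Λ y (fderiv ℝ (coordField Λ) y u) =
      fderiv ℝ Λ y (0, 1) * coordForm Λ y u := by
  have hX := ((contDiffAt_coordField h hreg).differentiableAt (by simp)).hasFDerivAt
  have h1 : (fderiv ℝ (coordField Λ) y u).1.1 = u.1.2 := by
    have h2 : HasFDerivAt (fun y => (coordField Λ y).1.1) _ y := hX.fst.fst
    have h3 : HasFDerivAt (fun y : (E × E) × ℝ => y.1.2)
      (ContinuousLinearMap.snd ℝ E E ∘L ContinuousLinearMap.fst ℝ (E × E) ℝ) y :=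
      (ContinuousLinearMap.snd ℝ E E ∘L ContinuousLinearMap.fst ℝ (E × E) ℝ).hasFDerivAt
    exact DFunLike.congr_fun (h2.unique h3) u
  have h2 : (fderiv ℝ (coordField Λ) y u).2 = fderiv ℝ Λ y u := by
    have h3 : HasFDerivAt (fun y => (coordField Λ y).2) _ y := hX.snd
    exact DFunLike.congr_fun (h3.unique (h.differentiableAt (by simp)).hasFDerivAt) u
  rw [fderiv_coordForm_apply h, fderiv_coordMomentum_coordField hreg, coordForm_apply, h1, h2,
    fderiv_coord_apply u, coordForm_apply]
  simp only [coordForce, add_apply,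
    ContinuousLinearMap.comp_apply, smul_apply, smul_eq_mul]
  ring

end Coordinates

/-! ### Contact Hamiltonian vector fields in local parametrisations -/

section Pullback

variable {F : Type*} [NormedAddCommGroup F] [NormedSpace ℝ F]
  {V : Type*} [NormedAddCommGroup V] [NormedSpace ℝ V]
  {H : Type*} [TopologicalSpace H] {I : ModelWithCorners ℝ V H}
  {M : Type*} [TopologicalSpace M] [ChartedSpace H M]
  {η : (x : M) → TangentSpace I x →L[ℝ] ℝ} {Ψ : PartialDiffeomorph 𝓘(ℝ, F) I F M ∞}
  {β : F → F →L[ℝ] ℝ}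

/-- A one-form is the pullback of its representative along the inverse parametrisation. -/
lemma oneForm_eq_of_pullback
    (hβ : ∀ y ∈ Ψ.source, ∀ u, η (Ψ y) (mfderiv 𝓘(ℝ, F) I Ψ y u) = β y u) {x : M}
    (hx : x ∈ Ψ.target) (u : TangentSpace I x) :
    η x u = β (Ψ.symm x) (mfderiv I 𝓘(ℝ, F) Ψ.symm x u) := by
  have hys : Ψ.symm x ∈ Ψ.source := Ψ.map_target hx
  have hgen : ∀ x', Ψ (Ψ.symm x) = x' → ∀ u : TangentSpace I x',
      η x' u = β (Ψ.symm x) (mfderiv I 𝓘(ℝ, F) Ψ.symm x' u) := by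
    rintro _ rfl u
    exact (congrArg (η _) (Ψ.mfderiv_mfderiv_symm hys u)).symm.trans (hβ _ hys _)
  exact hgen x (Ψ.right_inv hx) u

/-- The exterior derivative commutes with the pullback along a parametrisation. -/
lemma extDerivOneForm_pullback [I.Boundaryless] [IsManifold I ∞ M]
    (hβ : ∀ y ∈ Ψ.source, ∀ u, η (Ψ y) (mfderiv 𝓘(ℝ, F) I Ψ y u) = β y u) {y : F}
    (hy : y ∈ Ψ.source) (hd : DifferentiableAt ℝ β y) (a b : F) :
    extDerivOneForm I η (Ψ y) (mfderiv 𝓘(ℝ, F) I Ψ y a) (mfderiv 𝓘(ℝ, F) I Ψ y b) =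
      fderiv ℝ β y a b - fderiv ℝ β y b a := by
  set x := Ψ y with hx
  have hxt : x ∈ Ψ.target := Ψ.map_source hy
  set e := extChartAt I x with he
  have hex : e x ∈ e.target := mem_extChartAt_target x
  have hesymm : e.symm (e x) = x := extChartAt_to_inv x
  have hopen : IsOpen e.target := isOpen_extChartAt_target x
  have hes : ContMDiffOn 𝓘(ℝ, V) I ∞ e.symm e.target := contMDiffOn_extChartAt_symm x
  set g : V → F := fun w => Ψ.symm (e.symm w) with hg
  have hgx : g (e x) = y := by
    simp only [hg, hesymm]
    exact Ψ.left_inv hy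
  -- the domain of the transition map `g`
  have hnear : ∀ᶠ w in 𝓝 (e x), w ∈ e.target ∧ e.symm w ∈ Ψ.target := by
    refine Filter.Eventually.and (hopen.mem_nhds hex) ?_
    have hc : ContinuousAt e.symm (e x) := (hes.contMDiffAt (hopen.mem_nhds hex)).continuousAt
    exact hc.eventually_mem (Ψ.open_target.mem_nhds (by rwa [hesymm]))
  have hgs : ∀ w, w ∈ e.target → e.symm w ∈ Ψ.target → ContDiffAt ℝ ∞ g w := fun w h1 h2 =>
    ((Ψ.symm.contMDiffOn.contMDiffAt (Ψ.open_target.mem_nhds h2)).comp w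
      (hes.contMDiffAt (hopen.mem_nhds h1))).contDiffAt
  have hω : oneFormInChart I η x =ᶠ[𝓝 (e x)] fun w => β (g w) ∘L fderiv ℝ g w := by
    filter_upwards [hnear] with w hw
    have h1 := (Ψ.mdifferentiableAt_symm hw.2).hasMFDerivAt.comp w
      ((hes.contMDiffAt (hopen.mem_nhds hw.1)).mdifferentiableAt (by simp)).hasMFDerivAt
    have h2 : HasMFDerivAt 𝓘(ℝ, V) 𝓘(ℝ, F) g w (fderiv ℝ g w) :=
      ((hgs w hw.1 hw.2).differentiableAt (by simp)).hasFDerivAt.hasMFDerivAt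
    refine ContinuousLinearMap.ext fun c => ?_
    refine (oneForm_eq_of_pullback hβ hw.2 (mfderiv 𝓘(ℝ, V) I e.symm w c)).trans ?_
    exact congrArg (β (g w)) (DFunLike.congr_fun (hasMFDerivAt_unique h2 h1) c).symm
  have hgd : ContDiffAt ℝ ∞ g (e x) := hgs _ hex (by rwa [hesymm])
  have hgd2 : DifferentiableAt ℝ (fderiv ℝ g) (e x) :=
    (hgd.fderiv_right (m := ∞) (by simp)).differentiableAt (by simp)
  have hβg : HasFDerivAt (fun w => β (g w)) (fderiv ℝ β y ∘L fderiv ℝ g (e x)) (e x) := by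
    refine HasFDerivAt.comp (e x) ?_ (hgd.differentiableAt (by simp)).hasFDerivAt
    rw [hgx]
    exact hd.hasFDerivAt
  have hsymm : IsSymmSndFDerivAt ℝ g (e x) :=
    hgd.isSymmSndFDerivAt (by simpa using ENat.LEInfty.out)
  have hDω : ∀ A B : V, fderiv ℝ (oneFormInChart I η x) (e x) A B =
      fderiv ℝ β y (fderiv ℝ g (e x) A) (fderiv ℝ g (e x) B) +
        β y (fderiv ℝ (fderiv ℝ g) (e x) A B) := by
    intro A B
    rw [hω.fderiv_eq, (hβg.clm_comp hgd2.hasFDerivAt).fderiv, hgx]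
    simp [add_comm]
  have hinv : ∀ a : F, fderiv ℝ g (e x) (mfderiv I 𝓘(ℝ, V) e x (mfderiv 𝓘(ℝ, F) I Ψ y a)) = a := by
    intro a
    have h1 : HasMFDerivAt 𝓘(ℝ, F) I Ψ y (mfderiv 𝓘(ℝ, F) I Ψ y) :=
      (Ψ.mdifferentiableAt (by simp) hy).hasMFDerivAt
    have h2 : HasMFDerivAt I 𝓘(ℝ, V) e x (mfderiv I 𝓘(ℝ, V) e x) :=
      ((contMDiffAt_extChartAt (I := I) (n := ∞)).mdifferentiableAt (by simp)).hasMFDerivAt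
    have h3 : HasMFDerivAt 𝓘(ℝ, V) 𝓘(ℝ, F) g (e x) (fderiv ℝ g (e x)) :=
      (hgd.differentiableAt (by simp)).hasFDerivAt.hasMFDerivAt
    have h4 := h3.comp y (h2.comp y h1)
    have h5 : HasMFDerivAt 𝓘(ℝ, F) 𝓘(ℝ, F) (g ∘ e ∘ Ψ) y
        (ContinuousLinearMap.id ℝ (TangentSpace 𝓘(ℝ, F) y)) := by
      refine (hasMFDerivAt_id (I := 𝓘(ℝ, F)) y).congr_of_eventuallyEq ?_
      have hΨc : ContinuousAt Ψ y := h1.continuousAt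
      filter_upwards [Ψ.open_source.mem_nhds hy,
        hΨc.eventually_mem (extChartAt_source_mem_nhds (I := I) x)] with z hz hz'
      change Ψ.symm (e.symm (e (Ψ z))) = z
      rw [e.left_inv hz']
      exact Ψ.left_inv hz
    exact DFunLike.congr_fun (hasMFDerivAt_unique h4 h5) a
  have hA := hinv a
  have hB := hinv b
  set A : V := mfderiv I 𝓘(ℝ, V) e x (mfderiv 𝓘(ℝ, F) I Ψ y a)
  set B : V := mfderiv I 𝓘(ℝ, V) e x (mfderiv 𝓘(ℝ, F) I Ψ y b)
  change fderiv ℝ (oneFormInChart I η x) (e x) A B - fderiv ℝ (oneFormInChart I η x) (e x) B A = _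
  rw [hDω, hDω, hA, hB, hsymm A B]
  ring

end Pullback

section ContactRep

variable {E : Type*} [NormedAddCommGroup E] [NormedSpace ℝ E]
  {V : Type*} [NormedAddCommGroup V] [NormedSpace ℝ V]
  {H : Type*} [TopologicalSpace H] {I : ModelWithCorners ℝ V H}
  {M : Type*} [TopologicalSpace M] [ChartedSpace H M]

/-- In the parametrisation `Ψ`, the one-form `η` is the contact form `dz - (∂Λ/∂v) dx` and the
function `f` is the energy of a regular coordinate Lagrangian `Λ`. -/
structure IsContactRep (η : (x : M) → TangentSpace I x →L[ℝ] ℝ) (f : M → ℝ)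
    (Ψ : PartialDiffeomorph 𝓘(ℝ, (E × E) × ℝ) I ((E × E) × ℝ) M ∞)
    (Λ : (E × E) × ℝ → ℝ) : Prop where
  smooth : ∀ y ∈ Ψ.source, ContDiffAt ℝ ∞ Λ y
  regular : ∀ y ∈ Ψ.source, CoordRegularAt Λ y
  form : ∀ y ∈ Ψ.source, ∀ u, η (Ψ y) (mfderiv 𝓘(ℝ, (E × E) × ℝ) I Ψ y u) = coordForm Λ y u
  energy : ∀ y ∈ Ψ.source, f (Ψ y) = coordEnergy Λ y

namespace IsContactRep

variable {η : (x : M) → TangentSpace I x →L[ℝ] ℝ} {f : M → ℝ}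
  {Ψ : PartialDiffeomorph 𝓘(ℝ, (E × E) × ℝ) I ((E × E) × ℝ) M ∞} {Λ : (E × E) × ℝ → ℝ}
  {y : (E × E) × ℝ}

lemma extDeriv_eq [I.Boundaryless] [IsManifold I ∞ M] (h : IsContactRep η f Ψ Λ)
    (hy : y ∈ Ψ.source) (a b : (E × E) × ℝ) :
    extDerivOneForm I η (Ψ y) (mfderiv 𝓘(ℝ, (E × E) × ℝ) I Ψ y a)
      (mfderiv 𝓘(ℝ, (E × E) × ℝ) I Ψ y b) = coordTwoForm Λ y a b :=
  extDerivOneForm_pullback h.form hy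
    ((contDiffAt_coordForm (h.smooth y hy)).differentiableAt (by simp)) a b

lemma differential_eq (h : IsContactRep η f Ψ Λ) (hy : y ∈ Ψ.source) (b : (E × E) × ℝ) :
    differential I f (Ψ y) (mfderiv 𝓘(ℝ, (E × E) × ℝ) I Ψ y b) =
      fderiv ℝ (coordEnergy Λ) y b := by
  have hsy : Ψ.symm (Ψ y) = y := Ψ.left_inv hy
  have hE : DifferentiableAt ℝ (coordEnergy Λ) y :=
    (contDiffAt_coordEnergy (h.smooth y hy)).differentiableAt (by simp)
  have hf : MDifferentiableAt I 𝓘(ℝ, ℝ) f (Ψ y) := by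
    have h1 : MDifferentiableAt I 𝓘(ℝ, ℝ) (coordEnergy Λ ∘ Ψ.symm) (Ψ y) := by
      refine MDifferentiableAt.comp (I' := 𝓘(ℝ, (E × E) × ℝ)) (Ψ y) ?_
        (Ψ.mdifferentiableAt_symm (Ψ.map_source hy))
      rw [hsy]
      exact hE.mdifferentiableAt
    refine h1.congr_of_eventuallyEq ?_
    filter_upwards [Ψ.open_target.mem_nhds (Ψ.map_source hy)] with x hx
    have h2 := h.energy (Ψ.symm x) (Ψ.map_target hx)
    have h3 : Ψ (Ψ.symm x) = x := Ψ.right_inv hx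
    rw [h3] at h2
    exact h2
  have h1 := hf.hasMFDerivAt.comp y (Ψ.mdifferentiableAt (by simp) hy).hasMFDerivAt
  have h2 : HasMFDerivAt 𝓘(ℝ, (E × E) × ℝ) 𝓘(ℝ, ℝ) (f ∘ Ψ) y
      (fderiv ℝ (coordEnergy Λ) y) := by
    refine hE.hasFDerivAt.hasMFDerivAt.congr_of_eventuallyEq ?_
    filter_upwards [Ψ.open_source.mem_nhds hy] with z hz using h.energy z hz
  exact DFunLike.congr_fun (hasMFDerivAt_unique h1 h2) b

/-- The contact Hamiltonian vector field of the energy is the Herglotz vector field. -/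
lemma contactHamVF_eq [I.Boundaryless] [IsManifold I ∞ M] [FiniteDimensional ℝ E]
    (h : IsContactRep η f Ψ Λ) (hy : y ∈ Ψ.source) :
    mfderiv 𝓘(ℝ, (E × E) × ℝ) I Ψ y (coordField Λ y) = contactHamVF I η f (Ψ y) := by
  have hsm := h.smooth y hy
  have hreg := h.regular y hy
  set A := mfderiv 𝓘(ℝ, (E × E) × ℝ) I Ψ y with hA
  have hsurj : ∀ w : TangentSpace I (Ψ y), ∃ b : (E × E) × ℝ, A b = w := fun w =>
    ⟨_, Ψ.mfderiv_mfderiv_symm hy w⟩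
  have hext : ∀ a b : (E × E) × ℝ, extDerivOneForm I η (Ψ y) (A a) (A b) = coordTwoForm Λ y a b :=
    h.extDeriv_eq hy
  have hform : ∀ b : (E × E) × ℝ, η (Ψ y) (A b) = coordForm Λ y b := h.form y hy
  have hdiff : ∀ b : (E × E) × ℝ, differential I f (Ψ y) (A b) = fderiv ℝ (coordEnergy Λ) y b :=
    h.differential_eq hy
  have hreeb : differential I f (Ψ y) (reeb I η (Ψ y)) = -fderiv ℝ Λ y (0, 1) := by
    obtain ⟨r, hr, hr1⟩ := exists_coordReeb hsm hreg
    have hspec := Classical.epsilon_spec (p := fun v : TangentSpace I (Ψ y) =>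
      (∀ w, extDerivOneForm I η (Ψ y) v w = 0) ∧ η (Ψ y) v = 1)
      ⟨A r, fun w => by
        obtain ⟨b, rfl⟩ := hsurj w
        rw [hext, hr], by rw [hform, hr1]⟩
    change (∀ w, extDerivOneForm I η (Ψ y) (reeb I η (Ψ y)) w = 0) ∧
      η (Ψ y) (reeb I η (Ψ y)) = 1 at hspec
    obtain ⟨r', hr'⟩ := hsurj (reeb I η (Ψ y))
    rw [← hr'] at hspec ⊢
    rw [hdiff]
    refine fderiv_coordEnergy_reeb hsm hreg (fun b => ?_) ?_
    · rw [← hext]; exact hspec.1 _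
    · rw [← hform]; exact hspec.2
  have hspec := Classical.epsilon_spec (p := fun v : TangentSpace I (Ψ y) =>
    ∀ w, flat I η (Ψ y) v w =
      differential I f (Ψ y) w - (f (Ψ y) + differential I f (Ψ y) (reeb I η (Ψ y))) * η (Ψ y) w)
    ⟨A (coordField Λ y), fun w => by
      obtain ⟨b, rfl⟩ := hsurj w
      rw [flat, hext, hform, hform, hdiff, hreeb, h.energy y hy, coordField_spec hsm hreg]
      ring⟩
  change ∀ w, flat I η (Ψ y) (contactHamVF I η f (Ψ y)) w = _ at hspec
  obtain ⟨c, hc⟩ := hsurj (contactHamVF I η f (Ψ y))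
  rw [← hc] at hspec ⊢
  congr 1
  refine coordFlat_injective hsm hreg fun b => ?_
  have h1 := hspec (A b)
  rw [flat, hext, hform, hform, hdiff, hreeb, h.energy y hy] at h1
  rw [h1, coordField_spec hsm hreg]
  ring

lemma isLocalRep [I.Boundaryless] [IsManifold I ∞ M] [FiniteDimensional ℝ E]
    (h : IsContactRep η f Ψ Λ) : IsLocalRep (contactHamVF I η f) Ψ (coordField Λ) where
  smooth y hy := (contDiffAt_coordField (h.smooth y hy) (h.regular y hy)).contDiffWithinAt
  map_eq _ hy := h.contactHamVF_eq hy

end IsContactRep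

/-- Contact Hamiltonian vector fields rescale the contact form. -/
lemma isLocallyConformal_contactHamVF [I.Boundaryless] [IsManifold I ∞ M] [FiniteDimensional ℝ E]
    {η : (x : M) → TangentSpace I x →L[ℝ] ℝ} {f : M → ℝ}
    (h : ∀ x, ∃ (Ψ : PartialDiffeomorph 𝓘(ℝ, (E × E) × ℝ) I ((E × E) × ℝ) M ∞)
      (Λ : (E × E) × ℝ → ℝ), x ∈ Ψ.target ∧ IsContactRep η f Ψ Λ) :
    IsLocallyConformal ((E × E) × ℝ) (contactHamVF I η f) η := by
  intro x
  obtain ⟨Ψ, Λ, hx, hrep⟩ := h x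
  refine ⟨Ψ, coordField Λ, coordForm Λ, fun y => fderiv ℝ Λ y (0, 1), hx, hrep.isLocalRep,
    fun y hy => (contDiffAt_coordForm (hrep.smooth y hy)).contDiffWithinAt, fun y hy => ?_,
    fun y hy => ⟨hrep.form y hy, lieDeriv_coordForm (hrep.smooth y hy) (hrep.regular y hy)⟩⟩
  have h1 : ContDiffAt ℝ ∞ (fun y => fderiv ℝ Λ y (0, 1)) y :=
    ((hrep.smooth y hy).fderiv_right (m := ∞) (by simp)).clm_apply contDiffAt_const
  exact h1.continuousAt.continuousWithinAt

end ContactRep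

/-! ### Charts of the extended phase spaces -/

section Charts

/-- The total space of a fibre bundle with Hausdorff base and fibre is Hausdorff. -/
lemma t2Space_totalSpace {B : Type*} [TopologicalSpace B] [T2Space B] (F : Type*)
    [TopologicalSpace F] [T2Space F] (E : B → Type*) [TopologicalSpace (Bundle.TotalSpace F E)]
    [∀ b, TopologicalSpace (E b)] [FiberBundle F E] : T2Space (Bundle.TotalSpace F E) := by
  refine ⟨fun a b hab => ?_⟩
  have hproj : Continuous (Bundle.TotalSpace.proj : Bundle.TotalSpace F E → B) :=
    FiberBundle.continuous_proj F E
  by_cases h : a.proj = b.proj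
  · set e := trivializationAt F E a.proj
    have ha : a ∈ e.source := e.mem_source.2 (FiberBundle.mem_baseSet_trivializationAt' _)
    have hb : b ∈ e.source := e.mem_source.2 (h ▸ FiberBundle.mem_baseSet_trivializationAt' _)
    have hne : e a ≠ e b := fun he => hab (e.injOn ha hb he)
    obtain ⟨u, v, hu, hv, hau, hbv, huv⟩ := t2_separation hne
    refine ⟨e.source ∩ e ⁻¹' u, e.source ∩ e ⁻¹' v,
      e.continuousOn.isOpen_inter_preimage e.open_source hu,
      e.continuousOn.isOpen_inter_preimage e.open_source hv, ⟨ha, hau⟩, ⟨hb, hbv⟩, ?_⟩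
    exact (huv.preimage e).mono inter_subset_right inter_subset_right
  · obtain ⟨u, v, hu, hv, hau, hbv, huv⟩ := t2_separation h
    exact ⟨_, _, hu.preimage hproj, hv.preimage hproj, hau, hbv, huv.preimage _⟩

/-- The inverse of the chart centred at `x₀`, as a parametrisation. -/
noncomputable def chartParam {V : Type*} [NormedAddCommGroup V] [NormedSpace ℝ V]
    {H : Type*} [TopologicalSpace H] (I : ModelWithCorners ℝ V H) [I.Boundaryless]
    {M : Type*} [TopologicalSpace M] [ChartedSpace H M] [IsManifold I ∞ M] (x₀ : M) :
    PartialDiffeomorph 𝓘(ℝ, V) I V M ∞ where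
  toPartialEquiv := (extChartAt I x₀).symm
  open_source := isOpen_extChartAt_target x₀
  open_target := isOpen_extChartAt_source x₀
  contMDiffOn_toFun := contMDiffOn_extChartAt_symm x₀
  contMDiffOn_invFun := contMDiffOn_extChartAt.mono (extChartAt_source I x₀).subset

/-- The inverse function theorem, for a map with invertible derivatives on an open set. -/
lemma exists_partialDiffeomorph {F G : Type*} [NormedAddCommGroup F] [NormedSpace ℝ F]
    [CompleteSpace F] [NormedAddCommGroup G] [NormedSpace ℝ G] {f : F → G} {s : Set F}
    (hs : IsOpen s) (hf : ∀ z ∈ s, ContDiffAt ℝ ∞ f z)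
    (hd : ∀ z ∈ s, ∃ e : F ≃L[ℝ] G, HasFDerivAt f (e : F →L[ℝ] G) z) {y : F} (hy : y ∈ s) :
    ∃ Φ : PartialDiffeomorph 𝓘(ℝ, F) 𝓘(ℝ, G) F G ∞,
      y ∈ Φ.source ∧ Φ.source ⊆ s ∧ ∀ z, Φ z = f z := by
  obtain ⟨e, he⟩ := hd y hy
  let T := (hf y hy).toOpenPartialHomeomorph f he (by simp)
  have hT : ∀ z, T z = f z := fun _ => rfl
  let T' := T.restrOpen s hs
  have hsub : T'.source ⊆ s := fun z hz => by
    rw [OpenPartialHomeomorph.restrOpen_source] at hz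
    exact hz.2
  refine ⟨⟨T'.toPartialEquiv, T'.open_source, T'.open_target, ?_, ?_⟩, ?_, hsub, fun _ => rfl⟩
  · exact fun z hz => (hf z (hsub hz)).contMDiffAt.contMDiffWithinAt
  · intro z hz
    have hz' : T'.symm z ∈ s := hsub (T'.map_target hz)
    obtain ⟨e', he'⟩ := hd _ hz'
    exact (T'.contDiffAt_symm hz he' (hf _ hz')).contMDiffAt.contMDiffWithinAt
  · change y ∈ T'.source
    rw [OpenPartialHomeomorph.restrOpen_source]
    exact ⟨(hf y hy).mem_toOpenPartialHomeomorph_source he (by simp), hy⟩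

variable {E : Type*} [NormedAddCommGroup E] [NormedSpace ℝ E]
  {Q : Type*} [TopologicalSpace Q] [ChartedSpace E Q] [IsManifold 𝓘(ℝ, E) ∞ Q]

/-- The derivatives of a chart of `Q` and of its inverse are inverse to each other. -/
lemma mfderiv_extChartAt_symm_comp {q₀ : Q} {x : E} (hx : x ∈ (extChartAt 𝓘(ℝ, E) q₀).target)
    (u : E) :
    mfderiv 𝓘(ℝ, E) 𝓘(ℝ, E) (extChartAt 𝓘(ℝ, E) q₀).symm x
      (mfderiv 𝓘(ℝ, E) 𝓘(ℝ, E) (extChartAt 𝓘(ℝ, E) q₀)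
        ((extChartAt 𝓘(ℝ, E) q₀).symm x) u) = u :=
  (chartParam 𝓘(ℝ, E) q₀).mfderiv_mfderiv_symm hx u

lemma mfderiv_extChartAt_comp {q₀ : Q} {x : E} (hx : x ∈ (extChartAt 𝓘(ℝ, E) q₀).target)
    (u : E) :
    mfderiv 𝓘(ℝ, E) 𝓘(ℝ, E) (extChartAt 𝓘(ℝ, E) q₀) ((extChartAt 𝓘(ℝ, E) q₀).symm x)
      (mfderiv 𝓘(ℝ, E) 𝓘(ℝ, E) (extChartAt 𝓘(ℝ, E) q₀).symm x u) = u :=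
  (chartParam 𝓘(ℝ, E) q₀).mfderiv_symm_mfderiv hx u

/-- The domain in `(E × E) × ℝ` of the bundle coordinates induced by the chart at `q₀`. -/
def bundleCoordDomain {E : Type*} [NormedAddCommGroup E] [NormedSpace ℝ E]
    {Q : Type*} [TopologicalSpace Q] [ChartedSpace E Q] (q₀ : Q) : Set ((E × E) × ℝ) :=
  {y | y.1.1 ∈ (extChartAt 𝓘(ℝ, E) q₀).target}

lemma isOpen_bundleCoordDomain {E : Type*} [NormedAddCommGroup E] [NormedSpace ℝ E]
    {Q : Type*} [TopologicalSpace Q] [ChartedSpace E Q] (q₀ : Q) :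
    IsOpen (bundleCoordDomain (E := E) q₀) :=
  (isOpen_extChartAt_target q₀).preimage (by fun_prop : Continuous fun y : (E × E) × ℝ => y.1.1)

lemma chartParam_extTangent_source (x₀ : ExtTangent E Q) :
    (chartParam (modelTR E) x₀).source = bundleCoordDomain x₀.1.1 := by
  change (extChartAt (modelTR E) x₀).target = _
  rw [extChartAt_prod, PartialEquiv.prod_target, FiberBundle.extChartAt_target]
  ext y
  have : y.1.1 ∈ (chartAt E x₀.1.1).target →
      (chartAt E x₀.1.1).symm y.1.1 ∈ (chartAt E x₀.1.1).source :=
    (chartAt E x₀.1.1).map_target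
  simpa [bundleCoordDomain, chartAt_self_eq] using this

lemma chartParam_extTangent_target (x₀ : ExtTangent E Q) :
    (chartParam (modelTR E) x₀).target = {x | x.1.1 ∈ (extChartAt 𝓘(ℝ, E) x₀.1.1).source} := by
  change (extChartAt (modelTR E) x₀).source = _
  rw [extChartAt_prod, PartialEquiv.prod_source]
  ext y
  simp [TangentBundle.mem_chart_source_iff, chartAt_self_eq]

/-- The bundle coordinates of `TQ × ℝ`: velocities are transformed by the derivative of the
chart. -/
lemma chartParam_extTangent_apply (x₀ : ExtTangent E Q) {y : (E × E) × ℝ}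
    (hy : y ∈ bundleCoordDomain (E := E) x₀.1.1) : chartParam (modelTR E) x₀ y =
      (⟨(extChartAt 𝓘(ℝ, E) x₀.1.1).symm y.1.1,
        mfderiv 𝓘(ℝ, E) 𝓘(ℝ, E) (extChartAt 𝓘(ℝ, E) x₀.1.1).symm y.1.1 y.1.2⟩, y.2) := by
  change (extChartAt (modelTR E) x₀).symm y = _
  have hq : (extChartAt 𝓘(ℝ, E) x₀.1.1).symm y.1.1 ∈ (chartAt E x₀.1.1).source := by
    rw [← extChartAt_source 𝓘(ℝ, E)]
    exact (extChartAt 𝓘(ℝ, E) x₀.1.1).map_target hy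
  have hb : (extChartAt 𝓘(ℝ, E) x₀.1.1).symm y.1.1 ∈
      (trivializationAt E (TangentSpace 𝓘(ℝ, E)) x₀.1.1).baseSet := by
    rwa [TangentBundle.trivializationAt_baseSet]
  rw [extChartAt_prod, FiberBundle.extChartAt]
  refine Prod.ext ?_ rfl
  change (trivializationAt E (TangentSpace 𝓘(ℝ, E)) x₀.1.1).toPartialEquiv.symm
    ((extChartAt 𝓘(ℝ, E) x₀.1.1).symm y.1.1, y.1.2) = _
  refine ((trivializationAt E (TangentSpace 𝓘(ℝ, E)) x₀.1.1).mk_symm hb y.1.2).symm.trans ?_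
  have h := TangentBundle.symmL_trivializationAt (I := 𝓘(ℝ, E)) hq
  rw [modelWithCornersSelf_coe, range_id, mfderivWithin_univ,
    (extChartAt 𝓘(ℝ, E) x₀.1.1).right_inv hy] at h
  rw [← Bundle.Trivialization.symmL_apply (R := ℝ) _ hb, h]
  rfl

end Charts

/-! ### Lagrangian systems in bundle coordinates -/

section LagrangianCoords

variable {E : Type*} [NormedAddCommGroup E] [NormedSpace ℝ E]
  {Q : Type*} [TopologicalSpace Q] [ChartedSpace E Q] [IsManifold 𝓘(ℝ, E) ∞ Q]

/-- The Lagrangian in the bundle coordinates induced by the chart at `q₀`, as a function on the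
coordinate space. -/
noncomputable def coordLagrangian (L : ExtTangent E Q → ℝ) (q₀ : Q) (y : (E × E) × ℝ) : ℝ :=
  lagrangianInChart L q₀ y.1.1 y.1.2 y.2

variable {L : ExtTangent E Q → ℝ} {q₀ : Q} {y : (E × E) × ℝ}

lemma coordLagrangian_eq (x₀ : ExtTangent E Q) (hy : y ∈ bundleCoordDomain (E := E) x₀.1.1) :
    coordLagrangian L x₀.1.1 y = L (chartParam (modelTR E) x₀ y) := by
  rw [chartParam_extTangent_apply x₀ hy]
  rfl

lemma contDiffAt_coordLagrangian (hL : ContMDiff (modelTR E) 𝓘(ℝ, ℝ) ∞ L)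
    (hy : y ∈ bundleCoordDomain (E := E) q₀) : ContDiffAt ℝ ∞ (coordLagrangian L q₀) y := by
  let x₀ : ExtTangent E Q := (⟨q₀, 0⟩, 0)
  have hopen := isOpen_bundleCoordDomain (E := E) q₀
  have hs : y ∈ (chartParam (modelTR E) x₀).source := by
    rw [chartParam_extTangent_source]; exact hy
  have h1 : ContMDiffAt 𝓘(ℝ, (E × E) × ℝ) 𝓘(ℝ, ℝ) ∞ (L ∘ chartParam (modelTR E) x₀) y :=
    (hL _).comp y ((chartParam (modelTR E) x₀).contMDiffOn.contMDiffAt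
      ((chartParam (modelTR E) x₀).open_source.mem_nhds hs))
  refine h1.contDiffAt.congr_of_eventuallyEq ?_
  filter_upwards [hopen.mem_nhds hy] with z hz using coordLagrangian_eq x₀ hz

/-- The Lagrangian on the fibre over a chart domain, in terms of the coordinate Lagrangian. -/
lemma lagrangian_fibre_eq {x : E} (hx : x ∈ (extChartAt 𝓘(ℝ, E) q₀).target) (z : ℝ) (w : E) :
    L (⟨(extChartAt 𝓘(ℝ, E) q₀).symm x, w⟩, z) =
      coordLagrangian L q₀ ((x, mfderiv 𝓘(ℝ, E) 𝓘(ℝ, E) (extChartAt 𝓘(ℝ, E) q₀)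
        ((extChartAt 𝓘(ℝ, E) q₀).symm x) w), z) := by
  have h := mfderiv_extChartAt_symm_comp hx w
  change _ = L (⟨_, mfderiv 𝓘(ℝ, E) 𝓘(ℝ, E) (extChartAt 𝓘(ℝ, E) q₀).symm x
    (mfderiv 𝓘(ℝ, E) 𝓘(ℝ, E) (extChartAt 𝓘(ℝ, E) q₀) ((extChartAt 𝓘(ℝ, E) q₀).symm x) w)⟩, z)
  rw [h]

/-- The fibre derivative is the coordinate momentum, transformed by the chart. -/
lemma fibreDeriv_eq (hL : ContMDiff (modelTR E) 𝓘(ℝ, ℝ) ∞ L) {x : E}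
    (hx : x ∈ (extChartAt 𝓘(ℝ, E) q₀).target) (z : ℝ) (v w : E) :
    fibreDeriv L ((extChartAt 𝓘(ℝ, E) q₀).symm x) v z w =
      coordMomentum (coordLagrangian L q₀) ((x, mfderiv 𝓘(ℝ, E) 𝓘(ℝ, E) (extChartAt 𝓘(ℝ, E) q₀)
        ((extChartAt 𝓘(ℝ, E) q₀).symm x) v), z)
        (mfderiv 𝓘(ℝ, E) 𝓘(ℝ, E) (extChartAt 𝓘(ℝ, E) q₀)
          ((extChartAt 𝓘(ℝ, E) q₀).symm x) w) := by
  set B : E →L[ℝ] E := mfderiv 𝓘(ℝ, E) 𝓘(ℝ, E) (extChartAt 𝓘(ℝ, E) q₀)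
        ((extChartAt 𝓘(ℝ, E) q₀).symm x)
  have hfun : (fun w : E => L (⟨(extChartAt 𝓘(ℝ, E) q₀).symm x, w⟩, z)) =
      fun w => coordLagrangian L q₀ ((x, B w), z) := funext fun w => lagrangian_fibre_eq hx z w
  have h1 := (contDiffAt_coordLagrangian (y := ((x, B v), z)) hL hx).differentiableAt (by simp)
  have h2 : HasFDerivAt (fun w : E => (((x, B w), z) : (E × E) × ℝ)) (velIncl E ∘L B) v :=
    ((hasFDerivAt_const x v).prodMk B.hasFDerivAt).prodMk (hasFDerivAt_const z v)
  have h3 := h1.hasFDerivAt.comp v h2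
  change fderiv ℝ (fun w : E => L (⟨(extChartAt 𝓘(ℝ, E) q₀).symm x, w⟩, z)) v w = _
  rw [hfun]
  exact DFunLike.congr_fun h3.fderiv w

/-- The Hessians in different bundle coordinates differ by linear changes of the velocities, so that
regularity of `L` is regularity of its coordinate expressions. -/
lemma coordRegularAt_coordLagrangian (hL : ContMDiff (modelTR E) 𝓘(ℝ, ℝ) ∞ L)
    (hreg : IsRegularLagrangian L) (hy : y ∈ bundleCoordDomain (E := E) q₀) :
    CoordRegularAt (coordLagrangian L q₀) y := by
  intro u hu
  have hx : y.1.1 ∈ (extChartAt 𝓘(ℝ, E) q₀).target := hy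
  set q := (extChartAt 𝓘(ℝ, E) q₀).symm y.1.1 with hq
  set A : E →L[ℝ] E := mfderiv 𝓘(ℝ, E) 𝓘(ℝ, E) (extChartAt 𝓘(ℝ, E) q₀).symm y.1.1
  set B : E →L[ℝ] E := mfderiv 𝓘(ℝ, E) 𝓘(ℝ, E) (extChartAt 𝓘(ℝ, E) q₀) q
  have hBA : ∀ u, B (A u) = u := mfderiv_extChartAt_comp hx
  have hAu : A u = 0 := by
    refine hreg q (A y.1.2) y.2 (A u) fun w => ?_
    have hfun : (fun v' : E => fderiv ℝ (fun w' : E => L (⟨q, w'⟩, y.2)) v') =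
        fun v' => (coordMomentum (coordLagrangian L q₀) ((y.1.1, B v'), y.2)) ∘L B := by
      ext v' w
      exact fibreDeriv_eq hL hx y.2 v' w
    rw [hfun]
    have hyB : ((y.1.1, B (A y.1.2)), y.2) = y := by rw [hBA]
    have h1 : DifferentiableAt ℝ (coordMomentum (coordLagrangian L q₀))
        ((y.1.1, B (A y.1.2)), y.2) := by
      rw [hyB]
      exact (contDiffAt_coordMomentum (contDiffAt_coordLagrangian hL hy)).differentiableAt
        (by simp)
    have h2 : HasFDerivAt (fun w : E => (((y.1.1, B w), y.2) : (E × E) × ℝ)) (velIncl E ∘L B)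
        (A y.1.2) :=
      ((hasFDerivAt_const y.1.1 _).prodMk B.hasFDerivAt).prodMk (hasFDerivAt_const y.2 _)
    have h3 := (h1.hasFDerivAt.comp (A y.1.2) h2).clm_comp (hasFDerivAt_const B (A y.1.2))
    have h4 := hu (B w)
    refine (DFunLike.congr_fun (DFunLike.congr_fun h3.fderiv (A u)) w).trans ?_
    rw [hyB]
    simpa [coordHessian, hBA] using h4
  rw [← hBA u, hAu, map_zero]

/-- The derivative of the bundle projection `π` in a parametrisation that covers the inverse of the
chart of `Q` at `q₀`. -/
lemma mfderiv_proj_comp {V : Type*} [NormedAddCommGroup V] [NormedSpace ℝ V]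
    {H : Type*} [TopologicalSpace H] {I : ModelWithCorners ℝ V H}
    {M : Type*} [TopologicalSpace M] [ChartedSpace H M]
    {Ψ : PartialDiffeomorph 𝓘(ℝ, (E × E) × ℝ) I ((E × E) × ℝ) M ∞} {π : M → Q}
    (hπ : ∀ x, MDifferentiableAt I 𝓘(ℝ, E) π x) (hy : y ∈ Ψ.source)
    (hsub : Ψ.source ⊆ bundleCoordDomain (E := E) q₀)
    (hproj : ∀ z ∈ Ψ.source, π (Ψ z) = (extChartAt 𝓘(ℝ, E) q₀).symm z.1.1)
    (u : (E × E) × ℝ) :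
    (mfderiv I 𝓘(ℝ, E) π (Ψ y) (mfderiv 𝓘(ℝ, (E × E) × ℝ) I Ψ y u) : E) =
      mfderiv 𝓘(ℝ, E) 𝓘(ℝ, E) (extChartAt 𝓘(ℝ, E) q₀).symm y.1.1 u.1.1 := by
  have h1 := (hπ (Ψ y)).hasMFDerivAt.comp y (Ψ.mdifferentiableAt (by simp) hy).hasMFDerivAt
  have h2 : HasMFDerivAt 𝓘(ℝ, (E × E) × ℝ) 𝓘(ℝ, E) (posProj E) y (posProj E) :=
    (posProj E).hasFDerivAt.hasMFDerivAt
  have h3 : HasMFDerivAt 𝓘(ℝ, E) 𝓘(ℝ, E) (extChartAt 𝓘(ℝ, E) q₀).symm (posProj E y)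
      (mfderiv 𝓘(ℝ, E) 𝓘(ℝ, E) (extChartAt 𝓘(ℝ, E) q₀).symm y.1.1) :=
    ((chartParam 𝓘(ℝ, E) q₀).mdifferentiableAt (by simp) (hsub hy)).hasMFDerivAt
  have h4 := (h3.comp y h2).congr_of_eventuallyEq (f₁ := π ∘ Ψ) (by
    filter_upwards [Ψ.open_source.mem_nhds hy] with z hz using hproj z hz)
  exact DFunLike.congr_fun (hasMFDerivAt_unique h1 h4) u

lemma differential_snd_comp {V : Type*} [NormedAddCommGroup V] [NormedSpace ℝ V]
    {H : Type*} [TopologicalSpace H] {I : ModelWithCorners ℝ V H}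
    {M : Type*} [TopologicalSpace M] [ChartedSpace H M]
    {Ψ : PartialDiffeomorph 𝓘(ℝ, (E × E) × ℝ) I ((E × E) × ℝ) M ∞} {ζ : M → ℝ}
    (hζ : ∀ x, MDifferentiableAt I 𝓘(ℝ, ℝ) ζ x) (hy : y ∈ Ψ.source)
    (hz : ∀ z ∈ Ψ.source, ζ (Ψ z) = z.2) (u : (E × E) × ℝ) :
    differential I ζ (Ψ y) (mfderiv 𝓘(ℝ, (E × E) × ℝ) I Ψ y u) = u.2 := by
  have h1 := (hζ (Ψ y)).hasMFDerivAt.comp y (Ψ.mdifferentiableAt (by simp) hy).hasMFDerivAt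
  have h2 : HasMFDerivAt 𝓘(ℝ, (E × E) × ℝ) 𝓘(ℝ, ℝ) (ContinuousLinearMap.snd ℝ (E × E) ℝ) y
      (ContinuousLinearMap.snd ℝ (E × E) ℝ) :=
    (ContinuousLinearMap.snd ℝ (E × E) ℝ).hasFDerivAt.hasMFDerivAt
  have h4 := h2.congr_of_eventuallyEq (f₁ := ζ ∘ Ψ) (by
    filter_upwards [Ψ.open_source.mem_nhds hy] with z hz' using hz z hz')
  exact DFunLike.congr_fun (hasMFDerivAt_unique h1 h4) u

lemma contMDiff_extTangent_proj :
    ContMDiff (modelTR E) 𝓘(ℝ, E) ∞ (fun x : ExtTangent E Q => x.1.1) :=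
  (Bundle.contMDiff_proj (TangentSpace 𝓘(ℝ, E))).comp contMDiff_fst

lemma contMDiff_extCotangent_proj :
    ContMDiff (modelCR E) 𝓘(ℝ, E) ∞ (fun x : ExtCotangent E Q => x.1.1) :=
  (Bundle.contMDiff_proj _).comp contMDiff_fst

/-- The bundle charts of `TQ × ℝ` turn `η_L` into the contact form of the coordinate Lagrangian. -/
lemma isContactRep_chartParam (hL : ContMDiff (modelTR E) 𝓘(ℝ, ℝ) ∞ L)
    (hreg : IsRegularLagrangian L) (x₀ : ExtTangent E Q) :
    IsContactRep (etaL L) (energy L) (chartParam (modelTR E) x₀)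
      (coordLagrangian L x₀.1.1) := by
  set Ψ := chartParam (modelTR E) x₀ with hΨ
  have hsrc : Ψ.source = bundleCoordDomain x₀.1.1 := chartParam_extTangent_source x₀
  have hsub : Ψ.source ⊆ bundleCoordDomain (E := E) x₀.1.1 := hsrc.subset
  have happ : ∀ y ∈ Ψ.source, Ψ y = _ := fun y hy => chartParam_extTangent_apply x₀ (hsub hy)
  refine ⟨fun y hy => contDiffAt_coordLagrangian hL (hsub hy),
    fun y hy => coordRegularAt_coordLagrangian hL hreg (hsub hy), fun y hy u => ?_,
    fun y hy => ?_⟩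
  · have hx : y.1.1 ∈ (extChartAt 𝓘(ℝ, E) x₀.1.1).target := hsub hy
    have h1 := mfderiv_proj_comp (Ψ := Ψ)
      (fun x => (contMDiff_extTangent_proj (E := E) (Q := Q)).mdifferentiable (by simp) x)
      hy hsub (fun z hz => by rw [happ z hz]) u
    have h2 : differential (modelTR E) (fun y : ExtTangent E Q => y.2) (Ψ y)
        (mfderiv 𝓘(ℝ, (E × E) × ℝ) (modelTR E) Ψ y u) = u.2 :=
      differential_snd_comp (Ψ := Ψ) (ζ := fun y : ExtTangent E Q => y.2)
      (fun x => (contMDiff_snd (n := ∞)).mdifferentiable (by simp) x) hy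
      (fun z hz => by rw [happ z hz]) u
    have h3 : ∀ w : E, fibreDeriv L (Ψ y).1.1 (Ψ y).1.2 (Ψ y).2 w = _ := fun w => by
      rw [happ y hy]
      exact fibreDeriv_eq hL hx y.2 _ w
    change differential (modelTR E) (fun y : ExtTangent E Q => y.2) (Ψ y)
        (mfderiv 𝓘(ℝ, (E × E) × ℝ) (modelTR E) Ψ y u) -
      fibreDeriv L (Ψ y).1.1 (Ψ y).1.2 (Ψ y).2
        (mfderiv (modelTR E) 𝓘(ℝ, E) (fun y : ExtTangent E Q => y.1.1) (Ψ y)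
          (mfderiv 𝓘(ℝ, (E × E) × ℝ) (modelTR E) Ψ y u)) =
      u.2 - coordMomentum (coordLagrangian L x₀.1.1) y u.1.1
    refine congrArg₂ (· - ·) h2 ?_
    refine (congrArg (fibreDeriv L (Ψ y).1.1 (Ψ y).1.2 (Ψ y).2) h1).trans ((h3 _).trans ?_)
    rw [mfderiv_extChartAt_comp hx, mfderiv_extChartAt_comp hx]
  · have hx : y.1.1 ∈ (extChartAt 𝓘(ℝ, E) x₀.1.1).target := hsub hy
    rw [coordEnergy, coordLagrangian_eq x₀ (hsub hy), ← hΨ]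
    unfold energy
    congr 1
    rw [happ y hy]
    refine (fibreDeriv_eq hL hx y.2 _ _).trans ?_
    rw [mfderiv_extChartAt_comp hx]

end LagrangianCoords

section Cotangent

variable {E : Type*} [NormedAddCommGroup E] [NormedSpace ℝ E]
  {Q : Type*} [TopologicalSpace Q] [ChartedSpace E Q] [IsManifold 𝓘(ℝ, E) ∞ Q]

lemma chartParam_extCotangent_target (ξ₀ : ExtCotangent E Q) :
    (chartParam (modelCR E) ξ₀).target = {ξ | ξ.1.1 ∈ (extChartAt 𝓘(ℝ, E) ξ₀.1.1).source} := by
  change (extChartAt (modelCR E) ξ₀).source = _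
  rw [extChartAt_prod, PartialEquiv.prod_source, FiberBundle.extChartAt]
  ext ξ
  simp [chartAt_self_eq, hom_trivializationAt_apply]

/-- The bundle coordinates of `T*Q × ℝ`: covectors are transformed by the derivative of the inverse
of the chart. -/
lemma extChartAt_extCotangent_apply (ξ₀ : ExtCotangent E Q) {q : Q}
    (hq : q ∈ (extChartAt 𝓘(ℝ, E) ξ₀.1.1).source) (p : E →L[ℝ] ℝ) (z : ℝ) :
    extChartAt (modelCR E) ξ₀ (⟨q, p⟩, z) =
      ((extChartAt 𝓘(ℝ, E) ξ₀.1.1 q,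
        ContinuousLinearMap.comp p (mfderiv 𝓘(ℝ, E) 𝓘(ℝ, E) (extChartAt 𝓘(ℝ, E) ξ₀.1.1).symm
          (extChartAt 𝓘(ℝ, E) ξ₀.1.1 q) : E →L[ℝ] E)), z) := by
  have hq' : q ∈ (chartAt E ξ₀.1.1).source := by rwa [← extChartAt_source 𝓘(ℝ, E)]
  have hb : q ∈ (trivializationAt E (TangentSpace 𝓘(ℝ, E)) ξ₀.1.1).baseSet := by
    rwa [TangentBundle.trivializationAt_baseSet]
  rw [extChartAt_prod, FiberBundle.extChartAt]
  refine Prod.ext (Prod.ext rfl ?_) rfl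
  have h := TangentBundle.symmL_trivializationAt (I := 𝓘(ℝ, E)) hq'
  rw [modelWithCornersSelf_coe, range_id, mfderivWithin_univ] at h
  refine Eq.trans (b := ContinuousLinearMap.comp p (Bundle.Trivialization.symmL ℝ
    (trivializationAt E (TangentSpace 𝓘(ℝ, E)) ξ₀.1.1) q : E →L[ℝ] E)) ?_ ?_
  · refine (congrArg Prod.snd (hom_trivializationAt_apply
      (E₁ := fun q : Q => TangentSpace 𝓘(ℝ, E) q) (E₂ := Bundle.Trivial Q ℝ) (RingHom.id ℝ) ξ₀.1.1
      (⟨q, p⟩ : Bundle.TotalSpace (E →L[ℝ] ℝ)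
        (fun q : Q => TangentSpace 𝓘(ℝ, E) q →L[ℝ] Bundle.Trivial Q ℝ q)))).trans ?_
    refine (ContinuousLinearMap.inCoordinates_eq hb (mem_univ _)).trans ?_
    ext w
    refine Eq.trans ?_ (congrArg p (congrFun
      (Bundle.Trivialization.symm_continuousLinearEquivAt_eq (R := ℝ) _ hb) w))
    rfl
  · rw [h]
    rfl

end Cotangent

/-! ### The Legendre transformation -/

section CoordLegendre

variable {E : Type*} [NormedAddCommGroup E] [NormedSpace ℝ E] {Λ : (E × E) × ℝ → ℝ}

/-- The Legendre transformation `(x, v, z) ↦ (x, ∂Λ/∂v, z)` of a coordinate Lagrangian. -/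
noncomputable def coordLegendre (Λ : (E × E) × ℝ → ℝ) (y : (E × E) × ℝ) :
    (E × (E →L[ℝ] ℝ)) × ℝ :=
  ((y.1.1, coordMomentum Λ y), y.2)

/-- The derivative `(a, b, c) ↦ (a, DP(a, 0, c) + (∂²Λ/∂v²) b, c)`, with `P = ∂Λ/∂v`, is invertible
because the Hessian is. -/
lemma exists_equiv_hasFDerivAt_coordLegendre [FiniteDimensional ℝ E] {y : (E × E) × ℝ}
    (h : ContDiffAt ℝ ∞ Λ y) (hreg : CoordRegularAt Λ y) :
    ∃ e : ((E × E) × ℝ) ≃L[ℝ] ((E × (E →L[ℝ] ℝ)) × ℝ),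
      HasFDerivAt (coordLegendre Λ) (e : (E × E) × ℝ →L[ℝ] (E × (E →L[ℝ] ℝ)) × ℝ) y := by
  obtain ⟨e, he⟩ := hreg.exists_equiv
  have hP := ((contDiffAt_coordMomentum h).differentiableAt (by simp)).hasFDerivAt
  have hd : HasFDerivAt (coordLegendre Λ)
      (((posProj E).prod (fderiv ℝ (coordMomentum Λ) y)).prod
        (ContinuousLinearMap.snd ℝ (E × E) ℝ)) y :=
    ((posProj E).hasFDerivAt.prodMk hP).prodMk (ContinuousLinearMap.snd ℝ (E × E) ℝ).hasFDerivAt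
  have hs := fderiv_coordMomentum_split (Λ := Λ) (y := y)
  simp only [← he, ContinuousLinearEquiv.coe_coe] at hs
  let inv : (E × (E →L[ℝ] ℝ)) × ℝ →L[ℝ] (E × E) × ℝ :=
    let a : (E × (E →L[ℝ] ℝ)) × ℝ →L[ℝ] E :=
      ContinuousLinearMap.fst ℝ _ _ ∘L ContinuousLinearMap.fst ℝ _ _
    let p : (E × (E →L[ℝ] ℝ)) × ℝ →L[ℝ] (E →L[ℝ] ℝ) :=
      ContinuousLinearMap.snd ℝ _ _ ∘L ContinuousLinearMap.fst ℝ _ _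
    let c : (E × (E →L[ℝ] ℝ)) × ℝ →L[ℝ] ℝ := ContinuousLinearMap.snd ℝ _ _
    (a.prod ((e.symm : (E →L[ℝ] ℝ) →L[ℝ] E) ∘L
      (p - fderiv ℝ (coordMomentum Λ) y ∘L ((a.prod 0).prod c)))).prod c
  refine ⟨ContinuousLinearEquiv.equivOfInverse
    (((posProj E).prod (fderiv ℝ (coordMomentum Λ) y)).prod
      (ContinuousLinearMap.snd ℝ (E × E) ℝ)) inv ?_ ?_, hd⟩
  · rintro ⟨⟨a, b⟩, c⟩
    have h1 := hs ((a, b), c)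
    ext <;> simp [inv, h1]
  · rintro ⟨⟨a, p⟩, c⟩
    have h1 := hs (inv ((a, p), c))
    refine Prod.ext (Prod.ext rfl ?_) rfl
    change fderiv ℝ (coordMomentum Λ) y (inv ((a, p), c)) = p
    rw [h1]
    simp [inv]

lemma exists_partialDiffeomorph_coordLegendre [FiniteDimensional ℝ E] {s : Set ((E × E) × ℝ)}
    (hs : IsOpen s) (h : ∀ y ∈ s, ContDiffAt ℝ ∞ Λ y) (hreg : ∀ y ∈ s, CoordRegularAt Λ y)
    {y : (E × E) × ℝ} (hy : y ∈ s) :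
    ∃ Φ : PartialDiffeomorph 𝓘(ℝ, (E × E) × ℝ) 𝓘(ℝ, (E × (E →L[ℝ] ℝ)) × ℝ)
      ((E × E) × ℝ) ((E × (E →L[ℝ] ℝ)) × ℝ) ∞,
      y ∈ Φ.source ∧ Φ.source ⊆ s ∧ ∀ z, Φ z = coordLegendre Λ z := by
  refine exists_partialDiffeomorph hs (fun z hz => ?_)
    (fun z hz => exists_equiv_hasFDerivAt_coordLegendre (h z hz) (hreg z hz)) hy
  have h1 : ContDiffAt ℝ ∞ (fun y : (E × E) × ℝ => y.1.1) z := by fun_prop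
  have h2 : ContDiffAt ℝ ∞ (fun y : (E × E) × ℝ => y.2) z := by fun_prop
  exact (h1.prodMk (contDiffAt_coordMomentum (h z hz))).prodMk h2

end CoordLegendre

section Legendre

variable {E : Type*} [NormedAddCommGroup E] [NormedSpace ℝ E]
  {Q : Type*} [TopologicalSpace Q] [ChartedSpace E Q] [IsManifold 𝓘(ℝ, E) ∞ Q]
  {L : ExtTangent E Q → ℝ}

/-- In bundle coordinates, the Legendre transformation is that of the coordinate Lagrangian. -/
lemma extChartAt_legendre (hL : ContMDiff (modelTR E) 𝓘(ℝ, ℝ) ∞ L) (x₀ : ExtTangent E Q)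
    {y : (E × E) × ℝ} (hy : y ∈ (chartParam (modelTR E) x₀).source) :
    extChartAt (modelCR E) (legendre L x₀) (legendre L (chartParam (modelTR E) x₀ y)) =
      coordLegendre (coordLagrangian L x₀.1.1) y := by
  rw [chartParam_extTangent_source] at hy
  have hx : y.1.1 ∈ (extChartAt 𝓘(ℝ, E) x₀.1.1).target := hy
  rw [chartParam_extTangent_apply x₀ hy]
  refine (extChartAt_extCotangent_apply (legendre L x₀)
    ((extChartAt 𝓘(ℝ, E) x₀.1.1).map_target hx) _ _).trans ?_
  have hr : extChartAt 𝓘(ℝ, E) x₀.1.1 ((extChartAt 𝓘(ℝ, E) x₀.1.1).symm y.1.1) = y.1.1 :=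
    (extChartAt 𝓘(ℝ, E) x₀.1.1).right_inv hx
  refine Prod.ext (Prod.ext hr ?_) rfl
  refine ContinuousLinearMap.ext fun (w : E) => ?_
  refine Eq.trans (b := fibreDeriv L ((extChartAt 𝓘(ℝ, E) x₀.1.1).symm y.1.1)
    (mfderiv 𝓘(ℝ, E) 𝓘(ℝ, E) (extChartAt 𝓘(ℝ, E) x₀.1.1).symm y.1.1 y.1.2) y.2
    (mfderiv 𝓘(ℝ, E) 𝓘(ℝ, E) (extChartAt 𝓘(ℝ, E) x₀.1.1).symm y.1.1 w)) ?_ ?_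
  · have hgen : ∀ x' : E, x' = y.1.1 →
        (mfderiv 𝓘(ℝ, E) 𝓘(ℝ, E) (extChartAt 𝓘(ℝ, E) x₀.1.1).symm x' w : E) =
        (mfderiv 𝓘(ℝ, E) 𝓘(ℝ, E) (extChartAt 𝓘(ℝ, E) x₀.1.1).symm y.1.1 w : E) := by
      rintro _ rfl
      rfl
    exact congrArg (fibreDeriv L ((extChartAt 𝓘(ℝ, E) x₀.1.1).symm y.1.1)
      (mfderiv 𝓘(ℝ, E) 𝓘(ℝ, E) (extChartAt 𝓘(ℝ, E) x₀.1.1).symm y.1.1 y.1.2) y.2) (hgen _ hr)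
  · refine (fibreDeriv_eq hL hx y.2 _ _).trans ?_
    rw [mfderiv_extChartAt_comp hx, mfderiv_extChartAt_comp hx]
    rfl

/-- The Legendre transformation carries the bundle coordinates of `TQ × ℝ` at `x₀` to a
parametrisation of an open subset of `T*Q × ℝ`. -/
lemma exists_legendre_param [FiniteDimensional ℝ E] (hL : ContMDiff (modelTR E) 𝓘(ℝ, ℝ) ∞ L)
    (hreg : IsRegularLagrangian L) {O : Set (ExtTangent E Q)} (hO : IsOpen O)
    {x₀ : ExtTangent E Q} (hx₀ : x₀ ∈ O) :
    ∃ Ψ' : PartialDiffeomorph 𝓘(ℝ, (E × E) × ℝ) (modelCR E) ((E × E) × ℝ) (ExtCotangent E Q) ∞,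
      (chartParam (modelTR E) x₀).symm x₀ ∈ Ψ'.source ∧
      Ψ'.source ⊆ (chartParam (modelTR E) x₀).source ∧
      ∀ y ∈ Ψ'.source, chartParam (modelTR E) x₀ y ∈ O ∧
        Ψ' y = legendre L (chartParam (modelTR E) x₀ y) := by
  set Ψ := chartParam (modelTR E) x₀ with hΨ
  have hsrc : Ψ.source = bundleCoordDomain x₀.1.1 := chartParam_extTangent_source x₀
  set y₀ := Ψ.symm x₀ with hy₀
  have hy₀s : y₀ ∈ Ψ.source := Ψ.map_target (mem_extChartAt_source x₀)
  have hΨy₀ : Ψ y₀ = x₀ := Ψ.right_inv (mem_extChartAt_source x₀)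
  obtain ⟨Φ, hΦy, hΦs, hΦ⟩ := exists_partialDiffeomorph_coordLegendre
    (Λ := coordLagrangian L x₀.1.1) (Ψ.toOpenPartialHomeomorph.isOpen_inter_preimage hO)
    (fun y hy => contDiffAt_coordLagrangian hL (hsrc ▸ hy.1))
    (fun y hy => coordRegularAt_coordLagrangian hL hreg (hsrc ▸ hy.1))
    (y := y₀) ⟨hy₀s, by change Ψ y₀ ∈ O; rwa [hΨy₀]⟩
  have hmem : legendre L (Ψ y₀) ∈ (extChartAt (modelCR E) (legendre L x₀)).source := by
    rw [hΨy₀]; exact mem_extChartAt_source _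
  set Ξ := chartParam (modelCR E) (legendre L x₀) with hΞ
  have htgt : ∀ y ∈ Φ.source, legendre L (Ψ y) ∈ Ξ.target := by
    intro y hy
    rw [hΞ, chartParam_extCotangent_target]
    have h1 := Ψ.map_source (hΦs hy).1
    rw [hΨ, chartParam_extTangent_target] at h1
    exact h1
  have hΦ' : ∀ y ∈ Φ.source, Φ y = extChartAt (modelCR E) (legendre L x₀) (legendre L (Ψ y)) :=
    fun y hy => (hΦ y).trans (extChartAt_legendre hL x₀ (hΦs hy).1).symm
  refine ⟨Φ.trans Ξ, ⟨hΦy, ?_⟩, fun y hy => (hΦs hy.1).1, fun y hy => ⟨(hΦs hy.1).2, ?_⟩⟩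
  · change Φ y₀ ∈ Ξ.source
    rw [hΦ' _ hΦy]
    exact (extChartAt (modelCR E) (legendre L x₀)).map_source (htgt _ hΦy)
  · change Ξ (Φ y) = _
    rw [hΦ' _ hy.1]
    exact (extChartAt (modelCR E) (legendre L x₀)).left_inv (htgt _ hy.1)

/-- The Legendre transformation of a regular Lagrangian is a local diffeomorphism. -/
lemma isLocalDiffeomorph_legendre [FiniteDimensional ℝ E]
    (hL : ContMDiff (modelTR E) 𝓘(ℝ, ℝ) ∞ L) (hreg : IsRegularLagrangian L) :
    IsLocalDiffeomorph (modelTR E) (modelCR E) ∞ (legendre L) := by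
  intro x
  obtain ⟨Ψ', hx, hsub, h⟩ := exists_legendre_param hL hreg isOpen_univ (mem_univ x)
  have hxt : x ∈ (chartParam (modelTR E) x).target := mem_extChartAt_source x
  refine ⟨(chartParam (modelTR E) x).symm.trans Ψ', ⟨hxt, hx⟩, fun z hz => ?_⟩
  refine Eq.trans ?_ (h _ hz.2).2.symm
  exact congrArg (legendre L) ((chartParam (modelTR E) x).right_inv hz.1).symm

/-- The parametrisations of `T*Q × ℝ` that are induced by the Legendre transformation turn `η_Q`
into the contact form of the coordinate Lagrangian. -/
lemma isContactRep_legendre_param (hL : ContMDiff (modelTR E) 𝓘(ℝ, ℝ) ∞ L)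
    (hreg : IsRegularLagrangian L) {O : Set (ExtTangent E Q)} {H : ExtCotangent E Q → ℝ}
    (hH : ∀ x ∈ O, H (legendre L x) = energy L x) {x₀ : ExtTangent E Q}
    {Ψ' : PartialDiffeomorph 𝓘(ℝ, (E × E) × ℝ) (modelCR E) ((E × E) × ℝ) (ExtCotangent E Q) ∞}
    (hsub : Ψ'.source ⊆ (chartParam (modelTR E) x₀).source)
    (h : ∀ y ∈ Ψ'.source, chartParam (modelTR E) x₀ y ∈ O ∧
      Ψ' y = legendre L (chartParam (modelTR E) x₀ y)) :
    IsContactRep etaQ H Ψ' (coordLagrangian L x₀.1.1) := by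
  have hrep := isContactRep_chartParam hL hreg x₀
  refine ⟨fun y hy => hrep.smooth y (hsub hy), fun y hy => hrep.regular y (hsub hy),
    fun y hy u => ?_, fun y hy => ?_⟩
  · have hsub' : Ψ'.source ⊆ bundleCoordDomain (E := E) x₀.1.1 := fun y hy => by
      have := hsub hy
      rwa [chartParam_extTangent_source] at this
    have hx : y.1.1 ∈ (extChartAt 𝓘(ℝ, E) x₀.1.1).target := hsub' hy
    have happ : ∀ z ∈ Ψ'.source, Ψ' z = legendre L _ := fun z hz =>
      (h z hz).2.trans (congrArg (legendre L) (chartParam_extTangent_apply x₀ (hsub' hz)))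
    have h1 := mfderiv_proj_comp (Ψ := Ψ')
      (fun x => (contMDiff_extCotangent_proj (E := E) (Q := Q)).mdifferentiable (by simp) x)
      hy hsub' (fun z hz => by rw [happ z hz]; rfl) u
    have h2 : differential (modelCR E) (fun y : ExtCotangent E Q => y.2) (Ψ' y)
        (mfderiv 𝓘(ℝ, (E × E) × ℝ) (modelCR E) Ψ' y u) = u.2 :=
      differential_snd_comp (Ψ := Ψ') (ζ := fun y : ExtCotangent E Q => y.2)
      (fun x => (contMDiff_snd (n := ∞)).mdifferentiable (by simp) x) hy
      (fun z hz => by rw [happ z hz]; rfl) u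
    have h3 : ∀ w : E, ((Ψ' y).1.2 : E →L[ℝ] ℝ) w = _ := fun w => by
      rw [happ y hy]
      exact fibreDeriv_eq hL hx y.2 _ w
    change differential (modelCR E) (fun y : ExtCotangent E Q => y.2) (Ψ' y)
        (mfderiv 𝓘(ℝ, (E × E) × ℝ) (modelCR E) Ψ' y u) -
      ((Ψ' y).1.2 : E →L[ℝ] ℝ)
        (mfderiv (modelCR E) 𝓘(ℝ, E) (fun y : ExtCotangent E Q => y.1.1) (Ψ' y)
          (mfderiv 𝓘(ℝ, (E × E) × ℝ) (modelCR E) Ψ' y u)) =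
      u.2 - coordMomentum (coordLagrangian L x₀.1.1) y u.1.1
    refine congrArg₂ (· - ·) h2 ?_
    refine (congrArg ((Ψ' y).1.2 : E →L[ℝ] ℝ) h1).trans ((h3 _).trans ?_)
    rw [mfderiv_extChartAt_comp hx, mfderiv_extChartAt_comp hx]
  · rw [(h y hy).2, hH _ (h y hy).1]
    exact hrep.energy y (hsub hy)

/-- The contact Hamiltonian vector field of a Hamiltonian that corresponds to `L` on `O` has smooth
local representatives on `FL(O)`. -/
lemma isLocallyRepOn_hamiltonianVF [FiniteDimensional ℝ E]
    (hL : ContMDiff (modelTR E) 𝓘(ℝ, ℝ) ∞ L) (hreg : IsRegularLagrangian L)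
    {O : Set (ExtTangent E Q)} (hO : IsOpen O) {H : ExtCotangent E Q → ℝ}
    (hH : ∀ x ∈ O, H (legendre L x) = energy L x) :
    IsLocallyRepOn ((E × E) × ℝ) (hamiltonianVF H) (legendre L '' O) := by
  rintro _ ⟨x, hx, rfl⟩
  obtain ⟨Ψ', hx', hsub, h⟩ := exists_legendre_param hL hreg hO hx
  refine ⟨Ψ', _, (isContactRep_legendre_param hL hreg hH hsub h).isLocalRep, ?_⟩
  have h1 := Ψ'.map_source hx'
  have h2 : Ψ' _ = _ := (h _ hx').2
  have h3 : chartParam (modelTR E) x ((chartParam (modelTR E) x).symm x) = x :=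
    (chartParam (modelTR E) x).right_inv (mem_extChartAt_source x)
  rw [h3] at h2
  rwa [← h2]

/-- The Lie derivative of `η_L` along `ξ_L` is a multiple of `η_L`. -/
lemma isLocallyConformal_lagrangianVF [FiniteDimensional ℝ E]
    (hL : ContMDiff (modelTR E) 𝓘(ℝ, ℝ) ∞ L) (hreg : IsRegularLagrangian L) :
    IsLocallyConformal ((E × E) × ℝ) (lagrangianVF L) (etaL L) :=
  isLocallyConformal_contactHamVF fun x =>
    ⟨_, _, mem_extChartAt_source x, isContactRep_chartParam hL hreg x⟩

/-- The Legendre transformation maps the integral curves of `ξ_L` to integral curves of the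
corresponding contact Hamiltonian vector field: in the parametrisations that it carries to each
other, both are the integral curves of the same Herglotz vector field. -/
lemma IsMIntegralCurveOn.legendre [FiniteDimensional ℝ E]
    (hL : ContMDiff (modelTR E) 𝓘(ℝ, ℝ) ∞ L) (hreg : IsRegularLagrangian L)
    {O : Set (ExtTangent E Q)} (hO : IsOpen O) {H : ExtCotangent E Q → ℝ}
    (hH : ∀ x ∈ O, H (legendre L x) = energy L x) {γ : ℝ → ExtTangent E Q} {s : Set ℝ}
    (hγ : IsMIntegralCurveOn γ (lagrangianVF L) s) (hmem : ∀ t ∈ s, γ t ∈ O) :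
    IsMIntegralCurveOn (fun t => _root_.legendre L (γ t)) (hamiltonianVF H) s := by
  intro t ht
  obtain ⟨Ψ', hx', hsub, h⟩ := exists_legendre_param hL hreg hO (hmem t ht)
  set Ψ := chartParam (modelTR E) (γ t) with hΨ
  have hxt : γ t ∈ Ψ.target := mem_extChartAt_source _
  have hrep' := isContactRep_legendre_param hL hreg hH hsub h
  have h1 := (isContactRep_chartParam hL hreg (γ t)).isLocalRep.hasDerivWithinAt hxt (hγ t ht)
  have h2 := hrep'.isLocalRep.hasMFDerivWithinAt (c := fun t => Ψ.symm (γ t)) hx' h1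
  have hev : ∀ᶠ r in 𝓝[s] t, Ψ' (Ψ.symm (γ r)) = _root_.legendre L (γ r) := by
    have hc : ContinuousWithinAt γ s t := (hγ t ht).continuousWithinAt
    have hc' : ContinuousWithinAt (fun r => Ψ.symm (γ r)) s t := h1.continuousWithinAt
    filter_upwards [hc.eventually_mem (Ψ.open_target.mem_nhds hxt),
      hc'.eventually_mem (Ψ'.open_source.mem_nhds hx')] with r hr hr'
    exact (h _ hr').2.trans (congrArg _ (Ψ.right_inv hr))
  have he : Ψ' (Ψ.symm (γ t)) = _root_.legendre L (γ t) :=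
    (h _ hx').2.trans (congrArg _ (Ψ.right_inv hxt))
  have h3 := h2.congr_of_eventuallyEq (hev.mono fun _ h => h.symm) he.symm
  rw [he] at h3
  exact h3

end Legendre

/-! ### Solutions of the Herglotz equations -/

section Partials

variable {E : Type*} [NormedAddCommGroup E] [NormedSpace ℝ E] {Λ : (E × E) × ℝ → ℝ}
  {y : (E × E) × ℝ}

lemma fderiv_velocity_eq (h : DifferentiableAt ℝ Λ y) :
    fderiv ℝ (fun w => Λ ((y.1.1, w), y.2)) y.1.2 = coordMomentum Λ y := by
  have h2 : HasFDerivAt (fun w : E => (((y.1.1, w), y.2) : (E × E) × ℝ)) (velIncl E) y.1.2 :=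
    (((hasFDerivAt_const y.1.1 _).prodMk (hasFDerivAt_id _)).prodMk
      (hasFDerivAt_const y.2 _)).congr_fderiv (by ext <;> simp)
  exact (h.hasFDerivAt.comp y.1.2 h2).fderiv

lemma fderiv_position_eq (h : DifferentiableAt ℝ Λ y) :
    fderiv ℝ (fun x => Λ ((x, y.1.2), y.2)) y.1.1 = fderiv ℝ Λ y ∘L posIncl E := by
  have h2 : HasFDerivAt (fun x : E => (((x, y.1.2), y.2) : (E × E) × ℝ)) (posIncl E) y.1.1 :=
    (((hasFDerivAt_id _).prodMk (hasFDerivAt_const y.1.2 _)).prodMk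
      (hasFDerivAt_const y.2 _)).congr_fderiv (by ext <;> simp)
  exact (h.hasFDerivAt.comp y.1.1 h2).fderiv

lemma deriv_action_eq (h : DifferentiableAt ℝ Λ y) :
    deriv (fun ζ => Λ (y.1, ζ)) y.2 = fderiv ℝ Λ y (0, 1) := by
  have h2 : HasDerivAt (fun ζ : ℝ => ((y.1, ζ) : (E × E) × ℝ)) (0, 1) y.2 :=
    (hasDerivAt_const y.2 y.1).prodMk (hasDerivAt_id _)
  exact (h.hasFDerivAt.comp_hasDerivAt y.2 h2).deriv

end Partials

section Herglotz

variable {E : Type*} [NormedAddCommGroup E] [NormedSpace ℝ E]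
  {Q : Type*} [TopologicalSpace Q] [ChartedSpace E Q] [IsManifold 𝓘(ℝ, E) ∞ Q]
  {L : ExtTangent E Q → ℝ}

/-- The velocity of a curve, read in a chart, is the derivative of the coordinate expression. -/
lemma chartParam_velocityLift {s : Set ℝ} (hs : UniqueDiffOn ℝ s) {q : ℝ → Q} {z : ℝ → ℝ}
    (x₀ : ExtTangent E Q) {t : ℝ} (ht : t ∈ s)
    (hq : MDifferentiableWithinAt 𝓘(ℝ, ℝ) 𝓘(ℝ, E) q s t)
    (hqt : q t ∈ (extChartAt 𝓘(ℝ, E) x₀.1.1).source) :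
    chartParam (modelTR E) x₀ ((extChartAt 𝓘(ℝ, E) x₀.1.1 (q t),
      derivWithin (fun t => extChartAt 𝓘(ℝ, E) x₀.1.1 (q t)) s t), z t) =
      velocityLift s q z t := by
  set φ := extChartAt 𝓘(ℝ, E) x₀.1.1
  have hy : φ (q t) ∈ φ.target := φ.map_source hqt
  have hv : derivWithin (fun t => φ (q t)) s t =
      mfderiv 𝓘(ℝ, E) 𝓘(ℝ, E) φ (q t) (mfderivWithin 𝓘(ℝ, ℝ) 𝓘(ℝ, E) q s t (1 : ℝ)) := by
    have hφ : MDifferentiableAt 𝓘(ℝ, E) 𝓘(ℝ, E) φ (q t) :=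
      (chartParam 𝓘(ℝ, E) x₀.1.1).mdifferentiableAt_symm hqt
    have h := hφ.hasMFDerivAt.comp_hasMFDerivWithinAt t hq.hasMFDerivWithinAt
    let A : E →L[ℝ] E := mfderiv 𝓘(ℝ, E) 𝓘(ℝ, E) φ (q t)
    let d : ℝ →L[ℝ] E := mfderivWithin 𝓘(ℝ, ℝ) 𝓘(ℝ, E) q s t
    have h' : HasFDerivWithinAt (fun t => φ (q t)) (A ∘L d) s t :=
      hasMFDerivWithinAt_iff_hasFDerivWithinAt.1 h
    exact h'.hasDerivWithinAt.derivWithin (hs t ht)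
  have hgen : ∀ (q' : Q) (u : E), φ.symm (φ (q t)) = q' → ∀ w : E,
      w = mfderiv 𝓘(ℝ, E) 𝓘(ℝ, E) φ q' u →
      (⟨φ.symm (φ (q t)), mfderiv 𝓘(ℝ, E) 𝓘(ℝ, E) φ.symm (φ (q t)) w⟩ :
        TangentBundle 𝓘(ℝ, E) Q) = ⟨q', u⟩ := by
    rintro _ u rfl _ rfl
    exact congrArg (Bundle.TotalSpace.mk _) (mfderiv_extChartAt_symm_comp hy u)
  refine (chartParam_extTangent_apply x₀ hy).trans ?_
  exact Prod.ext (hgen _ _ (φ.left_inv hqt) _ hv) rfl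

/-- The lift of a solution of the Herglotz equations is an integral curve of `ξ_L`. -/
lemma IsHerglotzSolution.isMIntegralCurveOn [FiniteDimensional ℝ E]
    (hL : ContMDiff (modelTR E) 𝓘(ℝ, ℝ) ∞ L) (hreg : IsRegularLagrangian L)
    {s : Set ℝ} (hs : UniqueDiffOn ℝ s) {q : ℝ → Q} {z : ℝ → ℝ}
    (h : IsHerglotzSolution (E := E) L s q z) :
    IsMIntegralCurveOn (velocityLift s q z) (lagrangianVF L) s := by
  intro t₀ ht₀
  set x₀ : ExtTangent E Q := velocityLift s q z t₀ with hx₀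
  set φ := extChartAt 𝓘(ℝ, E) (q t₀) with hφ
  set x : ℝ → E := fun t => φ (q t) with hx
  set v : ℝ → E := fun t => derivWithin x s t with hv
  set Λ := coordLagrangian L (q t₀) with hΛ
  set Ψ := chartParam (modelTR E) x₀ with hΨ
  let c : ℝ → (E × E) × ℝ := fun t => ((x t, v t), z t)
  have hnear : ∀ᶠ t in 𝓝[s] t₀, t ∈ s ∧ q t ∈ φ.source :=
    Filter.Eventually.and self_mem_nhdsWithin
      ((h.contMDiffOn t₀ ht₀).continuousWithinAt.eventually_mem (extChartAt_source_mem_nhds _))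
  have hc : ∀ t ∈ s, q t ∈ φ.source → Ψ (c t) = velocityLift s q z t := fun t ht hqt =>
    chartParam_velocityLift hs x₀ ht ((h.contMDiffOn t ht).mdifferentiableWithinAt (by simp)) hqt
  have hq₀ : q t₀ ∈ φ.source := mem_extChartAt_source _
  have hc₀ := hc t₀ ht₀ hq₀
  have hdom : ∀ t, q t ∈ φ.source → c t ∈ bundleCoordDomain (E := E) (q t₀) := fun t ht =>
    φ.map_source ht
  have hsm : ∀ t, q t ∈ φ.source → ContDiffAt ℝ ∞ Λ (c t) := fun t ht =>
    contDiffAt_coordLagrangian hL (hdom t ht)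
  -- the coordinate expression of the curve is of class `C²`
  have hxC : ContDiffWithinAt ℝ 2 x s t₀ := by
    have h1 : ContMDiffAt 𝓘(ℝ, E) 𝓘(ℝ, E) 2 φ (q t₀) := contMDiffAt_extChartAt
    exact (h1.comp_contMDiffWithinAt t₀ (h.contMDiffOn t₀ ht₀)).contDiffWithinAt
  have hxd : HasDerivWithinAt x (v t₀) s t₀ :=
    (hxC.differentiableWithinAt (by simp)).hasDerivWithinAt
  have hvd : HasDerivWithinAt v (derivWithin v s t₀) s t₀ := by
    have h1 : ContDiffWithinAt ℝ 1 (fun t => fderivWithin ℝ x s t 1) s t₀ :=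
      (hxC.fderivWithin_right hs (by norm_num) ht₀).clm_apply contDiffWithinAt_const
    exact (h1.differentiableWithinAt (by simp)).hasDerivWithinAt
  have hcd : HasDerivWithinAt c ((v t₀, derivWithin v s t₀), L x₀) s t₀ :=
    (hxd.prodMk hvd).prodMk (h.action t₀ ht₀)
  -- the Herglotz equation, in terms of the coordinate Lagrangian
  have hforce : HasDerivWithinAt (fun t => coordMomentum Λ (c t)) (coordForce Λ (c t₀)) s t₀ := by
    have hd := (hsm t₀ hq₀).differentiableAt (by simp)
    have h1 := h.herglotz t₀ ht₀
    have h2 : coordForce Λ (c t₀) = _ := congrArg₂ (· + ·) (fderiv_position_eq hd).symm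
      (congrArg₂ (· • ·) (deriv_action_eq hd).symm (fderiv_velocity_eq hd).symm)
    rw [h2]
    refine h1.congr_of_eventuallyEq ?_ (fderiv_velocity_eq hd).symm
    filter_upwards [hnear] with t ht
    exact (fderiv_velocity_eq ((hsm t ht.2).differentiableAt (by simp))).symm
  have hmom := ((contDiffAt_coordMomentum (hsm t₀ hq₀)).differentiableAt
    (by simp)).hasFDerivAt.comp_hasDerivWithinAt t₀ hcd
  have hfield := eq_coordField (Λ := Λ) (coordRegularAt_coordLagrangian hL hreg (hdom t₀ hq₀))
    (X := ((v t₀, derivWithin v s t₀), L x₀)) rfl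
    ((congrArg L hc₀).symm.trans (coordLagrangian_eq x₀ (hdom t₀ hq₀)).symm)
    ((hs t₀ ht₀).eq_deriv _ hmom hforce)
  rw [hfield] at hcd
  have hsrc : c t₀ ∈ Ψ.source := by
    rw [hΨ, chartParam_extTangent_source]; exact hdom t₀ hq₀
  have h3 := ((isContactRep_chartParam hL hreg x₀).isLocalRep.hasMFDerivWithinAt hsrc
    hcd).congr_of_eventuallyEq (hnear.mono fun t ht => (hc t ht.1 ht.2).symm) hc₀.symm
  change HasMFDerivWithinAt 𝓘(ℝ, ℝ) (modelTR E) (velocityLift s q z) s t₀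
    ((1 : ℝ →L[ℝ] ℝ).smulRight (lagrangianVF L (Ψ (c t₀)))) at h3
  rw [hc₀] at h3
  exact h3

end Herglotz

/-! ### The differential of the exact discrete Lagrangian -/

section LagrangianFlow

variable {E : Type*} [NormedAddCommGroup E] [NormedSpace ℝ E]
  {Q : Type*} [TopologicalSpace Q] [ChartedSpace E Q] [IsManifold 𝓘(ℝ, E) ∞ Q]
  {L : ExtTangent E Q → ℝ}

lemma t2Space_extTangent [T2Space Q] : T2Space (ExtTangent E Q) :=
  have : T2Space (TangentBundle 𝓘(ℝ, E) Q) := t2Space_totalSpace E (TangentSpace 𝓘(ℝ, E))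
  inferInstance

lemma t2Space_extCotangent [T2Space Q] : T2Space (ExtCotangent E Q) :=
  have := t2Space_totalSpace (E →L[ℝ] ℝ)
    (fun q : Q => TangentSpace 𝓘(ℝ, E) q →L[ℝ] Bundle.Trivial Q ℝ q)
  inferInstance

lemma lagrangianFlow_eq [FiniteDimensional ℝ E] [T2Space Q]
    (hL : ContMDiff (modelTR E) 𝓘(ℝ, ℝ) ∞ L) (hreg : IsRegularLagrangian L) {T : ℝ}
    {x : ExtTangent E Q} {γ : ℝ → ExtTangent E Q}
    (h : IsFlowLine (modelTR E) (lagrangianVF L) univ T x γ) {t : ℝ} (ht : t ∈ Icc 0 T) :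
    lagrangianFlow L t x = γ t := by
  have := t2Space_extTangent (E := E) (Q := Q)
  exact flowMap_eq (isLocallyConformal_lagrangianVF hL hreg).isLocallyRepOn ht.1 (h.mono ht.2)

/-- Along the flow lines of `ξ_L`, the action `z` has the derivative `L`. -/
lemma IsMIntegralCurveOn.hasDerivWithinAt_action [FiniteDimensional ℝ E]
    (hL : ContMDiff (modelTR E) 𝓘(ℝ, ℝ) ∞ L) (hreg : IsRegularLagrangian L)
    {γ : ℝ → ExtTangent E Q} {s : Set ℝ} (hγ : IsMIntegralCurveOn γ (lagrangianVF L) s) {t : ℝ}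
    (ht : t ∈ s) : HasDerivWithinAt (fun r => (γ r).2) (L (γ t)) s t := by
  set Ψ := chartParam (modelTR E) (γ t) with hΨ
  have hxt : γ t ∈ Ψ.target := mem_extChartAt_source _
  have h1 := (isContactRep_chartParam hL hreg (γ t)).isLocalRep.hasDerivWithinAt hxt (hγ t ht)
  have h2 : HasDerivWithinAt (fun r => (Ψ.symm (γ r)).2) _ s t :=
    (ContinuousLinearMap.snd ℝ (E × E) ℝ).hasFDerivAt.comp_hasDerivWithinAt t h1
  refine h2.congr_deriv ?_
  have hs : Ψ.symm (γ t) ∈ bundleCoordDomain (E := E) (γ t).1.1 := by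
    rw [← chartParam_extTangent_source]; exact Ψ.map_target hxt
  exact (coordLagrangian_eq (γ t) hs).trans (congrArg L (Ψ.right_inv hxt))

lemma integral_lagrangian_eq [FiniteDimensional ℝ E]
    (hL : ContMDiff (modelTR E) 𝓘(ℝ, ℝ) ∞ L) (hreg : IsRegularLagrangian L)
    {γ : ℝ → ExtTangent E Q} {T : ℝ} (hT : 0 ≤ T)
    (hγ : IsMIntegralCurveOn γ (lagrangianVF L) (Icc 0 T)) :
    ∫ t in (0 : ℝ)..T, L (γ t) = (γ T).2 - (γ 0).2 := by
  have hd := fun t ht => hγ.hasDerivWithinAt_action hL hreg (t := t) ht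
  refine intervalIntegral.integral_eq_sub_of_hasDerivAt_of_le (f := fun r => (γ r).2) hT
    (fun t ht => (hd t ht).continuousWithinAt)
    (fun t ht => (hd t ⟨ht.1.le, ht.2.le⟩).hasDerivAt (Icc_mem_nhds ht.1 ht.2)) ?_
  refine ContinuousOn.intervalIntegrable ?_
  rw [uIcc_of_le hT]
  exact hL.continuous.comp_continuousOn hγ.continuousOn

/-- The flow of `ξ_L` is smooth and rescales `η_L` by a nonzero factor. -/
lemma lagrangianFlow_conformal [FiniteDimensional ℝ E] [T2Space Q]
    (hL : ContMDiff (modelTR E) 𝓘(ℝ, ℝ) ∞ L) (hreg : IsRegularLagrangian L) {h : ℝ} (hh : 0 < h)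
    {x : ExtTangent E Q} (hx : x ∈ flowDomain (modelTR E) (lagrangianVF L) univ h) :
    ContMDiffAt (modelTR E) (modelTR E) ∞ (lagrangianFlow L h) x ∧
    ∃ σ : ℝ, σ ≠ 0 ∧ ∀ u, etaL L (lagrangianFlow L h x)
      (mfderiv (modelTR E) (modelTR E) (lagrangianFlow L h) x u) = σ * etaL L x u := by
  have := t2Space_extTangent (E := E) (Q := Q)
  obtain ⟨γ, hγ⟩ := hx
  have hconf := isLocallyConformal_lagrangianVF hL hreg
  obtain ⟨Φ, hΦ, hΦf, σ, hσ, hη⟩ := hconf.isConformalFlowAt hh hγ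
  have heq : lagrangianFlow L h =ᶠ[𝓝 x] Φ := by
    filter_upwards [hΦf] with y ⟨γ', hγ', he⟩
    rw [← he]
    exact flowMap_eq hconf.isLocallyRepOn hh.le hγ'
  refine ⟨hΦ.congr_of_eventuallyEq heq, σ, hσ, fun u => ?_⟩
  have h1 := (hΦ.mdifferentiableAt (by simp)).hasMFDerivAt.congr_of_eventuallyEq heq
  -- `lagrangianFlow L h x` and `Φ x` are equal, but their tangent spaces are different types
  have hgen : ∀ ξ, ξ = Φ x → ∀ w : (E × E) × ℝ,
      (etaL L ξ : (E × E) × ℝ →L[ℝ] ℝ) w = (etaL L (Φ x) : (E × E) × ℝ →L[ℝ] ℝ) w := by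
    rintro _ rfl w
    rfl
  refine Eq.trans ?_ (hη u)
  refine Eq.trans ?_ (hgen _ heq.self_of_nhds _)
  exact congrArg (etaL L (lagrangianFlow L h x)) (DFunLike.congr_fun h1.mfderiv u)

/-- The pullback of `η_L` along a map, in terms of the base point and of the action. -/
lemma etaL_mfderiv {V' : Type*} [NormedAddCommGroup V'] [NormedSpace ℝ V']
    {H' : Type*} [TopologicalSpace H'] {J : ModelWithCorners ℝ V' H'}
    {N : Type*} [TopologicalSpace N] [ChartedSpace H' N] {f : N → ExtTangent E Q} {p : N}
    (hf : MDifferentiableAt J (modelTR E) f p) {b : N → Q} {b' : V' →L[ℝ] E}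
    (hb : HasMFDerivAt J 𝓘(ℝ, E) b p b') (hfb : ∀ᶠ y in 𝓝 p, (f y).1.1 = b y)
    {ζ : N → ℝ} {ζ' : V' →L[ℝ] ℝ} (hζ : HasMFDerivAt J 𝓘(ℝ, ℝ) ζ p ζ')
    (hfζ : ∀ᶠ y in 𝓝 p, (f y).2 = ζ y) (w : V') :
    etaL L (f p) (mfderiv J (modelTR E) f p w) =
      ζ' w - fibreDeriv L (f p).1.1 (f p).1.2 (f p).2 (b' w) := by
  have h1 := ((contMDiff_extTangent_proj (E := E) (Q := Q)).mdifferentiable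
    (by simp) (f p)).hasMFDerivAt.comp p hf.hasMFDerivAt
  have h2 := (((contMDiff_snd (n := ∞) (I := 𝓘(ℝ, E).prod 𝓘(ℝ, E)) (J := 𝓘(ℝ, ℝ))
    (M := TangentBundle 𝓘(ℝ, E) Q) (N := ℝ)).mdifferentiable
    (by simp) (f p)).hasMFDerivAt).comp p hf.hasMFDerivAt
  have h3 := hb.congr_of_eventuallyEq (f₁ := fun y => (f y).1.1) hfb
  have h4 := hζ.congr_of_eventuallyEq (f₁ := fun y => (f y).2) hfζ
  have h5 := DFunLike.congr_fun (hasMFDerivAt_unique h1 h3) w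
  have h6 := DFunLike.congr_fun (hasMFDerivAt_unique h2 h4) w
  exact congrArg₂ (fun a b : ℝ => a - b) h6 (congrArg (fibreDeriv L (f p).1.1 (f p).1.2 (f p).2) h5)

/-- A point of `T*Q × ℝ` over `q` is determined by its covector. -/
lemma mk_eq_legendre {x : ExtTangent E Q} {q : Q} {z : ℝ} {α : TangentSpace 𝓘(ℝ, E) q →L[ℝ] ℝ}
    (hq : x.1.1 = q) (hz : x.2 = z)
    (hα : ∀ u : E, α u = fibreDeriv L x.1.1 x.1.2 x.2 u) :
    ((⟨q, α⟩, z) : ExtCotangent E Q) = legendre L x := by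
  subst hq hz
  have : α = fibreDeriv L x.1.1 x.1.2 x.2 := ContinuousLinearMap.ext hα
  rw [this]
  rfl

end LagrangianFlow

section Partials

variable {E : Type*} [NormedAddCommGroup E] [NormedSpace ℝ E]
  {Q : Type*} [TopologicalSpace Q] [ChartedSpace E Q]
  {S : Q × Q × ℝ → ℝ} {S' : E × E × ℝ →L[ℝ] ℝ} {p : Q × Q × ℝ}

lemma discD1_apply (h : HasMFDerivAt (modelQQR E) 𝓘(ℝ, ℝ) S p S') (u : E) :
    discD1 (E := E) S p.1 p.2.1 p.2.2 u = S' (u, 0, 0) := by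
  have h1 : HasMFDerivAt 𝓘(ℝ, E) (modelQQR E) (fun q : Q => (q, p.2)) p.1
      (ContinuousLinearMap.inl ℝ E (E × ℝ)) :=
    (hasMFDerivAt_id p.1).prodMk (hasMFDerivAt_const p.2 p.1)
  exact DFunLike.congr_fun (HasMFDerivAt.comp p.1 h h1).mfderiv u

lemma discD2_apply (h : HasMFDerivAt (modelQQR E) 𝓘(ℝ, ℝ) S p S') (u : E) :
    discD2 (E := E) S p.1 p.2.1 p.2.2 u = S' (0, u, 0) := by
  have h1 : HasMFDerivAt 𝓘(ℝ, E) (modelQQR E) (fun q : Q => (p.1, q, p.2.2)) p.2.1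
      (ContinuousLinearMap.inr ℝ E (E × ℝ) ∘L ContinuousLinearMap.inl ℝ E ℝ) :=
    (hasMFDerivAt_const p.1 p.2.1).prodMk
      ((hasMFDerivAt_id p.2.1).prodMk (hasMFDerivAt_const p.2.2 p.2.1))
  exact DFunLike.congr_fun (HasMFDerivAt.comp p.2.1 h h1).mfderiv u

lemma discSigma_eq (h : HasMFDerivAt (modelQQR E) 𝓘(ℝ, ℝ) S p S') :
    discSigma S p.1 p.2.1 p.2.2 = 1 + S' (0, 0, 1) := by
  have h1 : HasMFDerivAt 𝓘(ℝ, ℝ) (modelQQR E) (fun z : ℝ => (p.1, p.2.1, z)) p.2.2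
      (ContinuousLinearMap.inr ℝ E (E × ℝ) ∘L ContinuousLinearMap.inr ℝ E ℝ) :=
    (hasMFDerivAt_const p.1 p.2.2).prodMk
      ((hasMFDerivAt_const p.2.1 p.2.2).prodMk (hasMFDerivAt_id p.2.2))
  have h2 := hasMFDerivAt_iff_hasFDerivAt.1 (HasMFDerivAt.comp p.2.2 h h1)
  have h3 : HasFDerivAt (fun z : ℝ => S (p.1, p.2.1, z)) (S' ∘L
      (ContinuousLinearMap.inr ℝ E (E × ℝ) ∘L ContinuousLinearMap.inr ℝ E ℝ)) p.2.2 := h2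
  rw [discSigma, h3.hasDerivAt.deriv]
  rfl

end Partials

namespace IsExactRetraction

variable {E : Type*} [NormedAddCommGroup E] [NormedSpace ℝ E]
  {Q : Type*} [TopologicalSpace Q] [ChartedSpace E Q] [IsManifold 𝓘(ℝ, E) ∞ Q]
  {L : ExtTangent E Q → ℝ} {h : ℝ} {V : Set (ExtTangent E Q)} {D : Set (Q × Q × ℝ)}
  {R : Q × Q × ℝ → ExtTangent E Q} {p : Q × Q × ℝ}

lemma contactExp_apply (hR : IsExactRetraction L h V D R) (hp : p ∈ D) :
    contactExp L h (R p) = p := hR.invOn.2 hp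

lemma base_eq (hR : IsExactRetraction L h V D R) (hp : p ∈ D) : (R p).1.1 = p.1 :=
  congrArg Prod.fst (hR.contactExp_apply hp)

lemma base_flow_eq (hR : IsExactRetraction L h V D R) (hp : p ∈ D) :
    (lagrangianFlow L h (R p)).1.1 = p.2.1 :=
  congrArg (fun x => x.2.1) (hR.contactExp_apply hp)

lemma action_eq (hR : IsExactRetraction L h V D R) (hp : p ∈ D) : (R p).2 = p.2.2 :=
  congrArg (fun x => x.2.2) (hR.contactExp_apply hp)

lemma mem_flowDomain (hR : IsExactRetraction L h V D R) (hp : p ∈ D) :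
    R p ∈ flowDomain (modelTR E) (lagrangianVF L) univ h :=
  hR.source_subset (hR.mapsTo_inv hp)

/-- The exact retraction as a diffeomorphism between the open sets `D` and `V`. -/
noncomputable def partialDiffeomorph (hR : IsExactRetraction L h V D R) :
    PartialDiffeomorph (modelQQR E) (modelTR E) (Q × Q × ℝ) (ExtTangent E Q) ∞ where
  toFun := R
  invFun := contactExp L h
  source := D
  target := V
  map_source' _ hp := hR.mapsTo_inv hp
  map_target' _ hx := hR.mapsTo_exp hx
  left_inv' _ hp := hR.invOn.2 hp
  right_inv' _ hx := hR.invOn.1 hx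
  open_source := hR.isOpen_target
  open_target := hR.isOpen_source
  contMDiffOn_toFun := hR.smooth_inv
  contMDiffOn_invFun := hR.smooth_exp

variable [FiniteDimensional ℝ E] [T2Space Q]

/-- As `ż = L` along the flow lines of `ξ_L`, the exact discrete Lagrangian is the increment of the
action. -/
lemma exactDiscreteLagrangian_eq (hR : IsExactRetraction L h V D R)
    (hL : ContMDiff (modelTR E) 𝓘(ℝ, ℝ) ∞ L) (hreg : IsRegularLagrangian L) (hh : 0 < h)
    (hp : p ∈ D) :
    exactDiscreteLagrangian L h R p = (lagrangianFlow L h (R p)).2 - p.2.2 := by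
  obtain ⟨γ, hγ⟩ := hR.mem_flowDomain hp
  have h1 : exactDiscreteLagrangian L h R p = ∫ t in (0 : ℝ)..h, L (γ t) := by
    refine intervalIntegral.integral_congr fun t ht => ?_
    rw [uIcc_of_le hh.le] at ht
    exact congrArg L (lagrangianFlow_eq hL hreg hγ ht)
  rw [h1, integral_lagrangian_eq hL hreg hh.le hγ.isMIntegralCurveOn_Icc, hγ.1, hR.action_eq hp,
    lagrangianFlow_eq hL hreg hγ ⟨hh.le, le_rfl⟩]

lemma contMDiffAt_flow (hR : IsExactRetraction L h V D R)
    (hL : ContMDiff (modelTR E) 𝓘(ℝ, ℝ) ∞ L) (hreg : IsRegularLagrangian L) (hh : 0 < h)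
    (hp : p ∈ D) :
    ContMDiffAt (modelQQR E) (modelTR E) ∞ (fun p => lagrangianFlow L h (R p)) p :=
  (lagrangianFlow_conformal hL hreg hh (hR.mem_flowDomain hp)).1.comp p
    (hR.smooth_inv.contMDiffAt (hR.isOpen_target.mem_nhds hp))

lemma contMDiffOn_exactDiscreteLagrangian (hR : IsExactRetraction L h V D R)
    (hL : ContMDiff (modelTR E) 𝓘(ℝ, ℝ) ∞ L) (hreg : IsRegularLagrangian L) (hh : 0 < h) :
    ContMDiffOn (modelQQR E) 𝓘(ℝ, ℝ) ∞ (exactDiscreteLagrangian L h R) D := by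
  intro p hp
  have h1 : ContMDiffAt (modelQQR E) 𝓘(ℝ, ℝ) ∞ (fun p => (lagrangianFlow L h (R p)).2) p :=
    contMDiffAt_snd.comp p (hR.contMDiffAt_flow hL hreg hh hp)
  have h2 : ContMDiffAt (modelQQR E) 𝓘(ℝ, ℝ) ∞ (fun p : Q × Q × ℝ => p.2.2) p :=
    contMDiffAt_snd.comp p contMDiffAt_snd
  refine ContMDiffAt.contMDiffWithinAt ((h1.sub h2).congr_of_eventuallyEq ?_)
  filter_upwards [hR.isOpen_target.mem_nhds hp] with p' hp'
  exact hR.exactDiscreteLagrangian_eq hL hreg hh hp'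

/-- The flow of `ξ_L` rescales `η_L`; in terms of the exact discrete Lagrangian `S`, this is
`dz + dS - p₁ dq₁ = σ (dz - p₀ dq₀)`, with the momenta `p₀`, `p₁` at the two ends. -/
lemma exists_conformal_factor (hR : IsExactRetraction L h V D R)
    (hL : ContMDiff (modelTR E) 𝓘(ℝ, ℝ) ∞ L) (hreg : IsRegularLagrangian L) (hh : 0 < h)
    (hp : p ∈ D) :
    ∃ (S' : E × E × ℝ →L[ℝ] ℝ) (σ : ℝ), σ ≠ 0 ∧
      HasMFDerivAt (modelQQR E) 𝓘(ℝ, ℝ) (exactDiscreteLagrangian L h R) p S' ∧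
      ∀ w : E × E × ℝ, w.2.2 + S' w - fibreDeriv L (lagrangianFlow L h (R p)).1.1
          (lagrangianFlow L h (R p)).1.2 (lagrangianFlow L h (R p)).2 w.2.1 =
        σ * (w.2.2 - fibreDeriv L (R p).1.1 (R p).1.2 (R p).2 w.1) := by
  obtain ⟨hsm, σ, hσ, hconf⟩ := lagrangianFlow_conformal hL hreg hh (hR.mem_flowDomain hp)
  have hS : HasMFDerivAt (modelQQR E) 𝓘(ℝ, ℝ) (exactDiscreteLagrangian L h R) p _ :=
    (((hR.contMDiffOn_exactDiscreteLagrangian hL hreg hh).contMDiffAt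
      (hR.isOpen_target.mem_nhds hp)).mdifferentiableAt (by simp)).hasMFDerivAt
  have hnear := hR.isOpen_target.mem_nhds hp
  have hRd : MDifferentiableAt (modelQQR E) (modelTR E) R p :=
    (hR.smooth_inv.contMDiffAt hnear).mdifferentiableAt (by simp)
  have hKd := (hR.contMDiffAt_flow hL hreg hh hp).mdifferentiableAt (by simp)
  let π₁ : E × E × ℝ →L[ℝ] E := ContinuousLinearMap.fst ℝ E (E × ℝ)
  let π₂ : E × E × ℝ →L[ℝ] E :=
    ContinuousLinearMap.fst ℝ E ℝ ∘L ContinuousLinearMap.snd ℝ E (E × ℝ)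
  let π₃ : E × E × ℝ →L[ℝ] ℝ :=
    ContinuousLinearMap.snd ℝ E ℝ ∘L ContinuousLinearMap.snd ℝ E (E × ℝ)
  have h₁ : HasMFDerivAt (modelQQR E) 𝓘(ℝ, E) (fun p : Q × Q × ℝ => p.1) p π₁ :=
    hasMFDerivAt_fst p
  have h₂ : HasMFDerivAt (modelQQR E) 𝓘(ℝ, E) (fun p : Q × Q × ℝ => p.2.1) p π₂ :=
    (hasMFDerivAt_fst p.2).comp p (hasMFDerivAt_snd p)
  have h₃ : HasMFDerivAt (modelQQR E) 𝓘(ℝ, ℝ) (fun p : Q × Q × ℝ => p.2.2) p π₃ :=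
    (hasMFDerivAt_snd p.2).comp p (hasMFDerivAt_snd p)
  set S' : E × E × ℝ →L[ℝ] ℝ :=
    mfderiv (modelQQR E) 𝓘(ℝ, ℝ) (exactDiscreteLagrangian L h R) p with hS'
  have hzS : HasMFDerivAt (modelQQR E) 𝓘(ℝ, ℝ)
      (fun p : Q × Q × ℝ => p.2.2 + exactDiscreteLagrangian L h R p) p (π₃ + S') := h₃.add hS
  refine ⟨S', σ, hσ, hS, fun w => ?_⟩
  have e1 := etaL_mfderiv (L := L) hRd h₁
    (by filter_upwards [hnear] with y hy using hR.base_eq hy) h₃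
    (by filter_upwards [hnear] with y hy using hR.action_eq hy) w
  have e2 := etaL_mfderiv (L := L) hKd h₂
    (by filter_upwards [hnear] with y hy using hR.base_flow_eq hy) hzS
    (by
      filter_upwards [hnear] with y hy
      rw [hR.exactDiscreteLagrangian_eq hL hreg hh hy]
      ring) w
  have e3 := (hsm.mdifferentiableAt (by simp)).hasMFDerivAt.comp p hRd.hasMFDerivAt
  have e4 := congrArg (etaL L (lagrangianFlow L h (R p))) (DFunLike.congr_fun e3.mfderiv w)
  exact e2.symm.trans (e4.trans ((hconf _).trans (congrArg (σ * ·) e1)))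

/-- The discrete Legendre transforms of the exact discrete Lagrangian `S` are the Legendre
transforms of the two ends of the flow line: `p₀ = -D₁S / (1 + D_z S)` and `p₁ = D₂S`. -/
lemma discLegendre_eq (hR : IsExactRetraction L h V D R)
    (hL : ContMDiff (modelTR E) 𝓘(ℝ, ℝ) ∞ L) (hreg : IsRegularLagrangian L) (hh : 0 < h)
    (hp : p ∈ D) :
    discSigma (exactDiscreteLagrangian L h R) p.1 p.2.1 p.2.2 ≠ 0 ∧
    discLegendreMinus (exactDiscreteLagrangian L h R) p = legendre L (R p) ∧
    discLegendrePlus (exactDiscreteLagrangian L h R) p =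
      legendre L (lagrangianFlow L h (R p)) := by
  obtain ⟨S', σ, hσ, hS, hw⟩ := hR.exists_conformal_factor hL hreg hh hp
  obtain ⟨p₀, hp₀⟩ : ∃ p₀ : E →L[ℝ] ℝ, ∀ u : E,
      fibreDeriv L (R p).1.1 (R p).1.2 (R p).2 u = p₀ u := ⟨_, fun _ => rfl⟩
  obtain ⟨p₁, hp₁⟩ : ∃ p₁ : E →L[ℝ] ℝ, ∀ u : E, fibreDeriv L (lagrangianFlow L h (R p)).1.1
      (lagrangianFlow L h (R p)).1.2 (lagrangianFlow L h (R p)).2 u = p₁ u := ⟨_, fun _ => rfl⟩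
  simp only [hp₀, hp₁] at hw
  have hσ' : discSigma (exactDiscreteLagrangian L h R) p.1 p.2.1 p.2.2 = σ := by
    rw [discSigma_eq hS]
    simpa using hw (0, 0, 1)
  refine ⟨hσ' ▸ hσ, mk_eq_legendre (hR.base_eq hp) (hR.action_eq hp) fun u => ?_,
    mk_eq_legendre (hR.base_flow_eq hp) ?_ fun u => ?_⟩
  · have h1 : S' (u, 0, 0) = -(σ * p₀ u) := by simpa using hw (u, 0, 0)
    refine Eq.trans ?_ (hp₀ u).symm
    refine (congrArg (-(discSigma (exactDiscreteLagrangian L h R) p.1 p.2.1 p.2.2)⁻¹ * ·)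
      ((discD1_apply hS u).trans h1)).trans ?_
    simp only [hσ']
    rw [neg_mul_neg, inv_mul_cancel_left₀ hσ]
  · rw [hR.exactDiscreteLagrangian_eq hL hreg hh hp]
    ring
  · have h1 := hw (0, u, 0)
    refine (discD2_apply hS u).trans (Eq.trans ?_ (hp₁ u).symm)
    simpa [sub_eq_zero] using h1

/-- The exact discrete Lagrangian is a regular discrete Lagrangian. -/
lemma isRegularDiscreteLagrangian (hR : IsExactRetraction L h V D R)
    (hL : ContMDiff (modelTR E) 𝓘(ℝ, ℝ) ∞ L) (hreg : IsRegularLagrangian L) (hh : 0 < h) :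
    IsRegularDiscreteLagrangian E (exactDiscreteLagrangian L h R) D where
  isOpen := hR.isOpen_target
  smooth := hR.contMDiffOn_exactDiscreteLagrangian hL hreg hh
  sigma_ne_zero _ hp := (hR.discLegendre_eq hL hreg hh hp).1
  legendre := by
    rintro ⟨p, hp⟩
    obtain ⟨Φ, hx, hΦ⟩ := isLocalDiffeomorph_legendre hL hreg (R p)
    refine ⟨hR.partialDiffeomorph.trans Φ, ⟨hp, hx⟩, fun y hy => ?_⟩
    exact (hR.discLegendre_eq hL hreg hh hy.1).2.1.trans (hΦ hy.2)

end IsExactRetraction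

/-! ### Discrete and continuous solutions -/

section Discrete

lemma neg_inv_smul_eq_iff {M : Type*} [AddCommGroup M] [Module ℝ M] {σ : ℝ} (hσ : σ ≠ 0)
    {a b : M} : -σ⁻¹ • a = b ↔ a + σ • b = 0 := by
  constructor
  · rintro rfl
    rw [neg_smul, smul_neg, smul_inv_smul₀ hσ, add_neg_cancel]
  · intro h
    rw [eq_neg_of_add_eq_zero_left h, neg_smul_neg, inv_smul_smul₀ hσ]

variable {E : Type*} [NormedAddCommGroup E] [NormedSpace ℝ E]
  {Q : Type*} [TopologicalSpace Q] [ChartedSpace E Q] [IsManifold 𝓘(ℝ, E) ∞ Q]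

/-- The discrete Herglotz equations are the matching of the discrete Legendre transforms. -/
lemma discLegendreMinus_eq_discLegendrePlus_iff {Ld : Q × Q × ℝ → ℝ} {q₀ q₁ q₂ : Q} {z₀ z₁ : ℝ}
    (hσ : discSigma Ld q₁ q₂ z₁ ≠ 0) (hz : z₁ = z₀ + Ld (q₀, q₁, z₀)) :
    discLegendreMinus Ld (q₁, q₂, z₁) = (discLegendrePlus Ld (q₀, q₁, z₀) : ExtCotangent E Q) ↔
      discD1 (E := E) Ld q₁ q₂ z₁ + discSigma Ld q₁ q₂ z₁ • discD2 (E := E) Ld q₀ q₁ z₀ = 0 := by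
  have h1 : discLegendreMinus Ld (q₁, q₂, z₁) =
      (discLegendrePlus Ld (q₀, q₁, z₀) : ExtCotangent E Q) ↔
      -(discSigma Ld q₁ q₂ z₁)⁻¹ • discD1 (E := E) Ld q₁ q₂ z₁ = discD2 (E := E) Ld q₀ q₁ z₀ := by
    constructor
    · intro h
      have h2 := congrArg Prod.fst h
      simpa [discLegendreMinus, discLegendrePlus] using h2
    · intro h
      exact Prod.ext (congrArg (Bundle.TotalSpace.mk q₁) h) hz
  exact h1.trans (neg_inv_smul_eq_iff (M := E →L[ℝ] ℝ) hσ)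

variable [FiniteDimensional ℝ E] [T2Space Q]
  {L : ExtTangent E Q → ℝ} {h T : ℝ} {V : Set (ExtTangent E Q)} {D : Set (Q × Q × ℝ)}
  {R : Q × Q × ℝ → ExtTangent E Q} {q : ℝ → Q} {z : ℝ → ℝ}

/-- The flow of `ξ_L` advances the lift of a solution of the Herglotz equations. -/
lemma IsHerglotzSolution.lagrangianFlow_eq (hL : ContMDiff (modelTR E) 𝓘(ℝ, ℝ) ∞ L)
    (hreg : IsRegularLagrangian L) (hh : 0 < h)
    (hsol : IsHerglotzSolution (E := E) L (Icc 0 T) q z) {s : ℝ} (hs : 0 ≤ s) (hsT : s + h ≤ T) :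
    lagrangianFlow L h (velocityLift (Icc 0 T) q z s) = velocityLift (Icc 0 T) q z (s + h) := by
  have hT : 0 < T := by linarith
  have hcurve := hsol.isMIntegralCurveOn hL hreg (uniqueDiffOn_Icc hT)
  obtain ⟨γ, hγ, he⟩ := hcurve.exists_isFlowLine
    (isLocallyConformal_lagrangianVF hL hreg).isLocallyRepOn isOpen_univ hT.le
    (fun _ _ => mem_univ _)
  have h1 := (hγ.mono hsT).shift hs
  rw [he ⟨hs, by linarith⟩] at h1
  rw [_root_.lagrangianFlow_eq hL hreg h1 ⟨hh.le, le_rfl⟩, add_comm h s,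
    he ⟨by linarith, hsT⟩]

lemma IsHerglotzSolution.lagrangianFlow_nat (hL : ContMDiff (modelTR E) 𝓘(ℝ, ℝ) ∞ L)
    (hreg : IsRegularLagrangian L) (hh : 0 < h) {N : ℕ}
    (hsol : IsHerglotzSolution (E := E) L (Icc 0 (N * h)) q z) {k : ℕ} (hk : k < N) :
    lagrangianFlow L h (velocityLift (Icc 0 (N * h)) q z (k * h)) =
      velocityLift (Icc 0 (N * h)) q z ((k + 1 : ℕ) * h) := by
  have h1 : ((k + 1 : ℕ) : ℝ) * h = k * h + h := by push_cast; ring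
  have h2 : ((k + 1 : ℕ) : ℝ) ≤ N := Nat.cast_le.2 hk
  rw [h1]
  exact hsol.lagrangianFlow_eq hL hreg hh (by positivity)
    (h1 ▸ mul_le_mul_of_nonneg_right h2 hh.le)

lemma IsHerglotzSolution.contactExp_nat (hL : ContMDiff (modelTR E) 𝓘(ℝ, ℝ) ∞ L)
    (hreg : IsRegularLagrangian L) (hh : 0 < h) {N : ℕ}
    (hsol : IsHerglotzSolution (E := E) L (Icc 0 (N * h)) q z) {k : ℕ} (hk : k < N) :
    contactExp L h (velocityLift (Icc 0 (N * h)) q z (k * h)) =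
      (q (k * h), q ((k + 1 : ℕ) * h), z (k * h)) := by
  rw [contactExp, hsol.lagrangianFlow_nat hL hreg hh hk]
  rfl

namespace IsExactRetraction

/-- The Legendre transforms of the exact discrete Lagrangian are related by the contact Hamiltonian
flow. -/
lemma discLegendrePlus_eq_flowMap (hR : IsExactRetraction L h V D R)
    (hL : ContMDiff (modelTR E) 𝓘(ℝ, ℝ) ∞ L) (hreg : IsRegularLagrangian L) (hh : 0 < h)
    {O : Set (ExtTangent E Q)} {H : ExtCotangent E Q → ℝ} (hO : IsOpen O)
    (hH : ∀ x ∈ O, H (legendre L x) = energy L x) {p : Q × Q × ℝ} (hp : p ∈ D)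
    (hmem : ∀ t ∈ Icc 0 h, lagrangianFlow L t (R p) ∈ O) :
    discLegendreMinus (exactDiscreteLagrangian L h R) p ∈
        flowDomain (modelCR E) (hamiltonianVF H) (legendre L '' O) h ∧
      discLegendrePlus (exactDiscreteLagrangian L h R) p =
        flowMap (modelCR E) (hamiltonianVF H) (legendre L '' O) h
          (discLegendreMinus (exactDiscreteLagrangian L h R) p) := by
  obtain ⟨-, hm, hp'⟩ := hR.discLegendre_eq hL hreg hh hp
  obtain ⟨γ, hγ⟩ := hR.mem_flowDomain hp
  have hflow : ∀ t ∈ Icc 0 h, lagrangianFlow L t (R p) = γ t := fun t ht =>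
    lagrangianFlow_eq hL hreg hγ ht
  have hline : IsFlowLine (modelCR E) (hamiltonianVF H) (legendre L '' O) h (legendre L (R p))
      (fun t => legendre L (γ t)) := by
    obtain ⟨h0, ε, hε, -, hcurve⟩ := hγ
    obtain ⟨δ, hδ, hδε, hδO⟩ := exists_forall_Ioo_mem hO hh.le hε hcurve.continuousOn
      (fun t ht => hflow t ht ▸ hmem t ht)
    refine ⟨congrArg (legendre L) h0, δ, hδ, fun t ht => mem_image_of_mem _ (hδO t ht), ?_⟩
    exact (hcurve.mono (Ioo_subset_Ioo (neg_le_neg hδε) (by linarith))).legendre hL hreg hO hH hδO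
  have := t2Space_extCotangent (E := E) (Q := Q)
  rw [hm, hp']
  refine ⟨⟨_, hline⟩, ?_⟩
  rw [flowMap_eq (isLocallyRepOn_hamiltonianVF hL hreg hO hH) hh.le hline,
    hflow h ⟨hh.le, le_rfl⟩]

variable {N : ℕ}

/-- The retraction recovers the lift of a solution of the Herglotz equations from its samples. -/
lemma eq_velocityLift (hR : IsExactRetraction L h V D R)
    (hL : ContMDiff (modelTR E) 𝓘(ℝ, ℝ) ∞ L) (hreg : IsRegularLagrangian L) (hh : 0 < h)
    (hsol : IsHerglotzSolution (E := E) L (Icc 0 (N * h)) q z) {k : ℕ} (hk : k < N)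
    (hV : velocityLift (Icc 0 (N * h)) q z (k * h) ∈ V) :
    R (q (k * h), q ((k + 1 : ℕ) * h), z (k * h)) =
      velocityLift (Icc 0 (N * h)) q z (k * h) := by
  rw [← hsol.contactExp_nat hL hreg hh hk, hR.invOn.1 hV]

/-- The samples of a solution of the Herglotz equations solve the discrete Herglotz equations: at
each sampled time, both Legendre transforms give the momentum of the solution. -/
lemma isDiscreteHerglotzSolution (hR : IsExactRetraction L h V D R)
    (hL : ContMDiff (modelTR E) 𝓘(ℝ, ℝ) ∞ L) (hreg : IsRegularLagrangian L) (hh : 0 < h)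
    (hsol : IsHerglotzSolution (E := E) L (Icc 0 (N * h)) q z)
    (hV : ∀ k < N, velocityLift (Icc 0 (N * h)) q z (k * h) ∈ V) :
    IsDiscreteHerglotzSolution E (exactDiscreteLagrangian L h R) D N
      (fun k => q (k * h)) (fun k => z (k * h)) := by
  set c := velocityLift (E := E) (Icc 0 (N * h)) q z with hc
  have hflow := fun k (hk : k < N) => hsol.lagrangianFlow_nat hL hreg hh hk
  have hmem : ∀ k < N, (q (k * h), q ((k + 1 : ℕ) * h), z (k * h)) ∈ D := fun k hk =>
    hsol.contactExp_nat hL hreg hh hk ▸ hR.mapsTo_exp (hV k hk)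
  have hinv := fun k hk => hR.eq_velocityLift hL hreg hh hsol hk (hV k hk)
  have hact : ∀ k < N, z ((k + 1 : ℕ) * h) - z (k * h) =
      exactDiscreteLagrangian L h R (q (k * h), q ((k + 1 : ℕ) * h), z (k * h)) := fun k hk => by
    rw [hR.exactDiscreteLagrangian_eq hL hreg hh (hmem k hk), hinv k hk, hflow k hk]
    rfl
  refine ⟨hmem, hact, fun k hk => ?_⟩
  have hk' : k < N := (Nat.lt_succ_self k).trans hk
  have h1 := hR.discLegendre_eq hL hreg hh (hmem k hk')
  have h2 := hR.discLegendre_eq hL hreg hh (hmem (k + 1) hk)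
  refine (discLegendreMinus_eq_discLegendrePlus_iff h2.1
    (by rw [← hact k hk']; ring)).1 (h2.2.1.trans (Eq.trans ?_ h1.2.2.symm))
  rw [hinv k hk', hinv (k + 1) hk, hflow k hk']

/-- A discrete solution follows the continuous one as long as the momenta at the sampled points
determine the velocities. -/
lemma discrete_solution_unique (hR : IsExactRetraction L h V D R)
    (hL : ContMDiff (modelTR E) 𝓘(ℝ, ℝ) ∞ L) (hreg : IsRegularLagrangian L) (hh : 0 < h)
    (hN : 1 ≤ N) (hsol : IsHerglotzSolution (E := E) L (Icc 0 (N * h)) q z)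
    (hV : velocityLift (Icc 0 (N * h)) q z 0 ∈ V) {q' : ℕ → Q} {z' : ℕ → ℝ}
    (hsol' : IsDiscreteHerglotzSolution E (exactDiscreteLagrangian L h R) D N q' z')
    (hq0 : q' 0 = q 0) (hq1 : q' 1 = q h) (hz0 : z' 0 = z 0)
    (hinj : ∀ k < N, legendre L (R (q' k, q' (k + 1), z' k)) =
        legendre L (velocityLift (Icc 0 (N * h)) q z (k * h)) →
      R (q' k, q' (k + 1), z' k) = velocityLift (Icc 0 (N * h)) q z (k * h)) :
    ∀ k ≤ N, q' k = q (k * h) ∧ z' k = z (k * h) := by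
  set c := velocityLift (E := E) (Icc 0 (N * h)) q z with hc
  have hflow := fun k (hk : k < N) => hsol.lagrangianFlow_nat hL hreg hh hk
  -- matching momenta: `FL (R p_{k+1}) = F⁻(p_{k+1}) = F⁺(p_k) = FL (φ_h (R p_k))`
  have key : ∀ k < N, R (q' k, q' (k + 1), z' k) = c (k * h) := by
    intro k
    induction k with
    | zero =>
      intro hk
      rw [zero_add, hq0, hq1, hz0]
      have h1 := hR.eq_velocityLift hL hreg hh hsol hk (by simpa using hV)
      simpa using h1
    | succ k ih =>
      intro hk
      have hk' : k < N := (Nat.lt_succ_self k).trans hk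
      have h1 := hR.discLegendre_eq hL hreg hh (hsol'.mem k hk')
      have h2 := hR.discLegendre_eq hL hreg hh (hsol'.mem (k + 1) hk)
      refine hinj (k + 1) hk (h2.2.1.symm.trans ?_)
      refine ((discLegendreMinus_eq_discLegendrePlus_iff h2.1 ?_).2
        (hsol'.herglotz k hk)).trans ?_
      · rw [← hsol'.action k hk']; ring
      · rw [h1.2.2, ih hk', hflow k hk']
  intro k hk
  rcases hk.lt_or_eq with hk | rfl
  · exact ⟨(hR.base_eq (hsol'.mem k hk)).symm.trans (congrArg (fun x => x.1.1) (key k hk)),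
      (hR.action_eq (hsol'.mem k hk)).symm.trans (congrArg Prod.snd (key k hk))⟩
  · obtain ⟨m, rfl⟩ : ∃ m, k = m + 1 := Nat.exists_eq_succ_of_ne_zero (by omega)
    have hm : m < m + 1 := Nat.lt_succ_self m
    have h1 : lagrangianFlow L h (R (q' m, q' (m + 1), z' m)) = c ((m + 1 : ℕ) * h) := by
      rw [key m hm, hflow m hm]
    refine ⟨(hR.base_flow_eq (hsol'.mem m hm)).symm.trans (congrArg (fun x => x.1.1) h1), ?_⟩
    have h2 := hsol'.action m hm
    rw [hR.exactDiscreteLagrangian_eq hL hreg hh (hsol'.mem m hm)] at h2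
    exact (sub_left_injective h2).trans (congrArg Prod.snd h1)

end IsExactRetraction

end Discrete

theorem mainTheorem7 {E : Type*} [NormedAddCommGroup E] [NormedSpace ℝ E] [FiniteDimensional ℝ E]
    {Q : Type*} [TopologicalSpace Q] [T2Space Q] [ChartedSpace E Q] [IsManifold 𝓘(ℝ, E) ∞ Q]
    (L : ExtTangent E Q → ℝ) (hL : ContMDiff (modelTR E) 𝓘(ℝ, ℝ) ∞ L)
    (hreg : IsRegularLagrangian L) (h : ℝ) (hh : 0 < h)
    (V : Set (ExtTangent E Q)) (D : Set (Q × Q × ℝ)) (R : Q × Q × ℝ → ExtTangent E Q)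
    (hR : IsExactRetraction L h V D R) :
    -- (1) the exact discrete Lagrangian is a regular discrete Lagrangian
    IsRegularDiscreteLagrangian E (exactDiscreteLagrangian L h R) D ∧
    -- (2) the discrete Legendre transforms are related by the contact Hamiltonian flow of any
    -- Hamiltonian `H` corresponding to `L` (`O = univ` is the hyperregular case)
    (∀ (O : Set (ExtTangent E Q)) (H : ExtCotangent E Q → ℝ), IsOpen O →
      (∀ x ∈ O, H (legendre L x) = energy L x) →
      ∀ p ∈ D, (∀ t ∈ Icc 0 h, lagrangianFlow L t (R p) ∈ O) →
        discLegendreMinus (exactDiscreteLagrangian L h R) p ∈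
            flowDomain (modelCR E) (hamiltonianVF H) (legendre L '' O) h ∧
          discLegendrePlus (exactDiscreteLagrangian L h R) p =
            flowMap (modelCR E) (hamiltonianVF H) (legendre L '' O) h
              (discLegendreMinus (exactDiscreteLagrangian L h R) p)) ∧
    -- (3) the discrete solutions sample the continuous ones
    (∀ (N : ℕ), 1 ≤ N → ∀ (q : ℝ → Q) (z : ℝ → ℝ),
      IsHerglotzSolution L (Icc 0 (N * h)) q z →
      ((∀ k < N, velocityLift (Icc 0 (N * h)) q z (k * h) ∈ V) →
        -- the sampled sequence solves the discrete Herglotz equations,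
        IsDiscreteHerglotzSolution E (exactDiscreteLagrangian L h R) D N
            (fun k => q (k * h)) (fun k => z (k * h)) ∧
        -- and it is the only solution near it with the same initial conditions
        ∃ U : ℕ → Set (Q × Q × ℝ),
          (∀ k < N, IsOpen (U k) ∧ (q (k * h), q ((k + 1) * h), z (k * h)) ∈ U k) ∧
          ∀ (q' : ℕ → Q) (z' : ℕ → ℝ),
            IsDiscreteHerglotzSolution E (exactDiscreteLagrangian L h R) D N q' z' →
            q' 0 = q 0 → q' 1 = q h → z' 0 = z 0 →
            (∀ k < N, (q' k, q' (k + 1), z' k) ∈ U k) →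
            ∀ k ≤ N, q' k = q (k * h) ∧ z' k = z (k * h)) ∧
      -- if the Legendre transformation is injective, it is the only solution altogether
      (Function.Injective (legendre L) → velocityLift (Icc 0 (N * h)) q z 0 ∈ V →
        ∀ (q' : ℕ → Q) (z' : ℕ → ℝ),
          IsDiscreteHerglotzSolution E (exactDiscreteLagrangian L h R) D N q' z' →
          q' 0 = q 0 → q' 1 = q h → z' 0 = z 0 →
          ∀ k ≤ N, q' k = q (k * h) ∧ z' k = z (k * h))) := by
  refine ⟨hR.isRegularDiscreteLagrangian hL hreg hh,
    fun O H hO hH p hp hmem => hR.discLegendrePlus_eq_flowMap hL hreg hh hO hH hp hmem,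
    fun N hN q z hsol => ⟨fun hV => ?_, fun hinj hV q' z' hsol' hq0 hq1 hz0 =>
      hR.discrete_solution_unique hL hreg hh hN hsol hV hsol' hq0 hq1 hz0
        fun _ _ he => hinj he⟩⟩
  have hsamp := hR.isDiscreteHerglotzSolution hL hreg hh hsol hV
  -- neighbourhoods on which the Legendre transformation is injective
  choose Φ hΦ hΦL using fun k : ℕ => isLocalDiffeomorph_legendre hL hreg
    (velocityLift (Icc 0 (N * h)) q z (k * h))
  refine ⟨hsamp, fun k => D ∩ R ⁻¹' (Φ k).source, fun k hk => ⟨?_, ?_⟩, ?_⟩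
  · exact hR.smooth_inv.continuousOn.isOpen_inter_preimage hR.isOpen_target (Φ k).open_source
  · have h1 := hsamp.mem k hk
    have h2 := hR.eq_velocityLift hL hreg hh hsol hk (hV k hk)
    simp only [Nat.cast_add, Nat.cast_one] at h1 h2
    exact ⟨h1, by rw [mem_preimage, h2]; exact hΦ k⟩
  · intro q' z' hsol' hq0 hq1 hz0 hU
    have hV0 : velocityLift (Icc 0 (N * h)) q z 0 ∈ V := by simpa using hV 0 hN
    refine hR.discrete_solution_unique hL hreg hh hN hsol hV0 hsol' hq0 hq1 hz0 fun k hk he => ?_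
    refine (Φ k).injOn (hU k hk).2 (hΦ k) ?_
    rw [hΦL k (hU k hk).2, hΦL k (hΦ k)] at he
    exact he
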